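/- Let $0=k_1<k_2<\dots<k_n=k$ be integers with $\gcd(k_2,\dots,k_n)=1$, let $A=\begin{bmatrix}1&\cdots&1\\k_1&\cdots&k_n\end{bmatrix}$, and let $H_A(\beta)$, $\beta\in\mathbb C^2$, be the $A$-hypergeometric system: $\partial^u\Phi=\partial^v\Phi$ for all $u,v\in\mathbb N^n$ with $Au=Av$, $\sum_j x_j\partial_j\Phi=\beta_1\Phi$ and $\sum_j k_jx_j\partial_j\Phi=\beta_2\Phi$. Let $G_0=\mathbb N\{k_2,\dots,k_n\}$ and $G_k=\mathbb N\{k-k_1,\dots,k-k_{n-1}\}$. The polar locus $\mathrm{Pol}(A)\subset\mathbb C^2$ is the union of the polar lines $L_0(N)=\{\beta_2=N\}$, $N\in G_0$, and $L_k(N)=\{k\beta_1-\beta_2=N\}$, $N\in G_k$. For $x\in\mathbb C^n$ with $x_1x_n\neq0$ let $f(z)=\sum_i x_iz^{k_i}$. For a connected component $\Theta\subset\mathbb R/2\pi\mathbb Z$ of the complement of the set of arguments of the zeros of $f$, and for continuous branches of $\log z$ and $\log f(z)$ on the sector $S_\Theta=\{z\ne0:\arg z\in\Theta\}$, the Euler–Mellin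 integral is $M_f^\Theta(x,\beta)=\int_{\arg z=\theta}f(z)^{\beta_1}z^{-\beta_2}\frac{dz}{z}$ with any $\theta\in\Theta$. The extended Euler–Mellin integral is the entire function $\beta\mapsto\Psi_f^\Theta(x,\beta)$ such that $$M_f^\Theta(x,\beta)=\frac{\Psi_f^\Theta(x,\beta)}{\Gamma(-\beta_1)}\,\Gamma(-\beta_2)\,\Gamma(\beta_2-k\beta_1)\prod_{\kappa\in\mathbb N\setminus G_0}(\beta_2-\kappa)\prod_{\kappa\in\mathbb N\setminus G_k}(k\beta_1-\beta_2-\kappa)$$ whenever $\operatorname{Re}\beta_2<0$ and $\operatorname{Re}(k\beta_1-\beta_2)<0$ (where the integral converges and does not depend on $\theta\in\Theta$); it exists and is unique. The branches determine a logarithm $v$ of $x_1$, namely $v=\lim_{z\to0}\log f(z)$, and a logarithm $v$ of $x_n$, namely $v=\lim_{z\to\infty}(\log f(z)-k\log z)$, the limits being taken in $S_\Theta$. **Theorem.** Let $L\subset\mathbb C^2$ be a complex affine line contained in $\mathrm{Pol}(A)$. Then either $L=L_0(N)$ with $N\in G_0$, and we set $w_i=k_i$, $b=1$, $G=G_0$,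 $G'=G_k$; or $L=L_k(N)$ with $N\in G_k$, and we set $w_i=k-k_i$, $b=n$, $G=G_k$, $G'=G_0$. Let $P$ be the finite set of finite sequences $p=(p_1,\dots,p_l)$ of indices $p_j\neq b$ with $w_{p_1}+\dots+w_{p_l}=N$, write $|p|=l$, let $\ell$ be the smallest length of an element of $P$, and for a logarithm $v$ of $x_b$ put $$S_v(x,\lambda)=e^{\lambda v}\sum_{p\in P}\ \prod_{i=\ell}^{|p|-1}(\lambda-i)\ \prod_{j=1}^{|p|}\frac{w_{p_j}}{N-(w_{p_1}+\dots+w_{p_{j-1}})}\cdot\frac{x_{p_j}}{x_b},$$ a finitely supported series in $x$. There is an entire function $h$ of $\lambda$, independent of $x$, of $\Theta$ and of the branches, given for $\lambda\notin\mathbb N$, $k\lambda-N\notin\mathbb N$ by $$h(\lambda)=\frac{(-1)^{N+\ell}\,N!\;\Gamma(\ell-\lambda)}{\Gamma(N-k\lambda)\,\prod_{\kappa\in\mathbb N\setminus G}(N-\kappa)\,\prod_{\kappa\in\mathbb N\setminus G'}(k\lambda-N-\kappa)},$$ such that the following hold. 1. For every $x$ with $x_1x_n\ne0$, every component $\Theta$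 and all branches, $\Psi_f^\Theta(x,\beta)=h(\beta_1)\,S_v(x,\beta_1)$ for all $\beta\in L$, where $v$ is the logarithm of $x_b$ determined by the branches. For every logarithm $v$ of $x_b$, each component $\Theta$ has branches that determine $v$, and all extended Euler–Mellin integrals whose branches determine the same $v$ coincide on $L$. 2. For every nonempty open $U\subset\mathbb C^n\setminus V(x_1x_n)$ and every continuous branch $v(x)$ of $\log x_b$ on $U$, the function $S_{v(x)}(x,\beta_1)$ is analytic in $(x,\beta)$ on $U\times L$, and for each $\beta\in L$ it is, as a function of $x\in U$, a solution of $H_A(\beta)$ that is not identically zero. -/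

import Mathlib

namespace ToricCurve

open Filter Topology MeasureTheory

/-- The exponents `0 = k 0 < k 1 < ⋯ < k n` of a projective toric curve: the matrix `A` has the
`n + 1` columns `(1, k i)`. The gcd condition says that the columns generate `ℤ²`
(in particular `n ≥ 1`). -/
structure IsCurve {n : ℕ} (k : Fin (n + 1) → ℕ) : Prop where
  zero : k 0 = 0
  strictMono : StrictMono k
  gcd_eq_one : Finset.univ.gcd k = 1

/-- The degree of the curve, i.e. the largest exponent. -/
def degree {n : ℕ} (k : Fin (n + 1) → ℕ) : ℕ := k (Fin.last n)

/-- The polynomial function `f(z) = ∑ x i * z ^ k i`. -/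
noncomputable def poly {n : ℕ} (k : Fin (n + 1) → ℕ) (x : Fin (n + 1) → ℂ) (z : ℂ) : ℂ :=
  ∑ i, x i * z ^ k i

/-! ### Facets and the polar locus -/

/-- The two facets of the cone over the columns of `A`: `origin` is spanned by the first column
`(1, 0)`, and `infinity` by the last column `(1, degree k)`. -/
inductive Facet where
  | origin
  | infinity

/-- The facet opposite to a given one. -/
def Facet.opp : Facet → Facet
  | .origin => .infinity
  | .infinity => .origin

/-- The index of the column of `A` that spans the facet. -/
def Facet.vertex {n : ℕ} : Facet → Fin (n + 1)
  | .origin => 0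
  | .infinity => Fin.last n

/-- Lattice distance of the exponents from the facet: `k i`, respectively `degree k - k i`. -/
def Facet.weight {n : ℕ} (k : Fin (n + 1) → ℕ) : Facet → Fin (n + 1) → ℕ
  | .origin => k
  | .infinity => fun i => degree k - k i

/-- The linear form on the parameter space that vanishes on the span of the facet and takes the
value `weight k F i` on the `i`-th column of `A`: `β₂`, respectively `degree k * β₁ - β₂`. -/
def Facet.form {n : ℕ} (k : Fin (n + 1) → ℕ) : Facet → ℂ × ℂ → ℂ
  | .origin => fun β => β.2
  | .infinity => fun β => degree k * β.1 - β.2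

/-- The numerical monoid of the facet. -/
def Facet.monoid {n : ℕ} (k : Fin (n + 1) → ℕ) (F : Facet) : AddSubmonoid ℕ :=
  AddSubmonoid.closure (Set.range (F.weight k))

/-- The product of the linear factors `s - κ` over the (finitely many) gaps `κ` of the monoid. -/
noncomputable def Facet.gapProd {n : ℕ} (k : Fin (n + 1) → ℕ) (F : Facet) (s : ℂ) : ℂ :=
  ∏ᶠ (κ : ℕ) (_ : κ ∉ F.monoid k), (s - κ)

/-- The line of parameters on which the form of the facet equals `N`. -/
def polarLine {n : ℕ} (k : Fin (n + 1) → ℕ) (F : Facet) (N : ℕ) : Set (ℂ × ℂ) :=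
  {β | F.form k β = N}

/-- The polar locus of `A`. -/
def polarLocus {n : ℕ} (k : Fin (n + 1) → ℕ) : Set (ℂ × ℂ) :=
  {β | ∃ F : Facet, ∃ N ∈ F.monoid k, β ∈ polarLine k F N}

/-! ### Euler–Mellin integrals -/

/-- The coamoeba of `f`: the set of arguments of its zeros in `ℂ^*`. -/
def coamoeba {n : ℕ} (k : Fin (n + 1) → ℕ) (x : Fin (n + 1) → ℂ) : Set Real.Angle :=
  (fun z : ℂ => (Complex.arg z : Real.Angle)) '' {z | z ≠ 0 ∧ poly k x z = 0}

/-- `Θ` is a connected component of the complement of the coamoeba. -/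
def IsComponent {n : ℕ} (k : Fin (n + 1) → ℕ) (x : Fin (n + 1) → ℂ) (Θ : Set Real.Angle) : Prop :=
  ∃ θ ∈ (coamoeba k x)ᶜ, Θ = connectedComponentIn (coamoeba k x)ᶜ θ

/-- The open sector of all `z ≠ 0` with argument in `Θ`. -/
def sector (Θ : Set Real.Angle) : Set ℂ :=
  {z | z ≠ 0 ∧ (Complex.arg z : Real.Angle) ∈ Θ}

/-- `lz` and `lf` are branches of `log z` and of `log f(z)` on the sector of `Θ`. They fix the
meaning of `z ^ (-β₂)` and `f(z) ^ β₁` there. -/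
structure IsBranch {n : ℕ} (k : Fin (n + 1) → ℕ) (x : Fin (n + 1) → ℂ) (Θ : Set Real.Angle)
    (lz lf : ℂ → ℂ) : Prop where
  continuousOn_z : ContinuousOn lz (sector Θ)
  exp_z : ∀ z ∈ sector Θ, Complex.exp (lz z) = z
  continuousOn_f : ContinuousOn lf (sector Θ)
  exp_f : ∀ z ∈ sector Θ, Complex.exp (lf z) = poly k x z

/-- The point of absolute value `r` on the ray with argument `θ`. -/
noncomputable def rayPoint (θ : Real.Angle) (r : ℝ) : ℂ := (r : ℂ) * (θ.toCircle : ℂ)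

/-- The integrand `f(z) ^ β₁ * z ^ (-β₂) dz / z` on the ray with argument `θ`, in terms of
`r = |z|`; on the ray `dz / z = dr / r`. -/
noncomputable def integrand (lz lf : ℂ → ℂ) (θ : Real.Angle) (β : ℂ × ℂ) (r : ℝ) : ℂ :=
  Complex.exp (β.1 * lf (rayPoint θ r) - β.2 * lz (rayPoint θ r)) / r

/-- The Euler–Mellin integral along the ray with argument `θ`. -/
noncomputable def eulerMellin (lz lf : ℂ → ℂ) (θ : Real.Angle) (β : ℂ × ℂ) : ℂ :=
  ∫ r in Set.Ioi (0 : ℝ), integrand lz lf θ β r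

/-- The tubular domain of convergence of the Euler–Mellin integrals. -/
def convergenceDomain {n : ℕ} (k : Fin (n + 1) → ℕ) : Set (ℂ × ℂ) :=
  {β | ∀ F : Facet, (F.form k β).re < 0}

/-- `Ψ` is the extended Euler–Mellin integral, as a function of `β`, of the component `Θ` and the
branches `lz`, `lf`: it is entire, and for `β` in the domain of convergence the Euler–Mellin
integral over the ray of any `θ ∈ Θ` converges and is the product of `Ψ β` with the stated
Gamma factors and linear factors. -/
structure IsExtendedEulerMellin {n : ℕ} (k : Fin (n + 1) → ℕ) (Θ : Set Real.Angle)
    (lz lf : ℂ → ℂ) (Ψ : ℂ × ℂ → ℂ) : Prop where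
  entire : Differentiable ℂ Ψ
  integrable : ∀ θ ∈ Θ, ∀ β ∈ convergenceDomain k,
    IntegrableOn (integrand lz lf θ β) (Set.Ioi (0 : ℝ))
  eq : ∀ θ ∈ Θ, ∀ β ∈ convergenceDomain k,
    eulerMellin lz lf θ β =
      Ψ β / Complex.Gamma (-β.1)
        * Complex.Gamma (-(Facet.origin.form k β)) * Complex.Gamma (-(Facet.infinity.form k β))
        * Facet.origin.gapProd k (Facet.origin.form k β)
        * Facet.infinity.gapProd k (Facet.infinity.form k β)

/-- The logarithm `v` of the coefficient of `f` at the vertex of the facet that the branches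
determine: `log f(z) → v` as `z → 0`, respectively `log f(z) - degree k * log z → v` as
`z → ∞`, in the sector. -/
def IsVertexLog {n : ℕ} (k : Fin (n + 1) → ℕ) (Θ : Set Real.Angle) (lz lf : ℂ → ℂ) (v : ℂ) :
    Facet → Prop
  | .origin => Tendsto lf (𝓝[sector Θ] 0) (𝓝 v)
  | .infinity =>
      Tendsto (fun z => lf z - degree k * lz z) (Bornology.cobounded ℂ ⊓ 𝓟 (sector Θ)) (𝓝 v)

/-! ### The finitely supported series -/

/-- Ordered partitions of `N` of length `l` with nonzero parts among the `w i`, given by the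
sequences of the indices of their parts. -/
def orderedPartitions {n : ℕ} (w : Fin (n + 1) → ℕ) (N l : ℕ) : Finset (Fin l → Fin (n + 1)) :=
  {p | (∀ j, w (p j) ≠ 0) ∧ ∑ j, w (p j) = N}

/-- The smallest length of an ordered partition of `N`. -/
noncomputable def minLength {n : ℕ} (w : Fin (n + 1) → ℕ) (N : ℕ) : ℕ :=
  sInf {l | (orderedPartitions w N l).Nonempty}

/-- The finite sum, over the ordered partitions `p` of `N` with parts the nonzero `w i`, of
the monomials `x_b ^ t * ∏_j (x_{p_j} / x_b)`, with the coefficients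
`∏_{i = ℓ}^{|p| - 1} (t - i) * ∏_j w_{p_j} / (N - s_j)`; here `ℓ` is the smallest length of such a
partition, and `s_j` is the sum of the parts of `p` that precede the part number `j`. The
argument `v` is a logarithm of `x_b`, which fixes the branch of `x_b ^ t`. -/
noncomputable def polarSeries {n : ℕ} (w : Fin (n + 1) → ℕ) (b : Fin (n + 1)) (N : ℕ)
    (v : ℂ) (x : Fin (n + 1) → ℂ) (t : ℂ) : ℂ :=
  Complex.exp (t * v) *
    ∑ l ∈ Finset.range (N + 1), ∑ p ∈ orderedPartitions w N l,
      (∏ i ∈ Finset.Ico (minLength w N) l, (t - i)) *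
        ∏ j : Fin l, (((w (p j) : ℂ) / ((N : ℂ) - ∑ i ∈ Finset.Iio j, (w (p i) : ℂ))) *
          (x (p j) / x b))

/-! ### The hypergeometric system -/

/-- The partial derivative with respect to the `j`-th coordinate. -/
noncomputable def partialDeriv {n : ℕ} (j : Fin (n + 1)) (Φ : (Fin (n + 1) → ℂ) → ℂ) :
    (Fin (n + 1) → ℂ) → ℂ :=
  fun x => fderiv ℂ Φ x (Pi.single j 1)

/-- The operator `∂ ^ u`. -/
noncomputable def monomialDeriv {n : ℕ} (u : Fin (n + 1) → ℕ) (Φ : (Fin (n + 1) → ℂ) → ℂ) :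
    (Fin (n + 1) → ℂ) → ℂ :=
  (List.finRange (n + 1)).foldr (fun j g => (partialDeriv j)^[u j] g) Φ

/-- `Φ` is an analytic solution on `U` of the `A`-hypergeometric system with parameter `β`: it is
annihilated by the toric operators `∂ ^ u - ∂ ^ v` with `A u = A v` and by the two Euler
operators, which generate the left ideal. -/
structure IsSolution {n : ℕ} (k : Fin (n + 1) → ℕ) (β : ℂ × ℂ) (U : Set (Fin (n + 1) → ℂ))
    (Φ : (Fin (n + 1) → ℂ) → ℂ) : Prop where
  analytic : AnalyticOnNhd ℂ Φ U
  toric : ∀ u v : Fin (n + 1) → ℕ, ∑ i, u i = ∑ i, v i → ∑ i, k i * u i = ∑ i, k i * v i →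
    ∀ x ∈ U, monomialDeriv u Φ x = monomialDeriv v Φ x
  euler_one : ∀ x ∈ U, ∑ j, x j * partialDeriv j Φ x = β.1 * Φ x
  euler_two : ∀ x ∈ U, ∑ j, (k j : ℂ) * x j * partialDeriv j Φ x = β.2 * Φ x

/-- The complement of `V(x_1 x_n)`: the first and the last coordinate are nonzero. -/
def nonzeroEnds (n : ℕ) : Set (Fin (n + 1) → ℂ) :=
  {x | x 0 ≠ 0 ∧ x (Fin.last n) ≠ 0}

end ToricCurve

open ToricCurve

/-!
Let `F` be a facet with opposite facet `F'`, let `w i` be its weights, and write `F β` for the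
linear form of `F`. Integrating the derivative of `f(z) ^ β₁ * z ^ (-β₂)` gives the contiguity
relation `F β * M β = β₁ * ∑ i, w i * x i * M (β - a i)`, where `a i` is the `i`-th column of `A`.
Iterating it for both facets continues `M`, and shows that `M` divided by the two Gamma factors is
an entire function of `β`, which vanishes at the gaps of the two monoids.

On the line `F β = N` the contiguity relation becomes the recursion for the coefficient of `s ^ N`
in `(∑ i, x i * s ^ w i) ^ β₁`, and the boundary term `exp (β₁ * v)` on `F β = 0` is the coefficient
of `s ^ 0`. Hence the residue of `M` along the line is a Taylor coefficient of a complex power of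
`f`. The polar series is this coefficient without the factor `∏ i ∈ range ℓ, (β₁ - i)`. Taylor
coefficients of powers, and of their primitives and derivatives, are permuted by the operators
`∂ⱼ`, and so they solve the hypergeometric system. The shortest partitions of `N` give a
constant-coefficient operator which maps the polar series to a multiple of a power of `x b`, so the
series does not vanish.
-/

namespace ToricCurve

open Filter Topology MeasureTheory

/-! ### Taylor expansion of a complex power of a polynomial -/

section TaylorCoeff

variable {ι : Type*} [Fintype ι]

/-- The coefficient of `z ^ N` in `(∑ x i * z ^ w i) ^ l / l!`, where only the terms with
`w i ≠ 0` enter the sum. The degree `N` is an integer, so that it may drop below `0`. -/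
noncomputable def powCoeff (w : ι → ℕ) (x : ι → ℂ) : ℕ → ℤ → ℂ
  | 0, N => if N = 0 then 1 else 0
  | l + 1, N => (∑ i with w i ≠ 0, x i * powCoeff w x l (N - w i)) / (l + 1)

variable (w : ι → ℕ) (x : ι → ℂ)

theorem succ_mul_powCoeff_succ (l : ℕ) (N : ℤ) :
    (l + 1 : ℂ) * powCoeff w x (l + 1) N =
      ∑ i with w i ≠ 0, x i * powCoeff w x l (N - w i) :=
  mul_div_cancel₀ _ l.cast_add_one_ne_zero

theorem powCoeff_eq_zero_of_lt {l : ℕ} {N : ℤ} (h : N < l) : powCoeff w x l N = 0 := by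
  induction l generalizing N with
  | zero => exact if_neg (by omega)
  | succ l ih =>
    rw [powCoeff, Finset.sum_eq_zero, zero_div]
    intro i hi
    have hi : w i ≠ 0 := (Finset.mem_filter.1 hi).2
    rw [ih (by omega), mul_zero]

/-- Euler's relation `z * (q ^ (l + 1))' = (l + 1) * q ^ l * (z * q')`, coefficientwise. -/
theorem intCast_mul_powCoeff_succ (l : ℕ) (N : ℤ) :
    (N : ℂ) * powCoeff w x (l + 1) N =
      ∑ i with w i ≠ 0, w i * (x i * powCoeff w x l (N - w i)) := by
  apply mul_left_cancel₀ (l.cast_add_one_ne_zero : (l + 1 : ℂ) ≠ 0)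
  rw [mul_left_comm, succ_mul_powCoeff_succ]
  induction l generalizing N with
  | zero =>
    rw [Finset.mul_sum, Finset.mul_sum]
    refine Finset.sum_congr rfl fun i _ => ?_
    by_cases hN : N = w i
    · simp [hN]
    · simp [powCoeff, sub_eq_zero, hN]
  | succ l ih =>
    have split_degree (i : ι) : (N : ℂ) * (x i * powCoeff w x (l + 1) (N - w i)) =
        ∑ j with w j ≠ 0, w j * (x i * (x j * powCoeff w x l (N - w j - w i))) +
          w i * (x i * powCoeff w x (l + 1) (N - w i)) := by
      have euler : ∑ j with w j ≠ 0, w j * (x j * powCoeff w x l (N - w i - w j)) =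
          ((N - w i : ℤ) : ℂ) * powCoeff w x (l + 1) (N - w i) := by
        apply mul_left_cancel₀ (l.cast_add_one_ne_zero : (l + 1 : ℂ) ≠ 0)
        rw [← ih (N - w i), ← succ_mul_powCoeff_succ, mul_left_comm]
      simp only [sub_right_comm (N : ℤ) (w _ : ℤ) (w i : ℤ)]
      simp only [mul_left_comm _ (x i), ← Finset.mul_sum, euler]
      push_cast
      ring
    simp only [Finset.mul_sum (a := (N : ℂ)), split_degree, Finset.sum_add_distrib]
    rw [Finset.sum_comm]
    simp only [← Finset.mul_sum, mul_left_comm (x _) (x _), ← succ_mul_powCoeff_succ]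
    simp only [mul_left_comm (x _) (l + 1 : ℂ), mul_left_comm (w _ : ℂ) (l + 1 : ℂ),
      ← Finset.mul_sum]
    push_cast
    ring

/-- The derivative of order `s` of `y ^ t / ∏ i ∈ Finset.range m, (t - i)` at `y = exp v`, with the
vanishing factors cancelled; it is meant for `m ≤ s`. -/
noncomputable def powDeriv (t : ℂ) (m s : ℕ) (v : ℂ) : ℂ :=
  (∏ i ∈ Finset.Ico m s, (t - i)) * Complex.exp ((t - s) * v)

theorem exp_mul_powDeriv_succ {t : ℂ} {m s : ℕ} (h : m ≤ s) (v : ℂ) :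
    Complex.exp v * powDeriv t m (s + 1) v = (t - s) * powDeriv t m s v := by
  have : Complex.exp ((t - s) * v) = Complex.exp v * Complex.exp ((t - (s + 1 : ℕ)) * v) := by
    rw [← Complex.exp_add]
    push_cast
    ring_nf
  rw [powDeriv, powDeriv, Finset.prod_Ico_succ_top h, this]
  ring

theorem powDeriv_zero_succ (t : ℂ) (s : ℕ) (v : ℂ) :
    powDeriv t 0 (s + 1) v = t * powDeriv (t - 1) 0 s v := by
  have exponent : t - ((s + 1 : ℕ) : ℂ) = t - 1 - s := by push_cast; ring
  have factors : ∏ i ∈ Finset.range s, (t - ((i + 1 : ℕ) : ℂ)) =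
      ∏ i ∈ Finset.range s, (t - 1 - i) :=
    Finset.prod_congr rfl fun i _ => by push_cast; ring
  rw [powDeriv, powDeriv, ← Finset.range_eq_Ico, ← Finset.range_eq_Ico, Finset.prod_range_succ',
    exponent, factors]
  push_cast
  ring

theorem hasDerivAt_powDeriv (t : ℂ) (m s : ℕ) (v : ℂ) :
    HasDerivAt (powDeriv t m s) ((t - s) * powDeriv t m s v) v := by
  refine (((hasDerivAt_id v).const_mul (t - s)).cexp.const_mul _).congr_deriv ?_
  simp only [powDeriv, id]
  ring

/-- The coefficient of `z ^ N` in the derivative of order `r` of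
`y ^ t / ∏ i ∈ Finset.range m, (t - i)` at `y = exp v + ∑ x i * z ^ w i`, by Taylor expansion around
`exp v`. -/
noncomputable def taylorCoeff (t v : ℂ) (m r : ℕ) (N : ℤ) : ℂ :=
  ∑ l ∈ Finset.range (N.toNat + 1), powDeriv t m (l + r) v * powCoeff w x l N

theorem taylorCoeff_eq_sum_range (t v : ℂ) (m r : ℕ) {N : ℤ} {M : ℕ} (h : N < M) :
    taylorCoeff w x t v m r N =
      ∑ l ∈ Finset.range M, powDeriv t m (l + r) v * powCoeff w x l N := by
  have extend {M' : ℕ} (hM' : N < M') (hle : M' ≤ max (N.toNat + 1) M) :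
      ∑ l ∈ Finset.range M', powDeriv t m (l + r) v * powCoeff w x l N =
        ∑ l ∈ Finset.range (max (N.toNat + 1) M), powDeriv t m (l + r) v * powCoeff w x l N :=
    Finset.sum_subset (Finset.range_subset_range.2 hle) fun l _ hl => by
      rw [Finset.mem_range, not_lt] at hl
      rw [powCoeff_eq_zero_of_lt w x (by omega), mul_zero]
  rw [taylorCoeff, extend (by omega) (le_max_left _ _), extend h (le_max_right _ _)]

theorem taylorCoeff_of_neg (t v : ℂ) (m r : ℕ) {N : ℤ} (hN : N < 0) :
    taylorCoeff w x t v m r N = 0 :=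
  (taylorCoeff_eq_sum_range w x t v m r (M := 0) hN).trans (Finset.sum_range_zero _)

theorem taylorCoeff_zero (t v : ℂ) (m r : ℕ) : taylorCoeff w x t v m r 0 = powDeriv t m r v := by
  simp [taylorCoeff, powCoeff]

theorem taylorCoeff_zero_succ (t v : ℂ) (r : ℕ) (N : ℤ) :
    taylorCoeff w x t v 0 (r + 1) N = t * taylorCoeff w x (t - 1) v 0 r N := by
  simp only [taylorCoeff, ← add_assoc, powDeriv_zero_succ, Finset.mul_sum, mul_assoc]

theorem sum_powDeriv_mul_powCoeff_sub (t v : ℂ) (m r : ℕ) {N : ℤ} {M : ℕ} (hM : N < M + 1)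
    (a : ι → ℂ) :
    ∑ l ∈ Finset.range M, powDeriv t m (l + 1 + r) v *
        ∑ i with w i ≠ 0, a i * powCoeff w x l (N - w i) =
      ∑ i with w i ≠ 0, a i * taylorCoeff w x t v m (r + 1) (N - w i) := by
  simp only [Finset.mul_sum]
  rw [Finset.sum_comm]
  refine Finset.sum_congr rfl fun i hi => ?_
  have hi : w i ≠ 0 := (Finset.mem_filter.1 hi).2
  rw [taylorCoeff_eq_sum_range w x t v m (r + 1) (M := M) (by omega), Finset.mul_sum]
  refine Finset.sum_congr rfl fun l _ => ?_
  rw [mul_left_comm, add_right_comm, add_assoc]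

theorem intCast_mul_taylorCoeff (t v : ℂ) (m r : ℕ) (N : ℤ) :
    (N : ℂ) * taylorCoeff w x t v m r N =
      ∑ i, w i * x i * taylorCoeff w x t v m (r + 1) (N - w i) := by
  have constant_term : (N : ℂ) * powCoeff w x 0 N = 0 := by
    by_cases hN : N = 0 <;> simp [powCoeff, hN]
  calc (N : ℂ) * taylorCoeff w x t v m r N
      = ∑ l ∈ Finset.range N.toNat, powDeriv t m (l + 1 + r) v *
          ∑ i with w i ≠ 0, w i * x i * powCoeff w x l (N - w i) := by
        simp only [taylorCoeff, Finset.sum_range_succ', mul_add, mul_left_comm (N : ℂ),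
          constant_term, mul_zero, add_zero, Finset.mul_sum (a := (N : ℂ)),
          intCast_mul_powCoeff_succ, mul_assoc]
    _ = ∑ i with w i ≠ 0, w i * x i * taylorCoeff w x t v m (r + 1) (N - w i) :=
        sum_powDeriv_mul_powCoeff_sub w x t v m r (by omega) _
    _ = ∑ i, w i * x i * taylorCoeff w x t v m (r + 1) (N - w i) := by
        rw [Finset.sum_filter]
        refine Finset.sum_congr rfl fun i _ => ?_
        split_ifs with hi
        · rfl
        · simp [not_not.1 hi]

variable {w x}

theorem sum_eq_add_sum_weight_ne_zero {E : Type*} [AddCommMonoid E] {b : ι}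
    (hw : ∀ i, w i = 0 ↔ i = b) (g : ι → E) : ∑ i, g i = g b + ∑ i with w i ≠ 0, g i := by
  classical
  have : ({i | w i ≠ 0} : Finset ι) = Finset.univ.erase b := by
    ext i
    simp [hw]
  rw [this, Finset.add_sum_erase _ _ (Finset.mem_univ b)]

theorem sum_mul_taylorCoeff_succ {b : ι} (hw : ∀ i, w i = 0 ↔ i = b) {t v : ℂ}
    (hv : Complex.exp v = x b) {m r : ℕ} {N : ℤ}
    (hm : ∀ l, l + r < m → powCoeff w x l N = 0) :
    ∑ i, x i * taylorCoeff w x t v m (r + 1) (N - w i) = (t - r) * taylorCoeff w x t v m r N := by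
  have vertex_term (l : ℕ) : x b * (powDeriv t m (l + (r + 1)) v * powCoeff w x l N) =
      (t - (l + r : ℕ)) * (powDeriv t m (l + r) v * powCoeff w x l N) := by
    rcases lt_or_ge (l + r) m with h | h
    · rw [hm l h]
      ring
    · rw [← hv, ← mul_assoc, ← add_assoc, exp_mul_powDeriv_succ h, mul_assoc]
  have other_terms : ∑ i with w i ≠ 0, x i * taylorCoeff w x t v m (r + 1) (N - w i) =
      ∑ l ∈ Finset.range (N.toNat + 1),
        (l : ℂ) * (powDeriv t m (l + r) v * powCoeff w x l N) := by
    rw [← sum_powDeriv_mul_powCoeff_sub w x t v m r (M := N.toNat) (by omega),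
      Finset.sum_range_succ', Nat.cast_zero, zero_mul, add_zero]
    refine Finset.sum_congr rfl fun l _ => ?_
    rw [← succ_mul_powCoeff_succ, mul_left_comm, Nat.cast_succ]
  rw [sum_eq_add_sum_weight_ne_zero hw, other_terms, (hw b).2 rfl, Nat.cast_zero, sub_zero,
    taylorCoeff, taylorCoeff, Finset.mul_sum, Finset.mul_sum, ← Finset.sum_add_distrib]
  refine Finset.sum_congr rfl fun l _ => ?_
  rw [vertex_term]
  push_cast
  ring

variable (w) in
theorem hasFDerivAt_powCoeff_succ (x : ι → ℂ) (l : ℕ) (N : ℤ) :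
    HasFDerivAt (fun x => powCoeff w x (l + 1) N)
      (∑ i with w i ≠ 0, powCoeff w x l (N - w i) •
        ContinuousLinearMap.proj (R := ℂ) (φ := fun _ : ι => ℂ) i) x := by
  induction l generalizing N with
  | zero =>
    simp only [powCoeff, Nat.cast_zero, zero_add, div_one]
    exact HasFDerivAt.fun_sum fun i _ => (hasFDerivAt_apply i x).mul_const _
  | succ l ih =>
    have recursion := (HasFDerivAt.fun_sum (u := {i | w i ≠ 0}) fun i _ =>
      (hasFDerivAt_apply (𝕜 := ℂ) i x).mul (ih (N - w i))).mul_const ((l + 1 : ℕ) + 1 : ℂ)⁻¹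
    have exchange (e : ι → ℂ) :
        ∑ i with w i ≠ 0, x i * ∑ j with w j ≠ 0, powCoeff w x l (N - w i - w j) * e j =
          (l + 1) * ∑ j with w j ≠ 0, powCoeff w x (l + 1) (N - w j) * e j := by
      simp only [Finset.mul_sum, ← mul_assoc, succ_mul_powCoeff_succ, Finset.sum_mul]
      rw [Finset.sum_comm]
      simp only [sub_right_comm]
    refine recursion.congr_fderiv (ContinuousLinearMap.ext fun e => ?_)
    rw [smul_apply, smul_eq_mul,
      inv_mul_eq_iff_eq_mul₀ (Nat.cast_add_one_ne_zero (l + 1))]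
    simp only [sum_apply, smul_apply,
      ContinuousLinearMap.proj_apply, add_apply, smul_eq_mul,
      Finset.sum_add_distrib, exchange]
    push_cast
    ring

variable (w) in
theorem differentiable_powCoeff (l : ℕ) (N : ℤ) : Differentiable ℂ fun x => powCoeff w x l N
  | x => match l with
    | 0 => differentiableAt_const _
    | l + 1 => (hasFDerivAt_powCoeff_succ w x l N).differentiableAt

theorem powCoeff_sub_eq_zero {m r : ℕ} {N : ℤ}
    (hm : ∀ l, l + r < m → ∀ x, powCoeff w x l N = 0) (j : ι) (l : ℕ) (hl : l + (r + 1) < m)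
    (x : ι → ℂ) : powCoeff w x l (N - w j) = 0 := by
  classical
  by_cases hj : w j = 0
  · simpa [hj] using hm l (by omega) x
  · have hzero : (fun x => powCoeff w x (l + 1) N) = fun _ => 0 := funext (hm _ (by omega))
    have hderiv := (hzero ▸ hasFDerivAt_powCoeff_succ w x l N).unique
      (hasFDerivAt_const (0 : ℂ) x)
    have := congrArg (fun L : (ι → ℂ) →L[ℂ] ℂ => L (Pi.single j 1)) hderiv
    simpa [Pi.single_apply, hj] using this

end TaylorCoeff

theorem analyticAt_of_exp_eq {E : Type*} [NormedAddCommGroup E] [NormedSpace ℂ E]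
    {l F : E → ℂ} {p : E} (hl : ContinuousAt l p) (hF : AnalyticAt ℂ F p)
    (h : ∀ᶠ q in 𝓝 p, Complex.exp (l q) = F q) : AnalyticAt ℂ l p := by
  have hp : Complex.exp (l p) = F p := h.self_of_nhds
  have hne : F p ≠ 0 := hp ▸ Complex.exp_ne_zero _
  have principal : AnalyticAt ℂ (fun q => l p + Complex.log (F q / F p)) p := by
    refine analyticAt_const.add ((hF.div analyticAt_const hne).clog ?_)
    rw [Pi.div_apply, div_self hne]
    exact Complex.one_mem_slitPlane
  have close : ∀ᶠ q in 𝓝 p, ‖l q - l p‖ < 1 :=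
    (hl.eventually (Metric.ball_mem_nhds _ one_pos)).mono fun q hq => mem_ball_iff_norm.1 hq
  refine principal.congr ?_
  filter_upwards [h, close] with q hq hclose
  have him := abs_lt.1 ((Complex.abs_im_le_norm _).trans_lt hclose)
  have hpi := Real.pi_gt_three
  rw [← hq, ← hp, ← Complex.exp_sub, Complex.log_exp (by linarith) (by linarith)]
  ring

/-- `v` is a continuous branch of the logarithm of the coordinate `b` on the open set `U`. -/
structure IsLogBranch {ι : Type*} (b : ι) (U : Set (ι → ℂ)) (v : (ι → ℂ) → ℂ) : Prop where
  isOpen : IsOpen U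
  continuousOn : ContinuousOn v U
  exp_eq : ∀ x ∈ U, Complex.exp (v x) = x b

namespace IsLogBranch

variable {ι : Type*} {b : ι} {U : Set (ι → ℂ)} {v : (ι → ℂ) → ℂ} {x : ι → ℂ}

theorem ne_zero (h : IsLogBranch b U v) (hx : x ∈ U) : x b ≠ 0 :=
  h.exp_eq x hx ▸ Complex.exp_ne_zero _

theorem analyticAt [Fintype ι] (h : IsLogBranch b U v) (hx : x ∈ U) : AnalyticAt ℂ v x :=
  analyticAt_of_exp_eq (h.continuousOn.continuousAt (h.isOpen.mem_nhds hx))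
    ((ContinuousLinearMap.proj (R := ℂ) (φ := fun _ : ι => ℂ) b).analyticAt x)
    (eventually_of_mem (h.isOpen.mem_nhds hx) h.exp_eq)

theorem hasFDerivAt [Finite ι] (h : IsLogBranch b U v) (hx : x ∈ U) :
    HasFDerivAt v (Complex.exp (-v x) • ContinuousLinearMap.proj (R := ℂ) (φ := fun _ : ι => ℂ) b)
      x := by
  have := Fintype.ofFinite ι
  have hv := (h.analyticAt hx).differentiableAt.hasFDerivAt
  have hexp : HasFDerivAt (fun y => Complex.exp (v y))
      (ContinuousLinearMap.proj (R := ℂ) (φ := fun _ : ι => ℂ) b) x :=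
    (hasFDerivAt_apply b x).congr_of_eventuallyEq
      (eventually_of_mem (h.isOpen.mem_nhds hx) h.exp_eq)
  rwa [← hv.cexp.unique hexp, smul_smul, ← Complex.exp_add, neg_add_cancel, Complex.exp_zero,
    one_smul]

variable [Fintype ι] {w : ι → ℕ}

theorem hasFDerivAt_taylorCoeff (h : IsLogBranch b U v)
    (hw : ∀ i, w i = 0 ↔ i = b) (t : ℂ) {m r : ℕ} {N : ℤ}
    (hm : ∀ l, l + r < m → ∀ x, powCoeff w x l N = 0) (hx : x ∈ U) :
    HasFDerivAt (fun x => taylorCoeff w x t (v x) m r N)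
      (∑ j, taylorCoeff w x t (v x) m (r + 1) (N - w j) •
        ContinuousLinearMap.proj (R := ℂ) (φ := fun _ : ι => ℂ) j) x := by
  have hpow (s : ℕ) := (hasDerivAt_powDeriv t m s (v x)).comp_hasFDerivAt x (h.hasFDerivAt hx)
  have vertex_factor (l : ℕ) : powCoeff w x l N * (t - (l + r : ℕ)) * powDeriv t m (l + r) (v x) *
      Complex.exp (-v x) =
      powDeriv t m (l + (r + 1)) (v x) * powCoeff w x l N := by
    rcases lt_or_ge (l + r) m with hl | hl
    · rw [hm l hl, mul_zero, zero_mul, zero_mul, zero_mul]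
    · rw [mul_assoc _ (t - _ : ℂ), mul_assoc (powCoeff w x l N), ← exp_mul_powDeriv_succ hl,
        mul_right_comm, ← Complex.exp_add, add_neg_cancel, Complex.exp_zero, one_mul, mul_comm,
        ← add_assoc]
  refine (HasFDerivAt.fun_sum fun l _ => (hpow (l + r)).mul
    (differentiable_powCoeff w l N x).hasFDerivAt).congr_fderiv
      (ContinuousLinearMap.ext fun e => ?_)
  have constant_term : fderiv ℂ (fun x => powCoeff w x 0 N) x = 0 := fderiv_const_apply _
  have other_terms : ∑ l ∈ Finset.range (N.toNat + 1), powDeriv t m (l + r) (v x) *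
      fderiv ℂ (fun x => powCoeff w x l N) x e =
      ∑ j with w j ≠ 0, e j * taylorCoeff w x t (v x) m (r + 1) (N - w j) := by
    rw [← sum_powDeriv_mul_powCoeff_sub w x t (v x) m r (M := N.toNat) (by omega),
      Finset.sum_range_succ', constant_term, zero_apply, mul_zero, add_zero]
    simp [(hasFDerivAt_powCoeff_succ w x _ N).fderiv, mul_comm]
  simp only [sum_apply, add_apply, smul_apply, ContinuousLinearMap.proj_apply, smul_eq_mul,
    Finset.sum_add_distrib, Function.comp_apply, other_terms, ← mul_assoc, vertex_factor]
  rw [sum_eq_add_sum_weight_ne_zero hw, (hw b).2 rfl, Nat.cast_zero, sub_zero, add_comm,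
    ← Finset.sum_mul, ← taylorCoeff]
  simp only [mul_comm (e _)]

end IsLogBranch

/-! ### Derivatives of the series -/

section PartialDeriv

variable {n : ℕ} {U : Set (Fin (n + 1) → ℂ)} {Φ Φ' : (Fin (n + 1) → ℂ) → ℂ}

theorem partialDeriv_congr (hU : IsOpen U) (h : Set.EqOn Φ Φ' U) (j : Fin (n + 1)) :
    Set.EqOn (partialDeriv j Φ) (partialDeriv j Φ') U := fun x hx => by
  rw [partialDeriv, partialDeriv, (h.eventuallyEq_of_mem (hU.mem_nhds hx)).fderiv_eq]

theorem monomialDeriv_eqOn_zero (hU : IsOpen U) (h : Set.EqOn Φ 0 U) (u : Fin (n + 1) → ℕ) :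
    Set.EqOn (monomialDeriv u Φ) 0 U := by
  have partialDeriv_eqOn_zero (j : Fin (n + 1)) {Φ : (Fin (n + 1) → ℂ) → ℂ}
      (h : Set.EqOn Φ 0 U) : Set.EqOn (partialDeriv j Φ) 0 U := fun x hx => by
    rw [partialDeriv_congr hU h j hx, partialDeriv, fderiv_zero]
    rfl
  rw [monomialDeriv]
  induction List.finRange (n + 1) with
  | nil => exact h
  | cons j L ih =>
    rw [List.foldr_cons]
    induction u j with
    | zero => exact ih
    | succ a ih' =>
      rw [Function.iterate_succ_apply']
      exact partialDeriv_eqOn_zero j ih'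

end PartialDeriv

/-- On `U`, the function `Φ` is the coefficient `taylorCoeff w x t (v x) m r N`, and only terms
enter into it in which `powDeriv` is a derivative of order at least `m`. -/
structure IsTaylorCoeffOn {n : ℕ} (w : Fin (n + 1) → ℕ) (t : ℂ) (m : ℕ)
    (U : Set (Fin (n + 1) → ℂ)) (v : (Fin (n + 1) → ℂ) → ℂ) (r : ℕ) (N : ℤ)
    (Φ : (Fin (n + 1) → ℂ) → ℂ) : Prop where
  powCoeff_eq_zero : ∀ l, l + r < m → ∀ x, powCoeff w x l N = 0
  eqOn : Set.EqOn Φ (fun x => taylorCoeff w x t (v x) m r N) U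

namespace IsTaylorCoeffOn

variable {n : ℕ} {b : Fin (n + 1)} {w : Fin (n + 1) → ℕ} {U : Set (Fin (n + 1) → ℂ)}
  {v : (Fin (n + 1) → ℂ) → ℂ} {t : ℂ} {m r : ℕ} {N : ℤ} {Φ : (Fin (n + 1) → ℂ) → ℂ}

theorem partialDeriv (hΦ : IsTaylorCoeffOn w t m U v r N Φ) (hv : IsLogBranch b U v)
    (hw : ∀ i, w i = 0 ↔ i = b) (j : Fin (n + 1)) :
    IsTaylorCoeffOn w t m U v (r + 1) (N - w j) (partialDeriv j Φ) where
  powCoeff_eq_zero := powCoeff_sub_eq_zero hΦ.powCoeff_eq_zero j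
  eqOn x hx := by
    rw [partialDeriv_congr hv.isOpen hΦ.eqOn j hx, ToricCurve.partialDeriv,
      (hv.hasFDerivAt_taylorCoeff hw t hΦ.powCoeff_eq_zero hx).fderiv]
    simp [Pi.single_apply]

theorem iterate_partialDeriv (hΦ : IsTaylorCoeffOn w t m U v r N Φ) (hv : IsLogBranch b U v)
    (hw : ∀ i, w i = 0 ↔ i = b) (j : Fin (n + 1)) (a : ℕ) :
    IsTaylorCoeffOn w t m U v (a + r) (N - (w j * a : ℕ)) ((ToricCurve.partialDeriv j)^[a] Φ) := by
  induction a with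
  | zero => simpa using hΦ
  | succ a ih =>
    rw [Function.iterate_succ_apply']
    convert ih.partialDeriv hv hw j using 1
    · ring
    · push_cast
      ring

theorem monomialDeriv (hΦ : IsTaylorCoeffOn w t m U v r N Φ) (hv : IsLogBranch b U v)
    (hw : ∀ i, w i = 0 ↔ i = b) (u : Fin (n + 1) → ℕ) :
    IsTaylorCoeffOn w t m U v (∑ j, u j + r) (N - (∑ j, w j * u j : ℕ)) (monomialDeriv u Φ) := by
  rw [Fin.sum_univ_def, Fin.sum_univ_def, ToricCurve.monomialDeriv]
  induction List.finRange (n + 1) with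
  | nil => simpa using hΦ
  | cons j L ih =>
    convert ih.iterate_partialDeriv hv hw j (u j) using 1
    · rw [List.map_cons, List.sum_cons, add_assoc]
    · rw [List.map_cons, List.sum_cons]
      push_cast
      ring
    · rw [List.foldr_cons]

end IsTaylorCoeffOn

/-! ### Ordered partitions -/

section OrderedPartitions

variable {n : ℕ} (w : Fin (n + 1) → ℕ)

variable {w} in
theorem mem_orderedPartitions {N l : ℕ} {p : Fin l → Fin (n + 1)} :
    p ∈ orderedPartitions w N l ↔ (∀ j, w (p j) ≠ 0) ∧ ∑ j, w (p j) = N := by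
  simp [orderedPartitions]

variable {w} in
theorem cons_mem_orderedPartitions {N l : ℕ} {i : Fin (n + 1)} {p : Fin l → Fin (n + 1)} :
    (Fin.cons i p : Fin (l + 1) → Fin (n + 1)) ∈ orderedPartitions w N (l + 1) ↔
      (w i ≠ 0 ∧ w i ≤ N) ∧ p ∈ orderedPartitions w (N - w i) l := by
  simp only [mem_orderedPartitions, Fin.forall_fin_succ, Fin.sum_univ_succ, Fin.cons_zero,
    Fin.cons_succ]
  constructor
  · rintro ⟨⟨hi, hp⟩, hsum⟩
    exact ⟨⟨hi, by omega⟩, hp, by omega⟩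
  · rintro ⟨⟨hi, hle⟩, hp, hsum⟩
    exact ⟨⟨hi, hp⟩, by omega⟩

theorem sum_orderedPartitions_succ {M : Type*} [AddCommMonoid M] (N l : ℕ)
    (g : (Fin (l + 1) → Fin (n + 1)) → M) :
    ∑ p ∈ orderedPartitions w N (l + 1), g p =
      ∑ i with w i ≠ 0 ∧ w i ≤ N, ∑ p ∈ orderedPartitions w (N - w i) l, g (Fin.cons i p) := by
  have indicator {l N : ℕ} (g : (Fin l → Fin (n + 1)) → M) :
      ∑ p ∈ orderedPartitions w N l, g p =
        ∑ p, if p ∈ orderedPartitions w N l then g p else 0 := by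
    rw [Finset.sum_ite_mem, Finset.univ_inter]
  rw [indicator, ← (Fin.consEquiv fun _ => Fin (n + 1)).sum_comp, Fintype.sum_prod_type,
    Finset.sum_filter]
  refine Finset.sum_congr rfl fun i _ => ?_
  have consEquiv_eq (p : Fin l → Fin (n + 1)) :
      Fin.consEquiv (fun _ => Fin (n + 1)) (i, p) = Fin.cons i p := rfl
  simp only [consEquiv_eq, cons_mem_orderedPartitions]
  by_cases hi : w i ≠ 0 ∧ w i ≤ N
  · rw [if_pos hi, indicator]
    simp only [and_iff_right hi]
  · rw [if_neg hi]
    simp only [hi, false_and, if_false, Finset.sum_const_zero]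

/-- The coefficient of the ordered partition `p` of `N` in `polarSeries`, without its factor that
depends on the exponent. -/
noncomputable def partitionWeight (N : ℕ) {l : ℕ} (p : Fin l → Fin (n + 1)) : ℂ :=
  ∏ j, (w (p j) : ℂ) / ((N : ℂ) - ∑ i ∈ Finset.Iio j, (w (p i) : ℂ))

theorem partitionWeight_cons {N l : ℕ} {i : Fin (n + 1)} (hi : w i ≤ N)
    (p : Fin l → Fin (n + 1)) :
    partitionWeight w N (Fin.cons i p : Fin (l + 1) → Fin (n + 1)) =
      w i / N * partitionWeight w (N - w i) p := by
  have partial_sum (j : Fin l) : ∑ m ∈ Finset.Iio j.succ,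
      (w ((Fin.cons i p : Fin (l + 1) → Fin (n + 1)) m) : ℂ) =
        w i + ∑ m ∈ Finset.Iio j, (w (p m) : ℂ) := by
    have : Finset.Iio j.succ = Finset.cons 0 ((Finset.Iio j).map (Fin.succEmb l)) (by simp) := by
      ext m
      refine Fin.cases ?_ (fun m => ?_) m <;> simp
    rw [this, Finset.sum_cons, Finset.sum_map]
    simp
  have : Finset.Iio (0 : Fin (l + 1)) = ∅ := by ext m; simp
  rw [partitionWeight, Fin.prod_univ_succ, this, Finset.sum_empty, sub_zero]
  simp only [partial_sum, Fin.cons_zero, Fin.cons_succ, partitionWeight, Nat.cast_sub hi, sub_sub]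

theorem powCoeff_eq_sum_orderedPartitions (x : Fin (n + 1) → ℂ) (l N : ℕ) :
    powCoeff w x l N = ∑ p ∈ orderedPartitions w N l, partitionWeight w N p * ∏ j, x (p j) := by
  induction l generalizing N with
  | zero =>
    rcases eq_or_ne N 0 with rfl | hN
    · simp [powCoeff, orderedPartitions, partitionWeight]
    · simp [powCoeff, orderedPartitions, hN, hN.symm]
  | succ l ih =>
    rw [sum_orderedPartitions_succ]
    rcases Nat.eq_zero_or_pos N with rfl | hN
    · rw [powCoeff_eq_zero_of_lt w x (by positivity), Finset.filter_eq_empty_iff.2,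
        Finset.sum_empty]
      rintro i - ⟨hi, hle⟩
      omega
    have hN : (N : ℂ) ≠ 0 := by exact_mod_cast hN.ne'
    have euler := intCast_mul_powCoeff_succ w x l N
    rw [Int.cast_natCast] at euler
    apply mul_left_cancel₀ hN
    rw [euler, ← Finset.filter_filter, Finset.sum_filter (w · ≤ N), Finset.mul_sum]
    refine Finset.sum_congr rfl fun i _ => ?_
    split_ifs with hi
    · simp only [← Nat.cast_sub hi, ih, partitionWeight_cons w hi, Fin.prod_univ_succ,
        Fin.cons_zero, Fin.cons_succ, Finset.mul_sum]
      refine Finset.sum_congr rfl fun p _ => ?_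
      field_simp
    · rw [powCoeff_eq_zero_of_lt w x (by omega), mul_zero, mul_zero, mul_zero]

theorem orderedPartitions_minLength_nonempty {N : ℕ}
    (hN : N ∈ AddSubmonoid.closure (Set.range w)) :
    (orderedPartitions w N (minLength w N)).Nonempty := by
  refine Nat.sInf_mem (s := {l | (orderedPartitions w N l).Nonempty}) ?_
  induction hN using AddSubmonoid.closure_induction_left with
  | zero => exact ⟨0, Fin.elim0, mem_orderedPartitions.2 ⟨fun j => j.elim0, by simp⟩⟩
  | add_left y hy N _ ih =>
    obtain ⟨i, rfl⟩ := hy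
    obtain ⟨l, p, hp⟩ := ih
    by_cases hi : w i = 0
    · exact ⟨l, p, by rwa [hi, zero_add]⟩
    · exact ⟨l + 1, Fin.cons i p, cons_mem_orderedPartitions.2
        ⟨⟨hi, Nat.le_add_right _ _⟩, by rwa [Nat.add_sub_cancel_left]⟩⟩

theorem powCoeff_eq_zero_of_lt_minLength {l N : ℕ} (hl : l < minLength w N)
    (x : Fin (n + 1) → ℂ) : powCoeff w x l N = 0 := by
  have : orderedPartitions w N l = ∅ :=
    Finset.not_nonempty_iff_eq_empty.1 (Nat.notMem_of_lt_sInf hl)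
  rw [powCoeff_eq_sum_orderedPartitions, this, Finset.sum_empty]

end OrderedPartitions

/-! ### The series solves the hypergeometric system -/

section PolarSeries

variable {n : ℕ} {b : Fin (n + 1)} {w : Fin (n + 1) → ℕ}

theorem polarSeries_eq_taylorCoeff {v : ℂ} {x : Fin (n + 1) → ℂ} (hv : Complex.exp v = x b)
    (N : ℕ) (t : ℂ) :
    polarSeries w b N v x t = taylorCoeff w x t v (minLength w N) 0 N := by
  rw [polarSeries, taylorCoeff, Finset.mul_sum, Int.toNat_natCast]
  refine Finset.sum_congr rfl fun l _ => ?_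
  have : Complex.exp ((t - l) * v) = Complex.exp (t * v) / x b ^ l := by
    rw [sub_mul, Complex.exp_sub, Complex.exp_nat_mul, hv]
  rw [powCoeff_eq_sum_orderedPartitions, Finset.mul_sum, Finset.mul_sum]
  refine Finset.sum_congr rfl fun p _ => ?_
  rw [add_zero, powDeriv, this, Finset.prod_mul_distrib, ← partitionWeight,
    Finset.prod_div_distrib, Finset.prod_const, Finset.card_univ, Fintype.card_fin]
  ring

theorem prod_mul_polarSeries {v : ℂ} {x : Fin (n + 1) → ℂ} (hv : Complex.exp v = x b)
    (N : ℕ) (t : ℂ) :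
    (∏ i ∈ Finset.range (minLength w N), (t - i)) * polarSeries w b N v x t =
      taylorCoeff w x t v 0 0 N := by
  rw [polarSeries_eq_taylorCoeff hv, taylorCoeff, taylorCoeff, Finset.mul_sum]
  refine Finset.sum_congr rfl fun l _ => ?_
  rcases lt_or_ge l (minLength w N) with hl | hl
  · rw [powCoeff_eq_zero_of_lt_minLength w hl, mul_zero, mul_zero, mul_zero]
  · rw [powDeriv, powDeriv, add_zero, ← Finset.prod_Ico_consecutive _ (Nat.zero_le _) hl,
      Finset.range_eq_Ico]
    ring

theorem analyticAt_polarSeries (N : ℕ) {v : (Fin (n + 1) → ℂ) → ℂ}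
    {q : (Fin (n + 1) → ℂ) × ℂ} (hv : AnalyticAt ℂ v q.1) (hb : q.1 b ≠ 0) :
    AnalyticAt ℂ (fun q : (Fin (n + 1) → ℂ) × ℂ => polarSeries w b N (v q.1) q.1 q.2) q := by
  have hx (i : Fin (n + 1)) : AnalyticAt ℂ (fun q : (Fin (n + 1) → ℂ) × ℂ => q.1 i) q :=
    ((ContinuousLinearMap.proj (R := ℂ) (φ := fun _ : Fin (n + 1) => ℂ) i).comp
      (ContinuousLinearMap.fst ℂ (Fin (n + 1) → ℂ) ℂ)).analyticAt q
  unfold polarSeries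
  refine (analyticAt_snd.mul (hv.comp_of_eq analyticAt_fst rfl)).cexp.mul ?_
  refine Finset.analyticAt_fun_sum _ fun l _ => Finset.analyticAt_fun_sum _ fun p _ => ?_
  refine (Finset.analyticAt_fun_prod _ fun i _ => analyticAt_snd.sub analyticAt_const).mul ?_
  exact Finset.analyticAt_fun_prod _ fun j _ => analyticAt_const.mul ((hx _).div (hx b) hb)

namespace IsLogBranch

variable {U : Set (Fin (n + 1) → ℂ)} {v : (Fin (n + 1) → ℂ) → ℂ}

theorem isTaylorCoeffOn_polarSeries (hv : IsLogBranch b U v) (N : ℕ) (t : ℂ) :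
    IsTaylorCoeffOn w t (minLength w N) U v 0 N fun x => polarSeries w b N (v x) x t where
  powCoeff_eq_zero _ hl := powCoeff_eq_zero_of_lt_minLength w hl
  eqOn x hx := polarSeries_eq_taylorCoeff (hv.exp_eq x hx) N t

theorem analyticOnNhd_polarSeries (hv : IsLogBranch b U v) (N : ℕ) :
    AnalyticOnNhd ℂ (fun q : (Fin (n + 1) → ℂ) × ℂ => polarSeries w b N (v q.1) q.1 q.2)
      (U ×ˢ Set.univ) :=
  fun _ hq => analyticAt_polarSeries N (hv.analyticAt hq.1) (hv.ne_zero hq.1)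

theorem monomialDeriv_polarSeries_eq (hv : IsLogBranch b U v) (hw : ∀ i, w i = 0 ↔ i = b)
    (N : ℕ) (t : ℂ) {u u' : Fin (n + 1) → ℕ} (hsum : ∑ i, u i = ∑ i, u' i)
    (hweight : ∑ i, w i * u i = ∑ i, w i * u' i) {x : Fin (n + 1) → ℂ} (hx : x ∈ U) :
    monomialDeriv u (fun x => polarSeries w b N (v x) x t) x =
      monomialDeriv u' (fun x => polarSeries w b N (v x) x t) x := by
  have hS := hv.isTaylorCoeffOn_polarSeries (w := w) N t
  rw [(hS.monomialDeriv hv hw u).eqOn hx, (hS.monomialDeriv hv hw u').eqOn hx, hsum, hweight]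

theorem sum_mul_partialDeriv_polarSeries (hv : IsLogBranch b U v) (hw : ∀ i, w i = 0 ↔ i = b)
    (N : ℕ) (t : ℂ) {x : Fin (n + 1) → ℂ} (hx : x ∈ U) :
    ∑ j, x j * partialDeriv j (fun x => polarSeries w b N (v x) x t) x =
      t * polarSeries w b N (v x) x t := by
  have hS := hv.isTaylorCoeffOn_polarSeries (w := w) N t
  simp only [(hS.partialDeriv hv hw _).eqOn hx, hS.eqOn hx]
  rw [sum_mul_taylorCoeff_succ hw (hv.exp_eq x hx) fun l hl => hS.powCoeff_eq_zero l hl x,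
    Nat.cast_zero, sub_zero]

theorem sum_weight_mul_partialDeriv_polarSeries (hv : IsLogBranch b U v)
    (hw : ∀ i, w i = 0 ↔ i = b) (N : ℕ) (t : ℂ) {x : Fin (n + 1) → ℂ} (hx : x ∈ U) :
    ∑ j, (w j : ℂ) * x j * partialDeriv j (fun x => polarSeries w b N (v x) x t) x =
      N * polarSeries w b N (v x) x t := by
  have hS := hv.isTaylorCoeffOn_polarSeries (w := w) N t
  simp only [(hS.partialDeriv hv hw _).eqOn hx, hS.eqOn hx]
  rw [← intCast_mul_taylorCoeff, Int.cast_natCast]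

/-- The indices of a shortest partition, counted with multiplicity, give an operator of order
`minLength w N` that lowers the degree `N` to `0`; there only an exponential is left. -/
theorem exists_polarSeries_ne_zero (hv : IsLogBranch b U v) (hne : U.Nonempty)
    (hw : ∀ i, w i = 0 ↔ i = b) {N : ℕ} (hN : N ∈ AddSubmonoid.closure (Set.range w)) (t : ℂ) :
    ∃ x ∈ U, polarSeries w b N (v x) x t ≠ 0 := by
  by_contra! vanishes
  obtain ⟨p, hp⟩ := orderedPartitions_minLength_nonempty w hN
  obtain ⟨x, hx⟩ := hne
  let u : Fin (n + 1) → ℕ := fun i => Finset.card {j | p j = i}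
  have count (f : Fin (n + 1) → ℕ) : ∑ i, f i * u i = ∑ j, f (p j) := by
    simp only [← Finset.sum_fiberwise' Finset.univ p f, Finset.sum_const, smul_eq_mul, u, mul_comm]
  have order : ∑ i, u i = minLength w N := by simpa using count fun _ => 1
  have degree : ∑ i, w i * u i = N := (count w).trans (mem_orderedPartitions.1 hp).2
  have hderiv := ((hv.isTaylorCoeffOn_polarSeries N t).monomialDeriv hv hw u).eqOn hx
  rw [monomialDeriv_eqOn_zero hv.isOpen vanishes u hx, order, degree, add_zero, sub_self] at hderiv
  beta_reduce at hderiv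
  rw [taylorCoeff_zero, powDeriv, Finset.Ico_self, Finset.prod_empty, one_mul] at hderiv
  exact Complex.exp_ne_zero _ hderiv.symm

end IsLogBranch

end PolarSeries

/-! ### Facets -/

section Facet

variable {n : ℕ} {k : Fin (n + 1) → ℕ}

theorem IsCurve.le_degree (hk : IsCurve k) (i : Fin (n + 1)) : k i ≤ degree k :=
  hk.strictMono.monotone (Fin.le_last i)

theorem IsCurve.degree_pos (hk : IsCurve k) : 0 < degree k := by
  by_contra h
  have hgcd : Finset.univ.gcd k = 0 := Finset.gcd_eq_zero_iff.2 fun i _ => by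
    have := hk.le_degree i
    omega
  exact one_ne_zero (hk.gcd_eq_one ▸ hgcd)

theorem IsCurve.weight_eq_zero_iff (hk : IsCurve k) (F : Facet) (i : Fin (n + 1)) :
    F.weight k i = 0 ↔ i = F.vertex := by
  cases F with
  | origin =>
    simp only [Facet.weight, Facet.vertex]
    rw [← hk.strictMono.injective.eq_iff, hk.zero]
  | infinity =>
    simp only [Facet.weight, Facet.vertex, Nat.sub_eq_zero_iff_le]
    rw [← hk.strictMono.injective.eq_iff]
    exact (hk.le_degree i).ge_iff_eq

theorem IsCurve.weight_add_weight_opp (hk : IsCurve k) (F : Facet) (i : Fin (n + 1)) :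
    F.weight k i + F.opp.weight k i = degree k := by
  have := hk.le_degree i
  cases F <;> simp only [Facet.weight, Facet.opp] <;> omega

theorem Facet.form_add_form_opp (F : Facet) (β : ℂ × ℂ) :
    F.form k β + F.opp.form k β = degree k * β.1 := by
  cases F <;> simp only [Facet.form, Facet.opp] <;> ring

/-- The columns of the matrix `A`. -/
def column (k : Fin (n + 1) → ℕ) (i : Fin (n + 1)) : ℂ × ℂ := (1, k i)

theorem IsCurve.form_sub_column (hk : IsCurve k) (F : Facet) (β : ℂ × ℂ) (i : Fin (n + 1)) :
    F.form k (β - column k i) = F.form k β - F.weight k i := by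
  cases F
  · simp [Facet.form, Facet.weight, column]
  · simp only [Facet.form, Facet.weight, column, Prod.fst_sub, Prod.snd_sub]
    rw [Nat.cast_sub (hk.le_degree i)]
    ring

theorem Facet.differentiable_form (F : Facet) : Differentiable ℂ (F.form k) := by
  cases F <;> simp only [Facet.form] <;> fun_prop

theorem Facet.form_sub (F : Facet) (β γ : ℂ × ℂ) :
    F.form k (β - γ) = F.form k β - F.form k γ := by
  cases F
  · rfl
  · simp only [Facet.form, Prod.fst_sub, Prod.snd_sub]
    ring

theorem IsCurve.finite_gaps (hk : IsCurve k) (F : Facet) : {κ | κ ∉ F.monoid k}.Finite := by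
  obtain ⟨m, hm⟩ := Nat.exists_mem_closure_of_ge (Set.range (F.weight k))
  refine (Set.finite_lt_nat m).subset fun κ hκ => ?_
  by_contra hlt
  refine hκ (hm κ (not_lt.1 hlt) ?_)
  suffices hgcd : Nat.setGcd (Set.range (F.weight k)) ∣ 1 from hgcd.trans (one_dvd κ)
  have hdvd : ∀ i, Nat.setGcd (Set.range (F.weight k)) ∣ F.weight k i := fun i =>
    Nat.setGcd_dvd_of_mem ⟨i, rfl⟩
  refine (Finset.dvd_gcd (f := k) (s := Finset.univ) fun i _ => ?_).trans hk.gcd_eq_one.dvd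
  cases F with
  | origin => exact hdvd i
  | infinity =>
    have hdegree := hdvd 0
    simp only [Facet.weight, hk.zero, Nat.sub_zero] at hdegree
    exact (Nat.dvd_sub_iff_right (hk.le_degree i) hdegree).1 (hdvd i)

/-- The finite set of gaps of the monoid of the facet. -/
noncomputable def IsCurve.gaps (hk : IsCurve k) (F : Facet) : Finset ℕ :=
  (hk.finite_gaps F).toFinset

theorem IsCurve.mem_gaps (hk : IsCurve k) (F : Facet) {κ : ℕ} :
    κ ∈ hk.gaps F ↔ κ ∉ F.monoid k :=
  (hk.finite_gaps F).mem_toFinset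

theorem IsCurve.gapProd_eq (hk : IsCurve k) (F : Facet) (s : ℂ) :
    F.gapProd k s = ∏ κ ∈ hk.gaps F, (s - κ) :=
  finprod_mem_eq_finite_toFinset_prod _ (hk.finite_gaps F)

theorem IsCurve.differentiable_gapProd (hk : IsCurve k) (F : Facet) :
    Differentiable ℂ (F.gapProd k) := by
  simp only [funext (hk.gapProd_eq F)]
  fun_prop

theorem IsCurve.gapProd_eq_zero_iff (hk : IsCurve k) (F : Facet) (s : ℂ) :
    F.gapProd k s = 0 ↔ ∃ κ : ℕ, κ ∉ F.monoid k ∧ s = κ := by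
  simp [hk.gapProd_eq, Finset.prod_eq_zero_iff, sub_eq_zero, hk.mem_gaps]

theorem IsCurve.gapProd_ne_zero_of_re_neg (hk : IsCurve k) (F : Facet) {s : ℂ} (hs : s.re < 0) :
    F.gapProd k s ≠ 0 := by
  rw [Ne, hk.gapProd_eq_zero_iff]
  rintro ⟨κ, -, rfl⟩
  simp only [Complex.natCast_re] at hs
  exact absurd hs (not_lt.2 (Nat.cast_nonneg κ))

theorem IsCurve.gapProd_natCast_ne_zero (hk : IsCurve k) (F : Facet) {N : ℕ}
    (hN : N ∈ F.monoid k) : F.gapProd k N ≠ 0 := by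
  rw [Ne, hk.gapProd_eq_zero_iff]
  rintro ⟨κ, hκ, h⟩
  exact hκ (Nat.cast_injective h ▸ hN)

theorem Facet.weight_mem_monoid (F : Facet) (i : Fin (n + 1)) : F.weight k i ∈ F.monoid k :=
  AddSubmonoid.subset_closure ⟨i, rfl⟩

theorem IsCurve.exists_mul_gapProd_eq (hk : IsCurve k) (F : Facet) {a : ℕ} (ha : a ∈ F.monoid k)
    {J : Finset ℕ} (hlt : ∀ j ∈ J, j < a) (hgap : ∀ j, j ∉ F.monoid k → j < a → j ∈ J) :
    ∃ R : ℂ → ℂ, Differentiable ℂ R ∧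
      ∀ s, R s * F.gapProd k s = (∏ j ∈ J, (j - s)) * F.gapProd k (s - a) := by
  let B : Finset ℕ := J ∪ (hk.gaps F).map (addRightEmbedding a)
  have hdisj : Disjoint J ((hk.gaps F).map (addRightEmbedding a)) := by
    rw [Finset.disjoint_left]
    intro j hj hj'
    have := hlt j hj
    simp only [Finset.mem_map, addRightEmbedding_apply] at hj'
    omega
  have hsub : hk.gaps F ⊆ B := by
    intro κ hκ
    rw [hk.mem_gaps] at hκ
    simp only [B, Finset.mem_union, Finset.mem_map, addRightEmbedding_apply, hk.mem_gaps]
    rcases lt_or_ge κ a with h | h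
    · exact Or.inl (hgap κ hκ h)
    · refine Or.inr ⟨κ - a, fun hmem => hκ ?_, Nat.sub_add_cancel h⟩
      have := (F.monoid k).add_mem hmem ha
      rwa [Nat.sub_add_cancel h] at this
  refine ⟨fun s => (-1) ^ J.card * ∏ κ ∈ B \ hk.gaps F, (s - κ), by fun_prop, fun s => ?_⟩
  rw [hk.gapProd_eq, hk.gapProd_eq, mul_assoc, Finset.prod_sdiff hsub, Finset.prod_union hdisj,
    Finset.prod_map, ← mul_assoc, ← Finset.prod_const, ← Finset.prod_mul_distrib]
  congr 1
  · exact Finset.prod_congr rfl fun j _ => by ring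
  · exact Finset.prod_congr rfl fun j _ => by simp only [addRightEmbedding_apply]; push_cast; ring

theorem IsCurve.exists_mem_monoid_opp_add_eq (hk : IsCurve k) (F : Facet) {N l m : ℕ}
    (hl : (orderedPartitions (F.weight k) N l).Nonempty) (hm : l ≤ m) :
    ∃ q ∈ F.opp.monoid k, N + q = degree k * m := by
  obtain ⟨p, hp⟩ := hl
  rw [mem_orderedPartitions] at hp
  refine ⟨∑ j, F.opp.weight k (p j) + (m - l) • F.opp.weight k F.vertex,
    (F.opp.monoid k).add_mem (sum_mem fun j _ => F.opp.weight_mem_monoid _)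
      (nsmul_mem (F.opp.weight_mem_monoid _) _), ?_⟩
  have hvertex : F.opp.weight k F.vertex = degree k := by
    rw [← hk.weight_add_weight_opp F F.vertex, (hk.weight_eq_zero_iff F _).2 rfl, zero_add]
  rw [hvertex, ← hp.2, ← add_assoc, ← Finset.sum_add_distrib]
  simp only [hk.weight_add_weight_opp F, Finset.sum_const, Finset.card_univ, Fintype.card_fin,
    smul_eq_mul]
  rw [← add_mul, Nat.add_sub_cancel' hm, mul_comm]

end Facet

theorem inv_Gamma_neg_eq (s : ℂ) (a : ℕ) :
    (Complex.Gamma (-s))⁻¹ = (∏ j ∈ Finset.range a, ((j : ℂ) - s)) * (Complex.Gamma (a - s))⁻¹ := by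
  induction a with
  | zero => simp
  | succ a ih =>
    have hrec := Complex.one_div_Gamma_eq_self_mul_one_div_Gamma_add_one (a - s)
    have hshift : ((a + 1 : ℕ) : ℂ) - s = a - s + 1 := by push_cast; ring
    rw [ih, Finset.prod_range_succ, hrec, hshift]
    ring

theorem differentiable_inv_Gamma_comp {g : ℂ → ℂ} (hg : Differentiable ℂ g) :
    Differentiable ℂ fun s => (Complex.Gamma (g s))⁻¹ :=
  Complex.differentiable_one_div_Gamma.comp hg

theorem deriv_inv_Gamma_neg_natCast_ne_zero (m : ℕ) :
    deriv (fun s : ℂ => (Complex.Gamma (-s))⁻¹) m ≠ 0 := by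
  let P : ℂ → ℂ := fun s =>
    (∏ j ∈ Finset.range m, ((j : ℂ) - s)) * (Complex.Gamma ((m + 1 : ℕ) - s))⁻¹
  have hP : Differentiable ℂ P :=
    Differentiable.mul (by fun_prop) (differentiable_inv_Gamma_comp (by fun_prop))
  have hfactor : (fun s : ℂ => (Complex.Gamma (-s))⁻¹) = fun s => (m - s) * P s := by
    funext s
    rw [inv_Gamma_neg_eq s (m + 1), Finset.prod_range_succ]
    ring
  have hderiv : HasDerivAt (fun s : ℂ => (m - s) * P s) (-1 * P m + (m - m) * deriv P m) m :=
    ((hasDerivAt_id (m : ℂ)).const_sub (m : ℂ)).mul (hP m).hasDerivAt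
  rw [hfactor, hderiv.deriv, sub_self, zero_mul, add_zero, neg_one_mul, neg_ne_zero]
  refine mul_ne_zero (Finset.prod_ne_zero_iff.2 fun j hj => ?_) ?_
  · rw [sub_ne_zero]
    exact_mod_cast (Finset.mem_range.1 hj).ne
  · simp

theorem exists_differentiable_eq_div {A B : ℂ → ℂ} (hA : Differentiable ℂ A)
    (hB : Differentiable ℂ B) (hzero : ∀ p, B p = 0 → A p = 0 ∧ deriv B p ≠ 0) :
    ∃ h : ℂ → ℂ, Differentiable ℂ h ∧ ∀ t, B t ≠ 0 → h t = A t / B t := by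
  classical
  refine ⟨fun t => if B t = 0 then deriv A t / deriv B t else A t / B t, fun p => ?_,
    fun t ht => if_neg ht⟩
  by_cases hp : B p = 0
  · obtain ⟨hAp, hdB⟩ := hzero p hp
    have hdslope : ∀ g : ℂ → ℂ, Differentiable ℂ g → DifferentiableAt ℂ (dslope g p) p :=
      fun g hg => ((Complex.differentiableOn_dslope univ_mem).2
        hg.differentiableOn).differentiableAt univ_mem
    have hne : dslope B p p ≠ 0 := by rwa [dslope_same]
    refine ((hdslope A hA).div (hdslope B hB) hne).congr_of_eventuallyEq ?_
    filter_upwards [(hdslope B hB).continuousAt.eventually_ne hne] with t ht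
    rcases eq_or_ne t p with rfl | htp
    · simp only [hp, if_true, Pi.div_apply, dslope_same]
    · have htp' : t - p ≠ 0 := sub_ne_zero.2 htp
      rw [dslope_of_ne _ htp, slope_def_field, hp, sub_zero] at ht
      have hBt : B t ≠ 0 := fun h => ht (by rw [h, zero_div])
      simp only [hBt, if_false, Pi.div_apply, dslope_of_ne _ htp, slope_def_field, hp, hAp,
        sub_zero, div_div_div_cancel_right₀ htp']
  · refine ((hA p).div (hB p) hp).congr_of_eventuallyEq ?_
    filter_upwards [(hB p).continuousAt.eventually_ne hp] with t ht
    exact if_neg ht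

section EntireFactor

variable {n : ℕ} {k : Fin (n + 1) → ℕ}

theorem IsCurve.exists_mul_gapProd_eq_inv_Gamma (hk : IsCurve k) (F : Facet) :
    ∃ E : ℂ → ℂ, Differentiable ℂ E ∧ ∀ s, E s * F.gapProd k s = (Complex.Gamma (-s))⁻¹ := by
  obtain ⟨a, ha⟩ := (hk.gaps F).exists_nat_subset_range
  refine ⟨fun s => (-1) ^ a * (∏ j ∈ Finset.range a \ hk.gaps F, (s - j)) *
    (Complex.Gamma (a - s))⁻¹,
    Differentiable.mul (by fun_prop) (differentiable_inv_Gamma_comp (by fun_prop)), fun s => ?_⟩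
  calc _ = (-1) ^ a * ((∏ j ∈ Finset.range a \ hk.gaps F, (s - j)) * ∏ j ∈ hk.gaps F, (s - j)) *
        (Complex.Gamma (a - s))⁻¹ := by rw [hk.gapProd_eq]; ring
    _ = (∏ j ∈ Finset.range a, ((j : ℂ) - s)) * (Complex.Gamma (a - s))⁻¹ := by
      rw [Finset.prod_sdiff ha]
      nth_rw 1 [← Finset.card_range a]
      rw [← Finset.prod_const, ← Finset.prod_mul_distrib]
      simp only [neg_one_mul, neg_sub]
    _ = _ := (inv_Gamma_neg_eq s a).symm

theorem IsCurve.eq_zero_of_mul_gapProd_eq_inv_Gamma (hk : IsCurve k) (F : Facet) {E : ℂ → ℂ}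
    (hE : ∀ s, E s * F.gapProd k s = (Complex.Gamma (-s))⁻¹) {q : ℕ} (hq : q ∈ F.monoid k) :
    E q = 0 := by
  have hEq := hE q
  rw [Complex.Gamma_neg_nat_eq_zero, inv_zero] at hEq
  exact (mul_eq_zero.1 hEq).resolve_right (hk.gapProd_natCast_ne_zero F hq)

theorem IsCurve.exists_entire_factor (hk : IsCurve k) (F : Facet) {N : ℕ} (hN : N ∈ F.monoid k) :
    ∃ h : ℂ → ℂ, Differentiable ℂ h ∧
      ∀ t : ℂ, (∀ j : ℕ, t ≠ j) → (∀ j : ℕ, degree k * t ≠ N + j) →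
        h t = (-1) ^ (N + minLength (F.weight k) N) * (N.factorial : ℂ)
            * Complex.Gamma (minLength (F.weight k) N - t)
          / (Complex.Gamma (N - degree k * t) * F.gapProd k N
            * F.opp.gapProd k (degree k * t - N)) := by
  set ℓ := minLength (F.weight k) N
  obtain ⟨E, hE, hEgap⟩ := hk.exists_mul_gapProd_eq_inv_Gamma F.opp
  have hpole : ∀ p : ℂ, (Complex.Gamma (-(p - ℓ)))⁻¹ = 0 → ∃ m : ℕ, p = ℓ + m := fun p hp => by
    obtain ⟨m, hm⟩ := (Complex.Gamma_eq_zero_iff _).1 (inv_eq_zero.1 hp)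
    exact ⟨m, by linear_combination -hm⟩
  -- The poles `ℓ + m` of `Γ(ℓ - t)` are simple, and there `degree k * t - N` lies in the monoid.
  obtain ⟨g, hg, hg_eq⟩ := exists_differentiable_eq_div
    (A := fun t => E (degree k * t - N)) (B := fun t => (Complex.Gamma (-(t - ℓ)))⁻¹)
    (hE.comp (by fun_prop)) (differentiable_inv_Gamma_comp (by fun_prop)) fun p hp => by
      obtain ⟨m, rfl⟩ := hpole p hp
      obtain ⟨q, hq, hNq⟩ := hk.exists_mem_monoid_opp_add_eq F
        (orderedPartitions_minLength_nonempty _ hN) (Nat.le_add_right ℓ m)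
      have hNq' : (degree k : ℂ) * (ℓ + m) - N = q := by
        rw [sub_eq_iff_eq_add']
        exact_mod_cast hNq.symm
      refine ⟨by simp only [hNq', hk.eq_zero_of_mul_gapProd_eq_inv_Gamma F.opp hEgap hq], ?_⟩
      rw [deriv_comp_sub_const (fun s : ℂ => (Complex.Gamma (-s))⁻¹), add_sub_cancel_left]
      exact deriv_inv_Gamma_neg_natCast_ne_zero m
  refine ⟨fun t => (-1) ^ (N + ℓ) * (N.factorial : ℂ) / F.gapProd k N * g t, hg.const_mul _,
    fun t ht ht' => ?_⟩
  have hgap : F.opp.gapProd k (degree k * t - N) ≠ 0 := by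
    rw [Ne, hk.gapProd_eq_zero_iff]
    rintro ⟨κ, -, hκ⟩
    exact ht' κ (by linear_combination hκ)
  have hGamma : (Complex.Gamma (-(t - ℓ)))⁻¹ ≠ 0 := fun h => by
    obtain ⟨m, hm⟩ := hpole t h
    exact ht (ℓ + m) (by rw [hm, Nat.cast_add])
  have hEt := eq_div_of_mul_eq hgap (hEgap (degree k * t - N))
  simp only [hg_eq t hGamma, hEt, neg_sub, div_eq_mul_inv, mul_inv, inv_inv]
  ring

end EntireFactor

/-! ### Sectors and branches -/

theorem eq_of_exp_eq_const {X : Type*} [TopologicalSpace X] {S : Set X} (hS : IsPreconnected S)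
    {g : X → ℂ} {c : ℂ} (hg : ContinuousOn g S) (hexp : ∀ z ∈ S, Complex.exp (g z) = c) {z z' : X}
    (hz : z ∈ S) (hz' : z' ∈ S) : g z = g z' := by
  have hc : (Set.range fun m : ℤ => g z + m * (2 * Real.pi * Complex.I)).Countable :=
    Set.countable_range _
  refine hc.isTotallyDisconnected (g '' S) ?_ (hS.image g hg) ⟨z, hz, rfl⟩ ⟨z', hz', rfl⟩
  rintro _ ⟨y, hy, rfl⟩
  obtain ⟨m, hm⟩ := Complex.exp_eq_exp_iff_exists_int.1 ((hexp y hy).trans (hexp z hz).symm)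
  exact ⟨m, hm.symm⟩

theorem exists_tendsto_of_tendsto_exp {X : Type*} [TopologicalSpace X] {l : Filter X} [l.NeBot]
    (hl : ∀ s ∈ l, ∃ t ∈ l, t ⊆ s ∧ IsPreconnected t) {g : X → ℂ} {S : Set X} (hS : S ∈ l)
    (hg : ContinuousOn g S) {c : ℂ} (hc : c ≠ 0)
    (hlim : Tendsto (fun z => Complex.exp (g z)) l (𝓝 c)) :
    ∃ v, Complex.exp v = c ∧ Tendsto g l (𝓝 v) := by
  have hone : Tendsto (fun z => Complex.exp (g z) / c) l (𝓝 1) := by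
    simpa only [div_self hc] using hlim.div_const c
  obtain ⟨t, htl, hts, ht⟩ := hl _ (inter_mem hS
    (hone (Complex.isOpen_slitPlane.mem_nhds Complex.one_mem_slitPlane)))
  have hcont : ContinuousOn (fun z => g z - Complex.log (Complex.exp (g z) / c)) t :=
    have hgt := hg.mono fun z hz => (hts hz).1
    hgt.sub ((hgt.cexp.div_const c).clog fun z hz => (hts hz).2)
  have hexp : ∀ z ∈ t, Complex.exp (g z - Complex.log (Complex.exp (g z) / c)) = c := fun z _ => by
    rw [Complex.exp_sub, Complex.exp_log (div_ne_zero (Complex.exp_ne_zero _) hc),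
      div_div_cancel₀ (Complex.exp_ne_zero _)]
  obtain ⟨z₀, hz₀⟩ := nonempty_of_mem htl
  set v := g z₀ - Complex.log (Complex.exp (g z₀) / c)
  refine ⟨v, hexp z₀ hz₀, ?_⟩
  have hsum : Tendsto (fun z => v + Complex.log (Complex.exp (g z) / c)) l (𝓝 v) := by
    simpa only [Complex.log_one, add_zero] using
      (hone.clog Complex.one_mem_slitPlane).const_add v
  refine hsum.congr' ?_
  filter_upwards [htl] with z hz
  have hv : g z - Complex.log (Complex.exp (g z) / c) = v :=
    eq_of_exp_eq_const ht hcont hexp hz hz₀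
  rw [← hv, sub_add_cancel]

section Ray

theorem continuous_toCircle : Continuous fun θ : Real.Angle => (θ.toCircle : ℂ) :=
  continuous_subtype_val.comp (continuous_coinduced_dom.mpr Circle.exp.continuous)

theorem norm_rayPoint (θ : Real.Angle) {r : ℝ} (hr : 0 < r) : ‖rayPoint θ r‖ = r := by
  rw [rayPoint, norm_mul, Circle.norm_coe, mul_one, Complex.norm_real, Real.norm_of_nonneg hr.le]

theorem rayPoint_arg_norm (z : ℂ) : rayPoint (Complex.arg z) ‖z‖ = z := by
  rw [rayPoint, Real.Angle.toCircle_coe, Circle.coe_exp, Complex.norm_mul_exp_arg_mul_I]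

theorem continuous_rayPoint : Continuous fun q : Real.Angle × ℝ => rayPoint q.1 q.2 :=
  (Complex.continuous_ofReal.comp continuous_snd).mul (continuous_toCircle.comp continuous_fst)

variable {Θ : Set Real.Angle}

theorem rayPoint_mem_sector {θ : Real.Angle} (hθ : θ ∈ Θ) {r : ℝ} (hr : 0 < r) :
    rayPoint θ r ∈ sector Θ := by
  refine ⟨norm_pos_iff.1 (by rwa [norm_rayPoint θ hr]), ?_⟩
  rwa [rayPoint, Complex.arg_real_mul _ hr, Real.Angle.arg_toCircle]

theorem continuousOn_comp_rayPoint {g : ℂ → ℂ} (hg : ContinuousOn g (sector Θ)) {θ : Real.Angle}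
    (hθ : θ ∈ Θ) : ContinuousOn (fun r => g (rayPoint θ r)) (Set.Ioi 0) :=
  hg.comp (continuous_rayPoint.comp (Continuous.prodMk_right θ)).continuousOn
    fun _ hr => rayPoint_mem_sector hθ hr

theorem isPreconnected_sector_inter (hΘ : IsPreconnected Θ) {I : Set ℝ} (hI : IsPreconnected I)
    (hpos : ∀ r ∈ I, 0 < r) : IsPreconnected {z | z ∈ sector Θ ∧ ‖z‖ ∈ I} := by
  suffices himage : {z | z ∈ sector Θ ∧ ‖z‖ ∈ I} =
      (fun q : Real.Angle × ℝ => rayPoint q.1 q.2) '' (Θ ×ˢ I) from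
    himage ▸ (hΘ.prod hI).image _ continuous_rayPoint.continuousOn
  ext z
  constructor
  · rintro ⟨hz, hzI⟩
    exact ⟨(Complex.arg z, ‖z‖), ⟨hz.2, hzI⟩, rayPoint_arg_norm z⟩
  · rintro ⟨⟨θ, r⟩, ⟨hθ, hr⟩, rfl⟩
    refine ⟨rayPoint_mem_sector hθ (hpos r hr), ?_⟩
    rwa [norm_rayPoint θ (hpos r hr)]

theorem isOpen_sector (hΘ : IsOpen Θ) : IsOpen (sector Θ) := by
  rw [isOpen_iff_mem_nhds]
  rintro z ⟨hz, hzΘ⟩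
  filter_upwards [isOpen_ne.mem_nhds hz,
    (Complex.continuousAt_arg_coe_angle hz).preimage_mem_nhds (hΘ.mem_nhds hzΘ)] with y hy hy'
  exact ⟨hy, hy'⟩

end Ray

section SectorEnd

/-- The exponent `±1` for which `z ^ F.sign` tends to `0` at the end of a sector at the facet. -/
def Facet.sign : Facet → ℤ
  | .origin => 1
  | .infinity => -1

/-- The end of a ray, parametrized by `r = |z|`, at the facet. -/
noncomputable def Facet.rayEnd : Facet → Filter ℝ
  | .origin => 𝓝[>] 0
  | .infinity => atTop

/-- The end of the sector of `Θ` at the facet: `z → 0`, respectively `z → ∞`, in the sector. -/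
noncomputable def Facet.sectorEnd (Θ : Set Real.Angle) : Facet → Filter ℂ
  | .origin => 𝓝[sector Θ] 0
  | .infinity => Bornology.cobounded ℂ ⊓ 𝓟 (sector Θ)

variable {Θ : Set Real.Angle}

theorem Facet.sign_ne_zero (F : Facet) : F.sign ≠ 0 := by
  cases F <;> decide

theorem Facet.sign_mul_self (F : Facet) : (F.sign : ℂ) * F.sign = 1 := by
  cases F <;> simp [Facet.sign]

theorem Facet.mem_sectorEnd_iff (F : Facet) {s : Set ℂ} :
    s ∈ F.sectorEnd Θ ↔ ∃ ε > 0, ∀ z ∈ sector Θ, ‖z‖ ^ F.sign < ε → z ∈ s := by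
  cases F with
  | origin =>
    simp only [Facet.sectorEnd, Facet.sign, Metric.mem_nhdsWithin_iff, zpow_one]
    refine exists_congr fun ε => and_congr_right fun _ => ?_
    simp only [Set.subset_def, Set.mem_inter_iff, mem_ball_zero_iff, and_imp]
    exact forall_congr' fun z => ⟨fun h hz hzε => h hzε hz, fun h hzε hz => h hz hzε⟩
  | infinity =>
    rw [Facet.sectorEnd, mem_inf_principal,
      (Metric.hasBasis_cobounded_compl_closedBall (0 : ℂ)).mem_iff]
    simp only [Facet.sign, zpow_neg_one, Set.subset_def, Set.mem_compl_iff,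
      mem_closedBall_zero_iff, not_le, Set.mem_ofPred_eq, true_and]
    constructor
    · rintro ⟨R, hR⟩
      refine ⟨(max R 1)⁻¹, by positivity, fun z hz hzR => hR z ?_ hz⟩
      exact (le_max_left R 1).trans_lt
        ((inv_lt_inv₀ (norm_pos_iff.2 hz.1) (by positivity)).1 hzR)
    · rintro ⟨ε, hε, h⟩
      exact ⟨ε⁻¹, fun z hzε hz => h z hz (inv_lt_of_inv_lt₀ hε hzε)⟩

theorem Facet.sector_mem_sectorEnd (F : Facet) : sector Θ ∈ F.sectorEnd Θ :=
  F.mem_sectorEnd_iff.2 ⟨1, one_pos, fun _ hz _ => hz⟩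

theorem Facet.tendsto_zpow_sign (F : Facet) :
    Tendsto (fun z : ℂ => z ^ F.sign) (F.sectorEnd Θ) (𝓝 0) := by
  refine Metric.tendsto_nhds.2 fun ε hε => F.mem_sectorEnd_iff.2 ⟨ε, hε, fun z _ hz => ?_⟩
  rwa [Set.mem_ofPred_eq, dist_zero_right, norm_zpow]

theorem Facet.exists_isPreconnected_mem_sectorEnd (F : Facet) (hΘ : IsPreconnected Θ) {s : Set ℂ}
    (hs : s ∈ F.sectorEnd Θ) : ∃ t ∈ F.sectorEnd Θ, t ⊆ s ∧ IsPreconnected t := by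
  obtain ⟨ε, hε, hsub⟩ := F.mem_sectorEnd_iff.1 hs
  have hI : IsPreconnected {r : ℝ | 0 < r ∧ r ^ F.sign < ε} := by
    cases F with
    | origin => simp only [Facet.sign, zpow_one]; exact isPreconnected_Ioo
    | infinity =>
      convert isPreconnected_Ioi (a := ε⁻¹) using 1
      ext r
      simp only [Facet.sign, zpow_neg_one, Set.mem_ofPred_eq, Set.mem_Ioi]
      exact ⟨fun h => inv_lt_of_inv_lt₀ h.1 h.2, fun h =>
        have hr := (inv_pos.2 hε).trans h
        ⟨hr, inv_lt_of_inv_lt₀ hε h⟩⟩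
  refine ⟨{z | z ∈ sector Θ ∧ ‖z‖ ∈ {r : ℝ | 0 < r ∧ r ^ F.sign < ε}},
    F.mem_sectorEnd_iff.2 ⟨ε, hε, fun z hz hzε => ⟨hz, norm_pos_iff.2 hz.1, hzε⟩⟩,
    fun z hz => hsub z hz.1 hz.2.2, isPreconnected_sector_inter hΘ hI fun r hr => hr.1⟩

theorem Facet.tendsto_rayPoint (F : Facet) {θ : Real.Angle} (hθ : θ ∈ Θ) :
    Tendsto (rayPoint θ) F.rayEnd (F.sectorEnd Θ) := by
  refine tendsto_def.2 fun s hs => ?_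
  obtain ⟨ε, hε, hsub⟩ := F.mem_sectorEnd_iff.1 hs
  have hsmall : ∀ r > 0, r ^ F.sign < ε → rayPoint θ r ∈ s := fun r hr hrε =>
    hsub _ (rayPoint_mem_sector hθ hr) (by rwa [norm_rayPoint θ hr])
  cases F with
  | origin =>
    refine mem_of_superset (Ioo_mem_nhdsGT hε) fun r hr => ?_
    exact hsmall r hr.1 (by rw [Facet.sign, zpow_one]; exact hr.2)
  | infinity =>
    refine mem_of_superset (Ioi_mem_atTop ε⁻¹) fun r hr => ?_
    have hr0 := (inv_pos.2 hε).trans hr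
    exact hsmall r hr0 (by rw [Facet.sign, zpow_neg_one]; exact inv_lt_of_inv_lt₀ hε hr)

instance (F : Facet) : NeBot F.rayEnd := by
  cases F <;> unfold Facet.rayEnd <;> infer_instance

end SectorEnd

section Polynomial

/-- `poly k x` as a polynomial in `z`. -/
noncomputable def curvePolynomial {n : ℕ} (k : Fin (n + 1) → ℕ) (x : Fin (n + 1) → ℂ) :
    Polynomial ℂ :=
  ∑ i, Polynomial.monomial (k i) (x i)

variable {n : ℕ} {k : Fin (n + 1) → ℕ} {x : Fin (n + 1) → ℂ}

theorem eval_curvePolynomial (k : Fin (n + 1) → ℕ) (x : Fin (n + 1) → ℂ) (z : ℂ) :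
    (curvePolynomial k x).eval z = poly k x z := by
  simp only [curvePolynomial, poly, Polynomial.eval_finsetSum, Polynomial.eval_monomial]

theorem continuous_poly (w : Fin (n + 1) → ℕ) (x : Fin (n + 1) → ℂ) : Continuous (poly w x) := by
  unfold poly
  fun_prop

theorem poly_zero_right {w : Fin (n + 1) → ℕ} {b : Fin (n + 1)} (hw : ∀ i, w i = 0 ↔ i = b)
    (x : Fin (n + 1) → ℂ) : poly w x 0 = x b := by
  rw [poly, Finset.sum_eq_single b]
  · rw [(hw b).2 rfl, pow_zero, mul_one]
  · intro i _ hi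
    rw [zero_pow ((hw i).not.2 hi), mul_zero]
  · exact fun h => absurd (Finset.mem_univ b) h

theorem ne_zero_of_mem_nonzeroEnds (hx : x ∈ nonzeroEnds n) (F : Facet) : x F.vertex ≠ 0 := by
  cases F
  exacts [hx.1, hx.2]

theorem IsCurve.poly_zero_ne_zero (hk : IsCurve k) (hx : x ∈ nonzeroEnds n) : poly k x 0 ≠ 0 := by
  have hzero := poly_zero_right (hk.weight_eq_zero_iff Facet.origin) x
  exact hzero.trans_ne hx.1

theorem IsCurve.curvePolynomial_ne_zero (hk : IsCurve k) (hx : x ∈ nonzeroEnds n) :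
    curvePolynomial k x ≠ 0 := fun h =>
  hk.poly_zero_ne_zero hx (by rw [← eval_curvePolynomial, h, Polynomial.eval_zero])

theorem IsCurve.natDegree_curvePolynomial_pos (hk : IsCurve k) (hx : x ∈ nonzeroEnds n) :
    0 < (curvePolynomial k x).natDegree := by
  refine hk.degree_pos.trans_le (Polynomial.le_natDegree_of_ne_zero ?_)
  rw [curvePolynomial, Polynomial.finsetSum_coeff, Finset.sum_eq_single (Fin.last n)]
  · rw [degree, Polynomial.coeff_monomial, if_pos rfl]
    exact hx.2
  · intro i _ hi
    rw [Polynomial.coeff_monomial, if_neg]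
    exact hk.strictMono.injective.ne hi
  · exact fun h => absurd (Finset.mem_univ _) h

end Polynomial

section Component

variable {n : ℕ} {k : Fin (n + 1) → ℕ} {x : Fin (n + 1) → ℂ} {Θ : Set Real.Angle}

theorem IsCurve.isClosed_coamoeba (hk : IsCurve k) (hx : x ∈ nonzeroEnds n) :
    IsClosed (coamoeba k x) := by
  refine ((curvePolynomial k x).roots.toFinset.finite_toSet.subset fun z hz => ?_).image _
    |>.isClosed
  simp only [Finset.mem_coe, Multiset.mem_toFinset, Polynomial.mem_roots
    (hk.curvePolynomial_ne_zero hx), Polynomial.IsRoot, eval_curvePolynomial, hz.2]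

theorem IsComponent.isOpen (h : IsComponent k x Θ) (hk : IsCurve k) (hx : x ∈ nonzeroEnds n) :
    IsOpen Θ := by
  obtain ⟨θ, -, rfl⟩ := h
  have : LocallyConnectedSpace Real.Angle :=
    (isQuotientMap_quotient_mk' (s := QuotientAddGroup.leftRel
      (AddSubgroup.zmultiples (2 * Real.pi)))).isCoinducing.locallyConnectedSpace
  exact (hk.isClosed_coamoeba hx).isOpen_compl.connectedComponentIn

theorem IsComponent.isPreconnected (h : IsComponent k x Θ) : IsPreconnected Θ := by
  obtain ⟨θ, -, rfl⟩ := h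
  exact isPreconnected_connectedComponentIn

theorem IsComponent.nonempty (h : IsComponent k x Θ) : Θ.Nonempty := by
  obtain ⟨θ, hθ, rfl⟩ := h
  exact ⟨θ, mem_connectedComponentIn hθ⟩

theorem IsComponent.arg_ne (h : IsComponent k x Θ) {z ζ : ℂ} (hz : z ∈ sector Θ) (hζ : ζ ≠ 0)
    (hroot : poly k x ζ = 0) : (Complex.arg z : Real.Angle) ≠ Complex.arg ζ := by
  obtain ⟨θ, -, rfl⟩ := h
  intro harg
  exact connectedComponentIn_subset _ _ hz.2 ⟨ζ, ⟨hζ, hroot⟩, harg.symm⟩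

end Component

section VertexLog

variable {n : ℕ} {k : Fin (n + 1) → ℕ} {x : Fin (n + 1) → ℂ} {Θ : Set Real.Angle}
  {lz lf : ℂ → ℂ}

/-- The branch of `log (f(z) / z ^ k_b)` given by branches of `log z` and `log f(z)`, where `b` is
the vertex of the facet. Its limit at the end of the sector is the logarithm of `x_b`. -/
def Facet.vertexBranch (k : Fin (n + 1) → ℕ) (F : Facet) (lz lf : ℂ → ℂ) (z : ℂ) : ℂ :=
  lf z - k F.vertex * lz z

theorem isVertexLog_iff (hk : IsCurve k) (F : Facet) {v : ℂ} :
    IsVertexLog k Θ lz lf v F ↔ Tendsto (F.vertexBranch k lz lf) (F.sectorEnd Θ) (𝓝 v) := by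
  cases F with
  | origin =>
    have hzero : Facet.origin.vertexBranch k lz lf = lf := by
      funext z
      rw [Facet.vertexBranch, Facet.vertex, hk.zero, Nat.cast_zero, zero_mul, sub_zero]
    rw [hzero]
    rfl
  | infinity => rfl

theorem IsCurve.form_eq (hk : IsCurve k) (F : Facet) (β : ℂ × ℂ) :
    F.form k β = F.sign * (β.2 - k F.vertex * β.1) := by
  cases F with
  | origin =>
    rw [Facet.form, Facet.sign, Facet.vertex, hk.zero, Nat.cast_zero, zero_mul, sub_zero,
      Int.cast_one, one_mul]
  | infinity =>
    rw [Facet.form, Facet.sign, Facet.vertex, degree]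
    push_cast
    ring

theorem IsCurve.zpow_sign_pow_weight (hk : IsCurve k) (F : Facet) (i : Fin (n + 1)) {z : ℂ}
    (hz : z ≠ 0) : (z ^ F.sign) ^ F.weight k i = z ^ k i / z ^ k F.vertex := by
  cases F with
  | origin =>
    rw [Facet.sign, zpow_one, Facet.weight, Facet.vertex, hk.zero, pow_zero, div_one]
  | infinity =>
    rw [Facet.sign, zpow_neg_one, Facet.weight, inv_pow, pow_sub₀ z hz (hk.le_degree i), mul_inv,
      inv_inv, mul_comm, ← div_eq_mul_inv]
    rfl

theorem IsCurve.poly_div_pow_vertex (hk : IsCurve k) (F : Facet) {z : ℂ} (hz : z ≠ 0) :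
    poly k x z / z ^ k F.vertex = poly (F.weight k) x (z ^ F.sign) := by
  simp only [poly, Finset.sum_div, hk.zpow_sign_pow_weight F _ hz, mul_div_assoc]

theorem IsBranch.exp_vertexBranch (hb : IsBranch k x Θ lz lf) (hk : IsCurve k) (F : Facet) {z : ℂ}
    (hz : z ∈ sector Θ) :
    Complex.exp (F.vertexBranch k lz lf z) = poly (F.weight k) x (z ^ F.sign) := by
  rw [Facet.vertexBranch, Complex.exp_sub, hb.exp_f z hz, Complex.exp_nat_mul, hb.exp_z z hz,
    hk.poly_div_pow_vertex F hz.1]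

theorem IsBranch.continuousOn_vertexBranch (hb : IsBranch k x Θ lz lf) (F : Facet) :
    ContinuousOn (F.vertexBranch k lz lf) (sector Θ) :=
  hb.continuousOn_f.sub (continuousOn_const.mul hb.continuousOn_z)

theorem IsBranch.exists_isVertexLog (hb : IsBranch k x Θ lz lf) (hk : IsCurve k)
    (hx : x ∈ nonzeroEnds n) (hΘ : IsComponent k x Θ) (F : Facet) :
    ∃ v, Complex.exp v = x F.vertex ∧ IsVertexLog k Θ lz lf v F := by
  obtain ⟨θ, hθ⟩ := hΘ.nonempty
  have : NeBot (F.sectorEnd Θ) := (F.tendsto_rayPoint hθ).neBot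
  simp only [isVertexLog_iff hk]
  refine exists_tendsto_of_tendsto_exp
    (fun s hs => F.exists_isPreconnected_mem_sectorEnd hΘ.isPreconnected hs)
    F.sector_mem_sectorEnd (hb.continuousOn_vertexBranch F) (ne_zero_of_mem_nonzeroEnds hx F) ?_
  have hlim := ((continuous_poly (F.weight k) x).tendsto 0).comp (F.tendsto_zpow_sign (Θ := Θ))
  rw [poly_zero_right (hk.weight_eq_zero_iff F)] at hlim
  refine hlim.congr' ?_
  filter_upwards [F.sector_mem_sectorEnd] with z hz
  exact (hb.exp_vertexBranch hk F hz).symm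

end VertexLog

section ExistsBranch

open ComplexOrder

theorem not_zero_le_div {z ζ : ℂ} (hz : z ≠ 0) (hζ : ζ ≠ 0)
    (harg : (Complex.arg z : Real.Angle) ≠ Complex.arg ζ) : ¬ 0 ≤ z / ζ := fun hle =>
  harg (sub_eq_zero.1 (by
    rw [← Complex.arg_div_coe_angle hz hζ, Complex.arg_eq_zero_iff_zero_le.2 hle,
      Real.Angle.coe_zero]))

theorem neg_div_mem_slitPlane {z ζ : ℂ} (hz : z ≠ 0) (hζ : ζ ≠ 0)
    (harg : (Complex.arg z : Real.Angle) ≠ Complex.arg ζ) : -(z / ζ) ∈ Complex.slitPlane := by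
  rw [Complex.mem_slitPlane_iff_not_le_zero, neg_nonpos]
  exact not_zero_le_div hz hζ harg

theorem one_sub_div_mem_slitPlane {z ζ : ℂ} (hz : z ≠ 0) (hζ : ζ ≠ 0)
    (harg : (Complex.arg z : Real.Angle) ≠ Complex.arg ζ) : 1 - z / ζ ∈ Complex.slitPlane := by
  rw [Complex.mem_slitPlane_iff_not_le_zero, sub_nonpos]
  exact fun hle => not_zero_le_div hz hζ harg (zero_le_one.trans hle)

theorem exists_continuousOn_exp_eq_prod {S : Set ℂ} (m : Multiset ℂ)
    (hm : ∀ ζ ∈ m, ∀ z ∈ S, 1 - z / ζ ∈ Complex.slitPlane) :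
    ∃ g : ℂ → ℂ, ContinuousOn g S ∧
      ∀ z ∈ S, Complex.exp (g z) = (m.map fun ζ => 1 - z / ζ).prod := by
  induction m using Multiset.induction_on with
  | empty => exact ⟨0, continuousOn_const, fun _ _ => by simp⟩
  | cons ζ m ih =>
    obtain ⟨g, hg, hexp⟩ := ih fun ζ' hζ' => hm ζ' (Multiset.mem_cons_of_mem hζ')
    have hslit := hm ζ (Multiset.mem_cons_self ζ m)
    refine ⟨fun z => Complex.log (1 - z / ζ) + g z,
      (ContinuousOn.clog (by fun_prop) hslit).add hg, fun z hz => ?_⟩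
    rw [Complex.exp_add, Complex.exp_log (Complex.slitPlane_ne_zero (hslit z hz)), hexp z hz,
      Multiset.map_cons, Multiset.prod_cons]

theorem eval_eq_eval_zero_mul_prod_roots {p : Polynomial ℂ} (hp : p.eval 0 ≠ 0) (z : ℂ) :
    p.eval z = p.eval 0 * (p.roots.map fun ζ => 1 - z / ζ).prod := by
  have hprod := (IsAlgClosed.splits p).eval_eq_prod_roots
  rw [hprod, hprod, mul_assoc, ← Multiset.prod_map_mul]
  congr 2
  refine Multiset.map_congr rfl fun ζ hζ => ?_
  have hζ0 : ζ ≠ 0 := by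
    rintro rfl
    exact hp (Polynomial.mem_roots'.1 hζ).2
  field_simp
  ring

variable {n : ℕ} {k : Fin (n + 1) → ℕ} {x : Fin (n + 1) → ℂ} {Θ : Set Real.Angle}

theorem exists_isBranch (hk : IsCurve k) (hx : x ∈ nonzeroEnds n) (hΘ : IsComponent k x Θ) :
    ∃ lz lf, IsBranch k x Θ lz lf := by
  set p := curvePolynomial k x
  have hp : p.eval 0 ≠ 0 := eval_curvePolynomial k x 0 ▸ hk.poly_zero_ne_zero hx
  have hroot : ∀ ζ ∈ p.roots,
      ζ ≠ 0 ∧ ∀ z ∈ sector Θ, (Complex.arg z : Real.Angle) ≠ Complex.arg ζ := by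
    intro ζ hζ
    have hζp : p.eval ζ = 0 := (Polynomial.mem_roots'.1 hζ).2
    have hζ0 : ζ ≠ 0 := fun h => hp (h ▸ hζp)
    exact ⟨hζ0, fun z hz => hΘ.arg_ne hz hζ0 (eval_curvePolynomial k x ζ ▸ hζp)⟩
  obtain ⟨ζ₀, hζ₀⟩ := IsAlgClosed.exists_root p
    (Polynomial.natDegree_pos_iff_degree_pos.1 (hk.natDegree_curvePolynomial_pos hx)).ne'
  obtain ⟨hζ₀0, hζ₀arg⟩ := hroot ζ₀
    ((Polynomial.mem_roots (hk.curvePolynomial_ne_zero hx)).2 hζ₀)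
  obtain ⟨g, hg, hexp⟩ := exists_continuousOn_exp_eq_prod p.roots fun ζ hζ z hz =>
    one_sub_div_mem_slitPlane hz.1 (hroot ζ hζ).1 ((hroot ζ hζ).2 z hz)
  refine ⟨fun z => Complex.log (-(z / ζ₀)) + Complex.log (-ζ₀),
    fun z => Complex.log (p.eval 0) + g z, ?_, fun z hz => ?_, continuousOn_const.add hg,
    fun z hz => ?_⟩
  · exact (ContinuousOn.clog (by fun_prop) fun z hz =>
      neg_div_mem_slitPlane hz.1 hζ₀0 (hζ₀arg z hz)).add continuousOn_const
  · rw [Complex.exp_add, Complex.exp_log (neg_ne_zero.2 (div_ne_zero hz.1 hζ₀0)),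
      Complex.exp_log (neg_ne_zero.2 hζ₀0), neg_mul_neg, div_mul_cancel₀ _ hζ₀0]
  · rw [Complex.exp_add, Complex.exp_log hp, hexp z hz, ← eval_eq_eval_zero_mul_prod_roots hp,
      eval_curvePolynomial]

theorem exists_isBranch_isVertexLog (hk : IsCurve k) (hx : x ∈ nonzeroEnds n)
    (hΘ : IsComponent k x Θ) (F : Facet) {v : ℂ} (hv : Complex.exp v = x F.vertex) :
    ∃ lz lf, IsBranch k x Θ lz lf ∧ IsVertexLog k Θ lz lf v F := by
  obtain ⟨lz, lf, hb⟩ := exists_isBranch hk hx hΘ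
  obtain ⟨v', hv', hlim⟩ := hb.exists_isVertexLog hk hx hΘ F
  have hexp : Complex.exp (v - v') = 1 := by
    rw [Complex.exp_sub, hv, hv', div_self (hv ▸ Complex.exp_ne_zero v)]
  refine ⟨lz, fun z => lf z + (v - v'), ⟨hb.continuousOn_z, hb.exp_z,
    hb.continuousOn_f.add continuousOn_const, fun z hz => ?_⟩, (isVertexLog_iff hk F).2 ?_⟩
  · rw [Complex.exp_add, hexp, mul_one, hb.exp_f z hz]
  · have hsum := ((isVertexLog_iff hk F).1 hlim).add_const (v - v')
    rw [add_sub_cancel] at hsum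
    exact hsum.congr fun z => by simp only [Facet.vertexBranch]; ring

end ExistsBranch

/-! ### Convergence of the Euler–Mellin integrals -/

section Side

/-- The part of a ray, parametrized by `r = |z|`, on the side of the facet: `r ≤ 1`, respectively
`1 ≤ r`. -/
def Facet.side (F : Facet) : Set ℝ :=
  {r | 0 < r ∧ r ^ F.sign ≤ 1}

theorem Facet.exists_mem_side {r : ℝ} (hr : 0 < r) : ∃ F : Facet, r ∈ F.side := by
  rcases le_total r 1 with h | h
  · exact ⟨.origin, hr, by rwa [Facet.sign, zpow_one]⟩
  · exact ⟨.infinity, hr, by rw [Facet.sign, zpow_neg_one]; exact inv_le_one_of_one_le₀ h⟩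

theorem Facet.sign_mul_log (F : Facet) {r : ℝ} (hr : r ∈ F.side) :
    F.sign * Real.log r = -|Real.log r| := by
  have hnonpos : F.sign * Real.log r ≤ 0 := by
    rw [← Real.log_zpow]
    exact Real.log_nonpos (zpow_nonneg hr.1.le _) hr.2
  have habs : |(F.sign : ℝ)| = 1 := by cases F <;> simp [Facet.sign]
  rw [← neg_eq_iff_eq_neg, ← abs_of_nonpos hnonpos, abs_mul, habs, one_mul]

theorem Facet.norm_sign (F : Facet) : ‖(F.sign : ℂ)‖ = 1 := by
  cases F <;> simp [Facet.sign]

theorem Facet.side_mem_rayEnd (F : Facet) : F.side ∈ F.rayEnd := by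
  cases F with
  | origin =>
    refine mem_of_superset (Ioo_mem_nhdsGT one_pos) fun r hr => ⟨hr.1, ?_⟩
    rw [Facet.sign, zpow_one]
    exact hr.2.le
  | infinity =>
    refine mem_of_superset (Ici_mem_atTop 1) fun r hr => ⟨one_pos.trans_le hr, ?_⟩
    rw [Facet.sign, zpow_neg_one]
    exact inv_le_one_of_one_le₀ hr

variable {Θ K : Set Real.Angle} {g : ℂ → ℂ}

theorem exists_norm_comp_rayPoint_le (hg : ContinuousOn g (sector Θ)) (hK : IsCompact K)
    (hKΘ : K ⊆ Θ) {a : ℝ} (ha : 0 < a) (c : ℝ) :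
    ∃ C, ∀ θ ∈ K, ∀ r ∈ Set.Icc a c, ‖g (rayPoint θ r)‖ ≤ C := by
  have hmaps : Set.MapsTo (fun q : Real.Angle × ℝ => rayPoint q.1 q.2) (K ×ˢ Set.Icc a c)
      (sector Θ) := fun q hq => rayPoint_mem_sector (hKΘ hq.1) (ha.trans_le hq.2.1)
  obtain ⟨C, hC⟩ := (hK.prod isCompact_Icc).exists_bound_of_continuousOn
    (hg.comp continuous_rayPoint.continuousOn hmaps)
  exact ⟨C, fun θ hθ r hr => hC (θ, r) ⟨hθ, hr⟩⟩

theorem Facet.exists_norm_comp_rayPoint_le (F : Facet) (hg : ContinuousOn g (sector Θ)) {v : ℂ}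
    (hlim : Tendsto g (F.sectorEnd Θ) (𝓝 v)) (hK : IsCompact K) (hKΘ : K ⊆ Θ) :
    ∃ C, ∀ θ ∈ K, ∀ r ∈ F.side, ‖g (rayPoint θ r)‖ ≤ C := by
  obtain ⟨ε, hε, hend⟩ := F.mem_sectorEnd_iff.1
    (hlim.norm.eventually_lt_const (lt_add_one ‖v‖))
  obtain ⟨C, hC⟩ := ToricCurve.exists_norm_comp_rayPoint_le hg hK hKΘ (lt_min hε one_pos)
    (max ε⁻¹ 1)
  refine ⟨max C (‖v‖ + 1), fun θ hθ r hr => ?_⟩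
  rcases lt_or_ge (r ^ F.sign) ε with hlt | hge
  · have hz := rayPoint_mem_sector (hKΘ hθ) hr.1
    exact (hend _ hz (by rwa [norm_rayPoint θ hr.1])).le.trans (le_max_right _ _)
  · refine (hC θ hθ r ?_).trans (le_max_left _ _)
    have hr1 := hr.2
    cases F with
    | origin =>
      rw [Facet.sign, zpow_one] at hge hr1
      exact ⟨min_le_of_left_le hge, le_max_of_le_right hr1⟩
    | infinity =>
      rw [Facet.sign, zpow_neg_one] at hge hr1
      exact ⟨min_le_of_right_le ((inv_le_one₀ hr.1).1 hr1),
        le_max_of_le_left (le_inv_of_le_inv₀ hε hge)⟩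

end Side

/-- The function `f(z) ^ β₁ * z ^ (-β₂)`, for given branches of `log z` and `log f(z)`. -/
noncomputable def powerKernel (lz lf : ℂ → ℂ) (β : ℂ × ℂ) (z : ℂ) : ℂ :=
  Complex.exp (β.1 * lf z - β.2 * lz z)

/-- A bound on the ray of argument `θ` for the distance of the branches to their leading terms. -/
structure RayBound {n : ℕ} (k : Fin (n + 1) → ℕ) (lz lf : ℂ → ℂ) (θ : Real.Angle) (C : ℝ) :
    Prop where
  norm_lz : ∀ r : ℝ, 0 < r → ‖lz (rayPoint θ r) - Real.log r‖ ≤ C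
  norm_vertexBranch : ∀ F : Facet, ∀ r ∈ F.side, ‖F.vertexBranch k lz lf (rayPoint θ r)‖ ≤ C

/-- The size of a parameter in the estimates for the kernel. -/
noncomputable def paramSize {n : ℕ} (k : Fin (n + 1) → ℕ) (β : ℂ × ℂ) : ℝ :=
  ‖β.1‖ + ‖Facet.origin.form k β‖ + ‖Facet.infinity.form k β‖

section Bounds

variable {n : ℕ} {k : Fin (n + 1) → ℕ} {x : Fin (n + 1) → ℂ} {Θ : Set Real.Angle} {lz lf : ℂ → ℂ}
  {θ : Real.Angle} {C : ℝ}

theorem integrand_eq (lz lf : ℂ → ℂ) (θ : Real.Angle) (β : ℂ × ℂ) (r : ℝ) :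
    integrand lz lf θ β r = powerKernel lz lf β (rayPoint θ r) / r := rfl

theorem IsCurve.powerKernel_eq_exp_vertexBranch (hk : IsCurve k) (F : Facet) (β : ℂ × ℂ) (z : ℂ) :
    powerKernel lz lf β z =
      Complex.exp (β.1 * F.vertexBranch k lz lf z - F.sign * F.form k β * lz z) := by
  rw [powerKernel, hk.form_eq, ← mul_assoc, F.sign_mul_self, Facet.vertexBranch]
  ring_nf

theorem IsBranch.continuousOn_powerKernel (hb : IsBranch k x Θ lz lf) (β : ℂ × ℂ) :
    ContinuousOn (powerKernel lz lf β) (sector Θ) :=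
  ((continuousOn_const.mul hb.continuousOn_f).sub
    (continuousOn_const.mul hb.continuousOn_z)).cexp

theorem IsBranch.lz_rayPoint (hb : IsBranch k x Θ lz lf) (hθ : θ ∈ Θ) {r : ℝ} (hr : 0 < r) :
    lz (rayPoint θ r) - Real.log r = lz (rayPoint θ 1) := by
  have hcont : ContinuousOn (fun r : ℝ => lz (rayPoint θ r) - Real.log r) (Set.Ioi 0) :=
    (continuousOn_comp_rayPoint hb.continuousOn_z hθ).sub
      (Complex.continuous_ofReal.comp_continuousOn
        (Real.continuousOn_log.mono fun r hr => ne_of_gt hr))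
  have hexp : ∀ r ∈ Set.Ioi (0 : ℝ),
      Complex.exp (lz (rayPoint θ r) - Real.log r) = θ.toCircle := by
    intro r (hr : 0 < r)
    rw [Complex.exp_sub, hb.exp_z _ (rayPoint_mem_sector hθ hr), ← Complex.ofReal_exp,
      Real.exp_log hr, rayPoint, mul_div_cancel_left₀ _ (Complex.ofReal_ne_zero.2 hr.ne')]
  have hone := eq_of_exp_eq_const isPreconnected_Ioi hcont hexp (z := r) (z' := 1) hr
    (Set.mem_Ioi.2 one_pos)
  simpa only [Real.log_one, Complex.ofReal_zero, sub_zero] using hone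

theorem IsBranch.exists_rayBound (hb : IsBranch k x Θ lz lf) (hk : IsCurve k)
    (hx : x ∈ nonzeroEnds n) (hΘ : IsComponent k x Θ) {K : Set Real.Angle} (hK : IsCompact K)
    (hKΘ : K ⊆ Θ) : ∃ C, ∀ θ ∈ K, RayBound k lz lf θ C := by
  have hvertex : ∀ F : Facet, ∃ C, ∀ θ ∈ K, ∀ r ∈ F.side,
      ‖F.vertexBranch k lz lf (rayPoint θ r)‖ ≤ C := fun F => by
    obtain ⟨v, -, hv⟩ := hb.exists_isVertexLog hk hx hΘ F
    exact F.exists_norm_comp_rayPoint_le (hb.continuousOn_vertexBranch F)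
      ((isVertexLog_iff hk F).1 hv) hK hKΘ
  choose C hC using hvertex
  obtain ⟨C', hC'⟩ := exists_norm_comp_rayPoint_le hb.continuousOn_z hK hKΘ one_pos 1
  refine ⟨max C' (max (C .origin) (C .infinity)), fun θ hθ => ⟨fun r hr => ?_, fun F r hr => ?_⟩⟩
  · rw [hb.lz_rayPoint (hKΘ hθ) hr]
    exact (hC' θ hθ 1 ⟨le_rfl, le_rfl⟩).trans (le_max_left _ _)
  · refine (hC F θ hθ r hr).trans (le_max_of_le_right ?_)
    cases F
    exacts [le_max_left _ _, le_max_right _ _]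

theorem continuous_paramSize : Continuous (paramSize k) :=
  (continuous_fst.norm.add (Facet.origin.differentiable_form.continuous.norm)).add
    Facet.infinity.differentiable_form.continuous.norm

theorem Facet.norm_fst_add_norm_form_le (F : Facet) (β : ℂ × ℂ) :
    ‖β.1‖ + ‖F.form k β‖ ≤ paramSize k β := by
  have h₀ := norm_nonneg (Facet.origin.form k β)
  have h₁ := norm_nonneg (Facet.infinity.form k β)
  unfold paramSize
  cases F <;> linarith

theorem RayBound.nonneg (h : RayBound k lz lf θ C) : 0 ≤ C :=
  (norm_nonneg _).trans (h.norm_lz 1 one_pos)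

theorem RayBound.norm_powerKernel_le (h : RayBound k lz lf θ C) (hk : IsCurve k) (F : Facet)
    (β : ℂ × ℂ) {r : ℝ} (hr : r ∈ F.side) :
    ‖powerKernel lz lf β (rayPoint θ r)‖ ≤
      Real.exp (C * paramSize k β + (F.form k β).re * |Real.log r|) := by
  set b := F.vertexBranch k lz lf (rayPoint θ r)
  set d := lz (rayPoint θ r) - Real.log r with hd
  have hlog : (F.sign : ℂ) * (Real.log r : ℂ) = -(|Real.log r| : ℝ) := by
    exact_mod_cast congrArg (fun y : ℝ => (y : ℂ)) (F.sign_mul_log hr)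
  have hexponent : β.1 * b - F.sign * F.form k β * lz (rayPoint θ r) =
      (β.1 * b - F.sign * F.form k β * d) + (|Real.log r| : ℝ) * F.form k β := by
    linear_combination F.sign * F.form k β * hd - F.form k β * hlog
  have hbound : ‖β.1 * b - F.sign * F.form k β * d‖ ≤ C * paramSize k β :=
    calc ‖β.1 * b - F.sign * F.form k β * d‖
        ≤ ‖β.1‖ * ‖b‖ + ‖F.form k β‖ * ‖d‖ := by
          refine (norm_sub_le _ _).trans_eq ?_
          rw [norm_mul, norm_mul, norm_mul, F.norm_sign, one_mul]
      _ ≤ ‖β.1‖ * C + ‖F.form k β‖ * C := by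
          gcongr
          exacts [h.norm_vertexBranch F r hr, h.norm_lz r hr.1]
      _ ≤ C * paramSize k β := by
          rw [← add_mul, mul_comm]
          exact mul_le_mul_of_nonneg_left (F.norm_fst_add_norm_form_le β) h.nonneg
  rw [hk.powerKernel_eq_exp_vertexBranch F, Complex.norm_exp, hexponent, Complex.add_re,
    Complex.re_ofReal_mul, mul_comm |Real.log r|]
  gcongr
  exact (Complex.re_le_norm _).trans hbound

theorem RayBound.norm_integrand_le (h : RayBound k lz lf θ C) (hk : IsCurve k) {β : ℂ × ℂ}
    {δ r B : ℝ} (hβ : ∀ F : Facet, (F.form k β).re ≤ -δ) (hB : paramSize k β ≤ B) (hr : 0 < r) :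
    ‖integrand lz lf θ β r‖ ≤ Real.exp (C * B) * (Real.exp (-δ * |Real.log r|) / r) := by
  obtain ⟨F, hF⟩ := Facet.exists_mem_side hr
  rw [integrand_eq, norm_div, Complex.norm_real, Real.norm_of_nonneg hr.le, mul_div_assoc',
    ← Real.exp_add]
  refine div_le_div_of_nonneg_right ((h.norm_powerKernel_le hk F β hF).trans ?_) hr.le
  gcongr
  exacts [h.nonneg, hβ F]

theorem IsBranch.aestronglyMeasurable_integrand (hb : IsBranch k x Θ lz lf) (hθ : θ ∈ Θ)
    (β : ℂ × ℂ) :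
    AEStronglyMeasurable (integrand lz lf θ β) (volume.restrict (Set.Ioi 0)) :=
  ((continuousOn_comp_rayPoint (hb.continuousOn_powerKernel β) hθ).div
    Complex.continuous_ofReal.continuousOn
      fun _ hr => Complex.ofReal_ne_zero.2 (ne_of_gt hr)).aestronglyMeasurable measurableSet_Ioi

theorem integrableOn_exp_neg_mul_abs_log {δ : ℝ} (hδ : 0 < δ) :
    IntegrableOn (fun r : ℝ => Real.exp (-δ * |Real.log r|) / r) (Set.Ioi 0) := by
  rw [← Set.Ioc_union_Ioi_eq_Ioi (zero_le_one' ℝ)]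
  refine IntegrableOn.union ?_ ?_
  · have hpow : IntegrableOn (fun r : ℝ => r ^ (δ - 1)) (Set.Ioc 0 1) := by
      rw [← intervalIntegrable_iff_integrableOn_Ioc_of_le zero_le_one]
      exact intervalIntegral.intervalIntegrable_rpow' (by linarith)
    refine hpow.congr_fun (fun r hr => ?_) measurableSet_Ioc
    dsimp only
    rw [abs_of_nonpos (Real.log_nonpos hr.1.le hr.2), Real.rpow_sub_one hr.1.ne',
      Real.rpow_def_of_pos hr.1]
    ring_nf
  · have hpow : IntegrableOn (fun r : ℝ => r ^ (-δ - 1)) (Set.Ioi 1) :=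
      integrableOn_Ioi_rpow_of_lt (by linarith) one_pos
    refine hpow.congr_fun (fun r hr => ?_) measurableSet_Ioi
    have hr0 : 0 < r := one_pos.trans hr
    dsimp only
    rw [abs_of_nonneg (Real.log_nonneg (le_of_lt hr)), Real.rpow_sub_one hr0.ne',
      Real.rpow_def_of_pos hr0]
    ring_nf

theorem exists_margin {β : ℂ × ℂ} (hβ : β ∈ convergenceDomain k) :
    ∃ δ : ℝ, 0 < δ ∧ ∀ F : Facet, (F.form k β).re < -δ := by
  obtain ⟨δ, hlow, hδ⟩ := exists_between (max_lt (hβ .origin) (hβ .infinity))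
  refine ⟨-δ, neg_pos.2 hδ, fun F => ?_⟩
  rw [neg_neg]
  cases F
  exacts [(le_max_left _ _).trans_lt hlow, (le_max_right _ _).trans_lt hlow]

theorem isOpen_setOf_forall_form_re_lt (a : ℝ) :
    IsOpen {β : ℂ × ℂ | ∀ F : Facet, (F.form k β).re < a} := by
  have hopen : ∀ F : Facet, IsOpen {β : ℂ × ℂ | (F.form k β).re < a} := fun F =>
    isOpen_lt (Complex.continuous_re.comp F.differentiable_form.continuous) continuous_const
  convert (hopen .origin).inter (hopen .infinity) using 1
  ext β
  exact ⟨fun h => ⟨h _, h _⟩, fun h F => by cases F; exacts [h.1, h.2]⟩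

theorem IsBranch.integrableOn_integrand (hb : IsBranch k x Θ lz lf) (hk : IsCurve k) (hθ : θ ∈ Θ)
    (h : RayBound k lz lf θ C) {β : ℂ × ℂ} (hβ : β ∈ convergenceDomain k) :
    IntegrableOn (integrand lz lf θ β) (Set.Ioi 0) := by
  obtain ⟨δ, hδ, hβδ⟩ := exists_margin hβ
  refine Integrable.mono' ((integrableOn_exp_neg_mul_abs_log hδ).const_mul
    (Real.exp (C * paramSize k β))) (hb.aestronglyMeasurable_integrand hθ β) ?_
  filter_upwards [ae_restrict_mem measurableSet_Ioi] with r hr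
  exact h.norm_integrand_le hk (fun F => (hβδ F).le) le_rfl hr

end Bounds

section Differentiability

variable {n : ℕ} {k : Fin (n + 1) → ℕ} {x : Fin (n + 1) → ℂ} {Θ : Set Real.Angle} {lz lf : ℂ → ℂ}
  {θ : Real.Angle} {C : ℝ}

/-- The logarithm of `f(z) ^ β₁ * z ^ (-β₂)` as a linear form in `β`. -/
noncomputable def exponentForm (lz lf : ℂ → ℂ) (z : ℂ) : ℂ × ℂ →L[ℂ] ℂ :=
  lf z • ContinuousLinearMap.fst ℂ ℂ ℂ - lz z • ContinuousLinearMap.snd ℂ ℂ ℂ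

theorem norm_exponentForm_le (lz lf : ℂ → ℂ) (z : ℂ) :
    ‖exponentForm lz lf z‖ ≤ ‖lf z‖ + ‖lz z‖ := by
  refine (norm_sub_le _ _).trans ?_
  rw [norm_smul, norm_smul]
  gcongr
  · exact mul_le_of_le_one_right (norm_nonneg _) (ContinuousLinearMap.norm_fst_le ℂ ℂ ℂ)
  · exact mul_le_of_le_one_right (norm_nonneg _) (ContinuousLinearMap.norm_snd_le ℂ ℂ ℂ)

theorem RayBound.norm_exponentForm_le (h : RayBound k lz lf θ C) (hk : IsCurve k) {r : ℝ}
    (hr : 0 < r) :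
    ‖exponentForm lz lf (rayPoint θ r)‖ ≤ (degree k + 2) * (C + 1) * (1 + |Real.log r|) := by
  set z := rayPoint θ r
  have hlz : ‖lz z‖ ≤ C + |Real.log r| := by
    rw [← sub_add_cancel (lz z) (Real.log r)]
    refine (norm_add_le _ _).trans (add_le_add (h.norm_lz r hr) ?_)
    rw [Complex.norm_real, Real.norm_eq_abs]
  have hlf : ‖lf z‖ ≤ C + degree k * (C + |Real.log r|) := by
    obtain ⟨F, hF⟩ := Facet.exists_mem_side hr
    have hle : (k F.vertex : ℝ) ≤ degree k := Nat.cast_le.2 (hk.le_degree _)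
    rw [← sub_add_cancel (lf z) (k F.vertex * lz z)]
    refine (norm_add_le _ _).trans (add_le_add (h.norm_vertexBranch F r hF) ?_)
    rw [norm_mul, Complex.norm_natCast]
    gcongr
  have hC := h.nonneg
  have hlog := abs_nonneg (Real.log r)
  have hprod : C + |Real.log r| ≤ (C + 1) * (1 + |Real.log r|) := by
    nlinarith [mul_nonneg hC hlog]
  have hdeg := mul_le_mul_of_nonneg_left hprod (Nat.cast_nonneg (α := ℝ) (degree k))
  linarith [ToricCurve.norm_exponentForm_le lz lf z]

theorem hasFDerivAt_integrand (lz lf : ℂ → ℂ) (θ : Real.Angle) (r : ℝ) (β : ℂ × ℂ) :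
    HasFDerivAt (fun β => integrand lz lf θ β r)
      (integrand lz lf θ β r • exponentForm lz lf (rayPoint θ r)) β := by
  have hexponent : HasFDerivAt
      (fun β : ℂ × ℂ => β.1 * lf (rayPoint θ r) - β.2 * lz (rayPoint θ r))
      (exponentForm lz lf (rayPoint θ r)) β :=
    (hasFDerivAt_fst.mul_const _).sub (hasFDerivAt_snd.mul_const _)
  refine (hexponent.cexp.mul_const (r : ℂ)⁻¹).congr_fderiv ?_
  rw [smul_smul, integrand, div_eq_inv_mul]

theorem one_add_mul_exp_neg_le {δ y : ℝ} (hδ : 0 < δ) (hy : 0 ≤ y) :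
    (1 + y) * Real.exp (-δ * y) ≤ (1 + 2 / δ) * Real.exp (-(δ / 2) * y) := by
  have hone : 1 + y ≤ (1 + 2 / δ) * Real.exp (δ / 2 * y) :=
    calc 1 + y ≤ 1 + y + (δ / 2 * y + 2 / δ) := le_add_of_nonneg_right (by positivity)
      _ = (1 + 2 / δ) * (δ / 2 * y + 1) := by field_simp; ring
      _ ≤ (1 + 2 / δ) * Real.exp (δ / 2 * y) := by
          gcongr
          exact Real.add_one_le_exp _
  calc (1 + y) * Real.exp (-δ * y)
      ≤ (1 + 2 / δ) * Real.exp (δ / 2 * y) * Real.exp (-δ * y) := by gcongr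
    _ = (1 + 2 / δ) * Real.exp (-(δ / 2) * y) := by
        rw [mul_assoc, ← Real.exp_add]
        ring_nf

theorem RayBound.norm_integrand_smul_exponentForm_le (h : RayBound k lz lf θ C) (hk : IsCurve k)
    {β : ℂ × ℂ} {δ r B : ℝ} (hδ : 0 < δ) (hβ : ∀ F : Facet, (F.form k β).re ≤ -δ)
    (hB : paramSize k β ≤ B) (hr : 0 < r) :
    ‖integrand lz lf θ β r • exponentForm lz lf (rayPoint θ r)‖ ≤
      Real.exp (C * B) * ((degree k + 2) * (C + 1)) * (1 + 2 / δ) *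
        (Real.exp (-(δ / 2) * |Real.log r|) / r) := by
  have hC := h.nonneg
  set D := (degree k + 2) * (C + 1)
  calc ‖integrand lz lf θ β r • exponentForm lz lf (rayPoint θ r)‖
      ≤ Real.exp (C * B) * (Real.exp (-δ * |Real.log r|) / r) * (D * (1 + |Real.log r|)) := by
        rw [norm_smul]
        gcongr
        exacts [h.norm_integrand_le hk hβ hB hr, h.norm_exponentForm_le hk hr]
    _ = Real.exp (C * B) * D / r * ((1 + |Real.log r|) * Real.exp (-δ * |Real.log r|)) := by ring
    _ ≤ Real.exp (C * B) * D / r * ((1 + 2 / δ) * Real.exp (-(δ / 2) * |Real.log r|)) := by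
        gcongr ?_ * ?_
        exact one_add_mul_exp_neg_le hδ (abs_nonneg _)
    _ = _ := by ring

theorem IsBranch.differentiableAt_eulerMellin (hb : IsBranch k x Θ lz lf) (hk : IsCurve k)
    (hθ : θ ∈ Θ) (h : RayBound k lz lf θ C) {β₀ : ℂ × ℂ} (hβ₀ : β₀ ∈ convergenceDomain k) :
    DifferentiableAt ℂ (eulerMellin lz lf θ) β₀ := by
  obtain ⟨δ, hδ, hβδ⟩ := exists_margin hβ₀
  have hopen := (isOpen_setOf_forall_form_re_lt (k := k) (-δ)).inter
    (isOpen_lt (continuous_paramSize (k := k)) (continuous_const (y := paramSize k β₀ + 1)))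
  have hmeas : AEStronglyMeasurable (fun r => exponentForm lz lf (rayPoint θ r))
      (volume.restrict (Set.Ioi 0)) :=
    (((continuousOn_comp_rayPoint hb.continuousOn_f hθ).smul continuousOn_const).sub
      ((continuousOn_comp_rayPoint hb.continuousOn_z hθ).smul
        continuousOn_const)).aestronglyMeasurable measurableSet_Ioi
  refine (hasFDerivAt_integral_of_dominated_of_fderiv_le (𝕜 := ℂ)
    (F := fun β r => integrand lz lf θ β r)
    (F' := fun β r => integrand lz lf θ β r • exponentForm lz lf (rayPoint θ r))
    (hopen.mem_nhds ⟨hβδ, lt_add_one (paramSize k β₀)⟩)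
    (Eventually.of_forall fun β => hb.aestronglyMeasurable_integrand hθ β)
    (hb.integrableOn_integrand hk hθ h hβ₀)
    ((hb.aestronglyMeasurable_integrand hθ β₀).smul hmeas) ?_
    ((integrableOn_exp_neg_mul_abs_log (half_pos hδ)).const_mul (Real.exp (C * (paramSize k β₀ + 1))
      * ((degree k + 2) * (C + 1)) * (1 + 2 / δ))) ?_).differentiableAt
  · filter_upwards [ae_restrict_mem measurableSet_Ioi] with r hr β hβ
    exact h.norm_integrand_smul_exponentForm_le hk hδ (fun F => (hβ.1 F).le) (le_of_lt hβ.2) hr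
  · exact Eventually.of_forall fun r β _ => hasFDerivAt_integrand lz lf θ r β

end Differentiability

/-! ### Contiguity relations -/

section RadialDerivative

variable {n : ℕ} {k : Fin (n + 1) → ℕ} {x : Fin (n + 1) → ℂ} {Θ : Set Real.Angle} {lz lf : ℂ → ℂ}
  {θ : Real.Angle}

theorem hasDerivAt_poly_zpow (w : Fin (n + 1) → ℕ) (x : Fin (n + 1) → ℂ) (s : ℤ) {z : ℂ}
    (hz : z ≠ 0) :
    HasDerivAt (fun z => poly w x (z ^ s)) (s * (∑ i, w i * x i * (z ^ s) ^ w i) / z) z := by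
  have hpow : ∀ i, HasDerivAt (fun z : ℂ => (z ^ s) ^ w i) (s * w i * (z ^ s) ^ w i / z) z := by
    intro i
    have hexp : ∀ z : ℂ, (z ^ s) ^ w i = z ^ (s * w i) := fun z => by rw [zpow_mul, zpow_natCast]
    simp only [hexp]
    refine (hasDerivAt_zpow (s * w i) z (Or.inl hz)).congr_deriv ?_
    rw [zpow_sub_one₀ hz, ← div_eq_mul_inv, mul_div_assoc']
    push_cast
    rfl
  refine (HasDerivAt.fun_sum fun i (_ : i ∈ Finset.univ) => (hpow i).const_mul (x i)).congr_deriv ?_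
  rw [Finset.mul_sum, Finset.sum_div]
  exact Finset.sum_congr rfl fun i _ => by ring

theorem analyticAt_poly_zpow (w : Fin (n + 1) → ℕ) (x : Fin (n + 1) → ℂ) (s : ℤ) {z : ℂ}
    (hz : z ≠ 0) : AnalyticAt ℂ (fun z => poly w x (z ^ s)) z := by
  have hpow : AnalyticAt ℂ (fun z : ℂ => z ^ s) z := analyticAt_id.zpow hz
  exact Finset.analyticAt_fun_sum _ fun i _ => analyticAt_const.mul (hpow.pow (w i))

theorem hasDerivAt_of_exp_eq {l F : ℂ → ℂ} {z d : ℂ} (hl : ContinuousAt l z)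
    (hF : AnalyticAt ℂ F z) (h : ∀ᶠ y in 𝓝 z, Complex.exp (l y) = F y) (hd : HasDerivAt F d z) :
    HasDerivAt l (d / F z) z := by
  have hdiff := (analyticAt_of_exp_eq hl hF h).differentiableAt
  have hderiv := hdiff.hasDerivAt.cexp.unique (hd.congr_of_eventuallyEq h)
  rw [h.self_of_nhds] at hderiv
  have hne : F z ≠ 0 := h.self_of_nhds ▸ Complex.exp_ne_zero _
  rw [← hderiv, mul_div_cancel_left₀ _ hne]
  exact hdiff.hasDerivAt

theorem IsBranch.hasDerivAt_lz (hb : IsBranch k x Θ lz lf) (hΘ : IsOpen Θ) {z : ℂ}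
    (hz : z ∈ sector Θ) : HasDerivAt lz z⁻¹ z := by
  have hmem := (isOpen_sector hΘ).mem_nhds hz
  have hexp : ∀ᶠ y in 𝓝 z, Complex.exp (lz y) = id y := eventually_of_mem hmem hb.exp_z
  have h := hasDerivAt_of_exp_eq (hb.continuousOn_z.continuousAt hmem) analyticAt_id hexp
    (hasDerivAt_id z)
  rwa [one_div] at h

theorem IsBranch.hasDerivAt_vertexBranch (hb : IsBranch k x Θ lz lf) (hk : IsCurve k)
    (hΘ : IsOpen Θ) (F : Facet) {z : ℂ} (hz : z ∈ sector Θ) :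
    HasDerivAt (F.vertexBranch k lz lf)
      (F.sign * (∑ i, F.weight k i * x i * (z ^ F.sign) ^ F.weight k i) / z /
        poly (F.weight k) x (z ^ F.sign)) z := by
  have hmem := (isOpen_sector hΘ).mem_nhds hz
  have hderiv := hasDerivAt_of_exp_eq ((hb.continuousOn_vertexBranch F).continuousAt hmem)
    (analyticAt_poly_zpow (F.weight k) x F.sign hz.1)
    (eventually_of_mem hmem fun y hy => hb.exp_vertexBranch hk F hy)
    (hasDerivAt_poly_zpow (F.weight k) x F.sign hz.1)
  exact hderiv

theorem IsBranch.powerKernel_sub_column (hb : IsBranch k x Θ lz lf) (hk : IsCurve k) (F : Facet)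
    (β : ℂ × ℂ) (i : Fin (n + 1)) {z : ℂ} (hz : z ∈ sector Θ) :
    powerKernel lz lf (β - column k i) z =
      powerKernel lz lf β z * (z ^ F.sign) ^ F.weight k i / poly (F.weight k) x (z ^ F.sign) := by
  have hpow : (z ^ F.sign) ^ F.weight k i = Complex.exp (F.sign * F.weight k i * lz z) := by
    rw [mul_right_comm, mul_comm, Complex.exp_nat_mul, Complex.exp_int_mul, hb.exp_z z hz]
  rw [hk.powerKernel_eq_exp_vertexBranch F, hk.powerKernel_eq_exp_vertexBranch F,
    hk.form_sub_column, ← hb.exp_vertexBranch hk F hz, hpow, ← Complex.exp_add, ← Complex.exp_sub,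
    column, Prod.fst_sub]
  ring_nf

theorem IsBranch.hasDerivAt_powerKernel (hb : IsBranch k x Θ lz lf) (hk : IsCurve k)
    (hΘ : IsOpen Θ) (F : Facet) (β : ℂ × ℂ) {z : ℂ} (hz : z ∈ sector Θ) :
    HasDerivAt (powerKernel lz lf β)
      (F.sign * (β.1 * ∑ i, F.weight k i * x i * powerKernel lz lf (β - column k i) z
        - F.form k β * powerKernel lz lf β z) / z) z := by
  have hsum : ∑ i, F.weight k i * x i * powerKernel lz lf (β - column k i) z =
      powerKernel lz lf β z * (∑ i, F.weight k i * x i * (z ^ F.sign) ^ F.weight k i) /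
        poly (F.weight k) x (z ^ F.sign) := by
    rw [Finset.mul_sum, Finset.sum_div]
    refine Finset.sum_congr rfl fun i _ => ?_
    rw [hb.powerKernel_sub_column hk F β i hz]
    ring
  rw [funext (hk.powerKernel_eq_exp_vertexBranch (lz := lz) (lf := lf) F β)] at hsum ⊢
  refine (((hb.hasDerivAt_vertexBranch hk hΘ F hz).const_mul β.1).sub
    ((hb.hasDerivAt_lz hΘ hz).const_mul (F.sign * F.form k β))).cexp.congr_deriv ?_
  rw [hsum, Pi.sub_apply]
  ring

/-- The derivative of `f(z) ^ β₁ * z ^ (-β₂)` along the ray of argument `θ`, with respect to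
`r = |z|`, as a combination of integrands adapted to the facet. -/
noncomputable def radialDeriv (k : Fin (n + 1) → ℕ) (x : Fin (n + 1) → ℂ) (F : Facet)
    (lz lf : ℂ → ℂ) (θ : Real.Angle) (β : ℂ × ℂ) (r : ℝ) : ℂ :=
  F.sign * (β.1 * ∑ i, F.weight k i * x i * integrand lz lf θ (β - column k i) r
    - F.form k β * integrand lz lf θ β r)

theorem IsBranch.hasDerivAt_powerKernel_rayPoint (hb : IsBranch k x Θ lz lf) (hk : IsCurve k)
    (hΘ : IsOpen Θ) (hθ : θ ∈ Θ) (F : Facet) (β : ℂ × ℂ) {r : ℝ} (hr : 0 < r) :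
    HasDerivAt (powerKernel lz lf β) (r * radialDeriv k x F lz lf θ β r / rayPoint θ r)
      (rayPoint θ r) := by
  refine (hb.hasDerivAt_powerKernel hk hΘ F β (rayPoint_mem_sector hθ hr)).congr_deriv ?_
  have hr' : (r : ℂ) ≠ 0 := Complex.ofReal_ne_zero.2 hr.ne'
  simp only [radialDeriv, integrand_eq, mul_div_assoc', ← Finset.sum_div, ← sub_div]
  rw [mul_div_cancel_left₀ _ hr']

theorem IsBranch.hasDerivAt_radial (hb : IsBranch k x Θ lz lf) (hk : IsCurve k)
    (hΘ : IsOpen Θ) (hθ : θ ∈ Θ) (F : Facet) (β : ℂ × ℂ) {r : ℝ} (hr : 0 < r) :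
    HasDerivAt (fun r => powerKernel lz lf β (rayPoint θ r)) (radialDeriv k x F lz lf θ β r) r := by
  have hray : HasDerivAt (rayPoint θ) (1 * (θ.toCircle : ℂ)) r :=
    (Complex.ofRealCLM.hasDerivAt (x := r)).mul_const (θ.toCircle : ℂ)
  refine ((hb.hasDerivAt_powerKernel_rayPoint hk hΘ hθ F β hr).comp r hray).congr_deriv ?_
  have hz : rayPoint θ r ≠ 0 := (rayPoint_mem_sector hθ hr).1
  rw [div_mul_eq_mul_div, div_eq_iff hz, rayPoint]
  ring

theorem IsBranch.hasDerivAt_angular (hb : IsBranch k x Θ lz lf) (hk : IsCurve k)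
    (hΘ : IsOpen Θ) {φ : ℝ} (hφ : (φ : Real.Angle) ∈ Θ) (F : Facet) (β : ℂ × ℂ) {r : ℝ}
    (hr : 0 < r) :
    HasDerivAt (fun φ : ℝ => integrand lz lf φ β r)
      (Complex.I * radialDeriv k x F lz lf φ β r) φ := by
  have hray : HasDerivAt (fun φ : ℝ => rayPoint φ r) (Complex.I * rayPoint φ r) φ := by
    simp only [rayPoint, Real.Angle.toCircle_coe, Circle.coe_exp]
    refine ((((Complex.ofRealCLM.hasDerivAt (x := φ)).mul_const
      Complex.I).cexp).const_mul (r : ℂ)).congr_deriv ?_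
    simp only [Complex.ofRealCLM_apply, Complex.ofReal_one]
    ring
  refine (((hb.hasDerivAt_powerKernel_rayPoint hk hΘ hφ F β hr).comp φ hray).div_const
    (r : ℂ)).congr_deriv ?_
  have hr' : (r : ℂ) ≠ 0 := Complex.ofReal_ne_zero.2 hr.ne'
  have hz : rayPoint φ r ≠ 0 := (rayPoint_mem_sector hφ hr).1
  field_simp

end RadialDerivative

section ByParts

variable {n : ℕ} {k : Fin (n + 1) → ℕ} {x : Fin (n + 1) → ℂ} {Θ : Set Real.Angle} {lz lf : ℂ → ℂ}
  {θ : Real.Angle} {C : ℝ}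

theorem integral_Ioi_eq_sub_of_tendsto {G G' : ℝ → ℂ} {m₀ m₁ : ℂ}
    (hG : ∀ r ∈ Set.Ioi (0 : ℝ), HasDerivAt G (G' r) r) (hG' : IntegrableOn G' (Set.Ioi 0))
    (h₀ : Tendsto G (𝓝[>] 0) (𝓝 m₀)) (h₁ : Tendsto G atTop (𝓝 m₁)) :
    ∫ r in Set.Ioi (0 : ℝ), G' r = m₁ - m₀ := by
  simpa only [Pi.zero_apply, Pi.one_apply, mul_one, mul_zero, add_zero] using
    integral_Ioi_deriv_mul_eq_sub (u := G) (v := 1) (v' := 0) hG (fun r _ => hasDerivAt_const r 1)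
      (by simpa only [mul_one, mul_zero, add_zero] using hG')
      (by simpa only [mul_one] using h₀) (by simpa only [mul_one] using h₁)

theorem Facet.tendsto_abs_log_rayEnd (F : Facet) :
    Tendsto (fun r => |Real.log r|) F.rayEnd atTop := by
  cases F
  · exact tendsto_abs_atBot_atTop.comp Real.tendsto_log_nhdsGT_zero
  · exact tendsto_abs_atTop_atTop.comp Real.tendsto_log_atTop

theorem RayBound.tendsto_powerKernel_zero (h : RayBound k lz lf θ C) (hk : IsCurve k) {F : Facet}
    {β : ℂ × ℂ} (hβ : (F.form k β).re < 0) :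
    Tendsto (fun r => powerKernel lz lf β (rayPoint θ r)) F.rayEnd (𝓝 0) := by
  refine squeeze_zero_norm' (mem_of_superset F.side_mem_rayEnd fun r hr =>
    h.norm_powerKernel_le hk F β hr) (Real.tendsto_exp_atBot.comp ?_)
  exact tendsto_atBot_add_const_left _ _ (F.tendsto_abs_log_rayEnd.const_mul_atTop_of_neg hβ)

theorem tendsto_powerKernel_vertex (hk : IsCurve k) (hθ : θ ∈ Θ) {F : Facet} {v : ℂ}
    (hv : IsVertexLog k Θ lz lf v F) {β : ℂ × ℂ} (hβ : F.form k β = 0) :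
    Tendsto (fun r => powerKernel lz lf β (rayPoint θ r)) F.rayEnd
      (𝓝 (Complex.exp (β.1 * v))) := by
  have hlim := ((isVertexLog_iff hk F).1 hv).comp (F.tendsto_rayPoint hθ)
  refine (hlim.const_mul β.1).cexp.congr fun r => ?_
  rw [hk.powerKernel_eq_exp_vertexBranch F, hβ, mul_zero, zero_mul, sub_zero, Function.comp_apply]

theorem IsCurve.form_sub_column_re_le (hk : IsCurve k) (F : Facet) (β : ℂ × ℂ) (i : Fin (n + 1)) :
    (F.form k (β - column k i)).re ≤ (F.form k β).re := by
  rw [hk.form_sub_column, Complex.sub_re, Complex.natCast_re]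
  exact sub_le_self _ (Nat.cast_nonneg _)

theorem IsCurve.sub_column_mem (hk : IsCurve k) {β : ℂ × ℂ} (hβ : β ∈ convergenceDomain k)
    (i : Fin (n + 1)) : β - column k i ∈ convergenceDomain k := fun F =>
  (hk.form_sub_column_re_le F β i).trans_lt (hβ F)

theorem IsBranch.integral_radialDeriv_eq_zero (hb : IsBranch k x Θ lz lf) (hk : IsCurve k)
    (hΘ : IsOpen Θ) (hθ : θ ∈ Θ) (h : RayBound k lz lf θ C) (F : Facet) {β : ℂ × ℂ}
    (hβ : β ∈ convergenceDomain k) :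
    IntegrableOn (radialDeriv k x F lz lf θ β) (Set.Ioi 0) ∧
      ∫ r in Set.Ioi (0 : ℝ), radialDeriv k x F lz lf θ β r = 0 := by
  have hint : IntegrableOn (radialDeriv k x F lz lf θ β) (Set.Ioi 0) :=
    (((integrable_finsetSum Finset.univ fun i _ => (hb.integrableOn_integrand hk hθ h
      (hk.sub_column_mem hβ i)).const_mul _).const_mul β.1).sub
        ((hb.integrableOn_integrand hk hθ h hβ).const_mul _)).const_mul _
  refine ⟨hint, ?_⟩
  rw [integral_Ioi_eq_sub_of_tendsto (fun r hr => hb.hasDerivAt_radial hk hΘ hθ F β hr) hint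
    (h.tendsto_powerKernel_zero hk (hβ .origin)) (h.tendsto_powerKernel_zero hk (hβ .infinity)),
    sub_zero]

theorem IsBranch.form_mul_eulerMellin (hb : IsBranch k x Θ lz lf) (hk : IsCurve k)
    (hΘ : IsOpen Θ) (hθ : θ ∈ Θ) (h : RayBound k lz lf θ C) (F : Facet) {β : ℂ × ℂ}
    (hβ : β ∈ convergenceDomain k) :
    F.form k β * eulerMellin lz lf θ β =
      β.1 * ∑ i, F.weight k i * x i * eulerMellin lz lf θ (β - column k i) := by
  have hint : ∀ i, IntegrableOn (fun r => F.weight k i * x i *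
      integrand lz lf θ (β - column k i) r) (Set.Ioi 0) := fun i =>
    (hb.integrableOn_integrand hk hθ h (hk.sub_column_mem hβ i)).const_mul _
  have hzero := (hb.integral_radialDeriv_eq_zero hk hΘ hθ h F hβ).2
  simp only [radialDeriv] at hzero
  rw [integral_const_mul, integral_sub ((integrable_finsetSum _ fun i _ => hint i).const_mul _)
      ((hb.integrableOn_integrand hk hθ h hβ).const_mul _), integral_const_mul,
    integral_const_mul, integral_finsetSum _ fun i _ => hint i, mul_eq_zero,
    or_iff_right (Int.cast_ne_zero.2 F.sign_ne_zero), sub_eq_zero] at hzero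
  simp only [integral_const_mul] at hzero
  exact hzero.symm

theorem IsCurve.sub_column_mem_of_form_eq_zero (hk : IsCurve k) {F : Facet} {β : ℂ × ℂ}
    (hβ : F.form k β = 0) (hβ' : (F.opp.form k β).re < 0) {i : Fin (n + 1)}
    (hi : F.weight k i ≠ 0) : β - column k i ∈ convergenceDomain k := by
  have hF : (F.form k (β - column k i)).re < 0 := by
    rw [hk.form_sub_column, hβ, zero_sub, Complex.neg_re, Complex.natCast_re]
    exact neg_neg_of_pos (Nat.cast_pos.2 (Nat.pos_of_ne_zero hi))
  have hopp := (hk.form_sub_column_re_le F.opp β i).trans_lt hβ'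
  intro F'
  cases F <;> cases F' <;> assumption

theorem IsBranch.integral_radialDeriv_of_form_eq_zero (hb : IsBranch k x Θ lz lf) (hk : IsCurve k)
    (hΘ : IsOpen Θ) (hθ : θ ∈ Θ) (h : RayBound k lz lf θ C) {F : Facet} {v : ℂ}
    (hv : IsVertexLog k Θ lz lf v F) {β : ℂ × ℂ} (hβ : F.form k β = 0)
    (hβ' : (F.opp.form k β).re < 0)
    (hint : IntegrableOn (radialDeriv k x F lz lf θ β) (Set.Ioi 0)) :
    ∫ r in Set.Ioi (0 : ℝ), radialDeriv k x F lz lf θ β r =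
      F.sign * -Complex.exp (β.1 * v) := by
  have hderiv := fun r hr => hb.hasDerivAt_radial hk hΘ hθ F β (r := r) hr
  have hvertex := tendsto_powerKernel_vertex hk hθ hv hβ
  have hopp := h.tendsto_powerKernel_zero hk hβ'
  cases F with
  | origin =>
    rw [integral_Ioi_eq_sub_of_tendsto hderiv hint hvertex hopp, Facet.sign, Int.cast_one, one_mul,
      zero_sub]
  | infinity =>
    rw [integral_Ioi_eq_sub_of_tendsto hderiv hint hopp hvertex, Facet.sign, Int.cast_neg,
      Int.cast_one, neg_mul_neg, one_mul, sub_zero]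

theorem IsBranch.sum_eulerMellin_of_form_eq_zero (hb : IsBranch k x Θ lz lf) (hk : IsCurve k)
    (hΘ : IsOpen Θ) (hθ : θ ∈ Θ) (h : RayBound k lz lf θ C) {F : Facet} {v : ℂ}
    (hv : IsVertexLog k Θ lz lf v F) {β : ℂ × ℂ} (hβ : F.form k β = 0)
    (hβ' : (F.opp.form k β).re < 0) :
    β.1 * ∑ i, F.weight k i * x i * eulerMellin lz lf θ (β - column k i) =
      -Complex.exp (β.1 * v) := by
  have hint : ∀ i, IntegrableOn (fun r => F.weight k i * x i *
      integrand lz lf θ (β - column k i) r) (Set.Ioi 0) := by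
    intro i
    rcases eq_or_ne (F.weight k i) 0 with hi | hi
    · simp only [hi, Nat.cast_zero, zero_mul]
      exact integrableOn_zero
    · exact (hb.integrableOn_integrand hk hθ h
        (hk.sub_column_mem_of_form_eq_zero hβ hβ' hi)).const_mul _
  have hradial : radialDeriv k x F lz lf θ β = fun r => F.sign *
      (β.1 * ∑ i, F.weight k i * x i * integrand lz lf θ (β - column k i) r) := by
    funext r
    rw [radialDeriv, hβ, zero_mul, sub_zero]
  have hval := hb.integral_radialDeriv_of_form_eq_zero hk hΘ hθ h hv hβ hβ'
    (hradial ▸ ((integrable_finsetSum _ fun i _ => hint i).const_mul β.1).const_mul _)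
  rw [hradial, integral_const_mul, integral_const_mul,
    integral_finsetSum _ fun i _ => hint i] at hval
  simp only [integral_const_mul] at hval
  exact mul_left_cancel₀ (Int.cast_ne_zero.2 F.sign_ne_zero) hval

end ByParts

section Rotation

variable {n : ℕ} {k : Fin (n + 1) → ℕ} {x : Fin (n + 1) → ℂ} {Θ : Set Real.Angle} {lz lf : ℂ → ℂ}

theorem exists_norm_radialDeriv_le (hk : IsCurve k) (x : Fin (n + 1) → ℂ) (lz lf : ℂ → ℂ)
    (F : Facet) {β : ℂ × ℂ} {δ : ℝ} (hβ : ∀ F : Facet, (F.form k β).re ≤ -δ) (C : ℝ) :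
    ∃ B, ∀ θ, RayBound k lz lf θ C → ∀ r : ℝ, 0 < r →
      ‖radialDeriv k x F lz lf θ β r‖ ≤ B * (Real.exp (-δ * |Real.log r|) / r) := by
  refine ⟨‖β.1‖ * (∑ i, ‖F.weight k i * x i‖ * Real.exp (C * paramSize k (β - column k i))) +
    ‖F.form k β‖ * Real.exp (C * paramSize k β), fun θ h r hr => ?_⟩
  rw [radialDeriv, norm_mul, F.norm_sign, one_mul, add_mul, mul_assoc, mul_assoc, Finset.sum_mul]
  refine (norm_sub_le _ _).trans ?_
  rw [norm_mul, norm_mul]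
  gcongr
  · refine norm_sum_le_of_le _ fun i _ => ?_
    rw [norm_mul, mul_assoc]
    gcongr
    exact h.norm_integrand_le hk (fun F => (hk.form_sub_column_re_le F β i).trans (hβ F)) le_rfl hr
  · exact h.norm_integrand_le hk hβ le_rfl hr

theorem IsBranch.hasDerivAt_eulerMellin_angle (hb : IsBranch k x Θ lz lf) (hk : IsCurve k)
    (hΘ : IsOpen Θ) {β : ℂ × ℂ} (hβ : β ∈ convergenceDomain k) {I : Set ℝ} {C : ℝ}
    (hbound : ∀ φ ∈ I, (φ : Real.Angle) ∈ Θ ∧ RayBound k lz lf φ C) {φ : ℝ} (hφ : I ∈ 𝓝 φ) :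
    HasDerivAt (fun φ : ℝ => eulerMellin lz lf φ β) 0 φ := by
  obtain ⟨δ, hδ, hβδ⟩ := exists_margin hβ
  obtain ⟨B, hB⟩ := exists_norm_radialDeriv_le hk x lz lf .origin (fun F => (hβδ F).le) C
  obtain ⟨hφΘ, hφC⟩ := hbound φ (mem_of_mem_nhds hφ)
  obtain ⟨hint, hzero⟩ := hb.integral_radialDeriv_eq_zero hk hΘ hφΘ hφC .origin hβ
  have hderiv := (hasDerivAt_integral_of_dominated_loc_of_deriv_le (𝕜 := ℝ)
    (F := fun (φ : ℝ) r => integrand lz lf φ β r)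
    (F' := fun φ r => Complex.I * radialDeriv k x .origin lz lf φ β r) hφ
    (eventually_of_mem hφ fun ψ hψ => hb.aestronglyMeasurable_integrand (hbound ψ hψ).1 β)
    (hb.integrableOn_integrand hk hφΘ hφC hβ) (hint.const_mul _).aestronglyMeasurable ?_
    ((integrableOn_exp_neg_mul_abs_log hδ).const_mul B) ?_).2
  · rwa [integral_const_mul, hzero, mul_zero] at hderiv
  · filter_upwards [ae_restrict_mem measurableSet_Ioi] with r hr ψ hψ
    rw [norm_mul, Complex.norm_I, one_mul]
    exact hB ψ (hbound ψ hψ).2 r hr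
  · filter_upwards [ae_restrict_mem measurableSet_Ioi] with r hr ψ hψ
    exact hb.hasDerivAt_angular hk hΘ (hbound ψ hψ).1 .origin β hr

theorem IsBranch.eventually_eulerMellin_eq (hb : IsBranch k x Θ lz lf) (hk : IsCurve k)
    (hx : x ∈ nonzeroEnds n) (hΘ : IsComponent k x Θ) {β : ℂ × ℂ}
    (hβ : β ∈ convergenceDomain k) {φ₀ : ℝ} (hφ₀ : (φ₀ : Real.Angle) ∈ Θ) :
    ∀ᶠ φ : ℝ in 𝓝 φ₀, eulerMellin lz lf φ₀ β = eulerMellin lz lf φ β := by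
  have hopen := hΘ.isOpen hk hx
  obtain ⟨ε, hε, hεΘ⟩ := Metric.nhds_basis_closedBall.mem_iff.1
    (Real.Angle.continuous_coe.continuousAt.preimage_mem_nhds (hopen.mem_nhds hφ₀))
  obtain ⟨C, hC⟩ := hb.exists_rayBound hk hx hΘ
    ((isCompact_closedBall φ₀ ε).image Real.Angle.continuous_coe) (Set.image_subset_iff.2 hεΘ)
  have hderiv : ∀ φ ∈ Metric.ball φ₀ ε, HasDerivAt (fun φ : ℝ => eulerMellin lz lf φ β) 0 φ :=
    fun φ hφ => hb.hasDerivAt_eulerMellin_angle hk hopen hβ (I := Metric.ball φ₀ ε)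
      (fun ψ hψ => have hψ := Metric.ball_subset_closedBall hψ; ⟨hεΘ hψ, hC ψ ⟨ψ, hψ, rfl⟩⟩)
      (Metric.isOpen_ball.mem_nhds hφ)
  filter_upwards [Metric.ball_mem_nhds φ₀ hε] with φ hφ
  exact Metric.isOpen_ball.is_const_of_deriv_eq_zero (convex_ball φ₀ ε).isPreconnected
    (fun φ hφ => (hderiv φ hφ).differentiableAt.differentiableWithinAt)
    (fun φ hφ => (hderiv φ hφ).deriv) (Metric.mem_ball_self hε) hφ

theorem IsBranch.eulerMellin_eq (hb : IsBranch k x Θ lz lf) (hk : IsCurve k)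
    (hx : x ∈ nonzeroEnds n) (hΘ : IsComponent k x Θ) {β : ℂ × ℂ}
    (hβ : β ∈ convergenceDomain k) {θ θ' : Real.Angle} (hθ : θ ∈ Θ) (hθ' : θ' ∈ Θ) :
    eulerMellin lz lf θ β = eulerMellin lz lf θ' β := by
  refine hΘ.isPreconnected.induction₂
    (fun θ θ' => eulerMellin lz lf θ β = eulerMellin lz lf θ' β) (fun θ hθ => ?_)
    (fun _ _ _ _ _ _ h h' => h.trans h') (fun _ _ _ _ h => h.symm) hθ hθ'
  induction θ using Real.Angle.induction_on with
  | _ φ =>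
    have hopen : IsOpenMap Real.Angle.coe := QuotientAddGroup.isOpenMap_coe
    exact nhdsWithin_le_nhds (hopen.nhds_le φ
      (eventually_map.2 (hb.eventually_eulerMellin_eq hk hx hΘ hβ hθ)))

end Rotation

/-! ### The extended Euler–Mellin integral -/

section GammaFactor

variable {n : ℕ} {k : Fin (n + 1) → ℕ}

/-- The meromorphic factor between the Euler–Mellin integral and its extension; it is only used on
the domain of convergence, where it has neither zeros nor poles. -/
noncomputable def gammaFactor (k : Fin (n + 1) → ℕ) (β : ℂ × ℂ) : ℂ :=
  (Complex.Gamma (-β.1))⁻¹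
    * Complex.Gamma (-(Facet.origin.form k β)) * Complex.Gamma (-(Facet.infinity.form k β))
    * Facet.origin.gapProd k (Facet.origin.form k β)
    * Facet.infinity.gapProd k (Facet.infinity.form k β)

theorem gammaFactor_eq (F : Facet) (β : ℂ × ℂ) :
    gammaFactor k β = (Complex.Gamma (-β.1))⁻¹
      * (Complex.Gamma (-(F.form k β)) * Complex.Gamma (-(F.opp.form k β)))
      * (F.gapProd k (F.form k β) * F.opp.gapProd k (F.opp.form k β)) := by
  cases F <;> simp only [gammaFactor, Facet.opp] <;> ring

theorem re_natCast_mul (m : ℕ) (z : ℂ) : ((m : ℂ) * z).re = m * z.re := by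
  rw [← Complex.ofReal_natCast, Complex.re_ofReal_mul]

theorem fst_re_neg_of_mem_convergenceDomain {β : ℂ × ℂ} (hβ : β ∈ convergenceDomain k) :
    β.1.re < 0 := by
  have hsum := congrArg Complex.re (Facet.origin.form_add_form_opp (k := k) β)
  rw [Complex.add_re, re_natCast_mul] at hsum
  by_contra! hre
  exact absurd (add_neg (hβ .origin) (hβ .infinity))
    (not_lt.2 ((mul_nonneg (Nat.cast_nonneg _) hre).trans_eq hsum.symm))

theorem isOpen_convergenceDomain : IsOpen (convergenceDomain k) :=
  isOpen_setOf_forall_form_re_lt 0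

theorem IsCurve.convergenceDomain_nonempty (hk : IsCurve k) : (convergenceDomain k).Nonempty := by
  refine ⟨(-2, -1), fun F => ?_⟩
  have hd : (1 : ℝ) ≤ degree k := Nat.one_le_cast.2 hk.degree_pos
  cases F
  · simp [Facet.form]
  · simp only [Facet.form, Complex.sub_re, re_natCast_mul]
    norm_num
    linarith

theorem IsCurve.gammaFactor_ne_zero (hk : IsCurve k) {β : ℂ × ℂ}
    (hβ : β ∈ convergenceDomain k) : gammaFactor k β ≠ 0 := by
  have hΓ : ∀ s : ℂ, s.re < 0 → Complex.Gamma (-s) ≠ 0 := fun s hs =>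
    Complex.Gamma_ne_zero_of_re_pos (by rwa [Complex.neg_re, neg_pos])
  have hgap : ∀ F : Facet, F.gapProd k (F.form k β) ≠ 0 := fun F =>
    hk.gapProd_ne_zero_of_re_neg F (hβ F)
  have hfst := hΓ _ (fst_re_neg_of_mem_convergenceDomain hβ)
  exact mul_ne_zero (mul_ne_zero (mul_ne_zero (mul_ne_zero (inv_ne_zero hfst) (hΓ _ (hβ _)))
    (hΓ _ (hβ _))) (hgap _)) (hgap _)

theorem IsCurve.differentiableAt_gammaFactor (hk : IsCurve k) {β : ℂ × ℂ}
    (hβ : β ∈ convergenceDomain k) : DifferentiableAt ℂ (gammaFactor k) β := by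
  have hΓ : ∀ F : Facet, DifferentiableAt ℂ (fun β => Complex.Gamma (-(F.form k β))) β := by
    refine fun F => DifferentiableAt.comp β (Complex.differentiableAt_Gamma _ fun m hm => ?_)
      (F.differentiable_form β).neg
    have hre := hβ F
    rw [neg_injective hm, Complex.natCast_re] at hre
    exact absurd hre (not_lt.2 (Nat.cast_nonneg m))
  have hgap : ∀ F : Facet, DifferentiableAt ℂ (fun β => F.gapProd k (F.form k β)) β := fun F =>
    (hk.differentiable_gapProd F).comp F.differentiable_form β
  have hfst : DifferentiableAt ℂ (fun β : ℂ × ℂ => (Complex.Gamma (-β.1))⁻¹) β :=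
    (Complex.differentiable_one_div_Gamma.comp differentiable_fst.neg) β
  exact (((hfst.mul (hΓ _)).mul (hΓ _)).mul (hgap _)).mul (hgap _)

end GammaFactor

section Contiguity

variable {n : ℕ} {k : Fin (n + 1) → ℕ}

theorem IsCurve.exists_contiguityCoeff (hk : IsCurve k) (F : Facet) (i : Fin (n + 1)) :
    ∃ c : ℂ × ℂ → ℂ, Differentiable ℂ c ∧ (F.weight k i = 0 → c = 0) ∧
      ∀ β, c β * (F.gapProd k (F.form k β) * F.opp.gapProd k (F.opp.form k β)) =
        F.weight k i * (∏ j ∈ Finset.Ico 1 (F.weight k i), ((j : ℂ) - F.form k β)) *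
          (∏ j ∈ Finset.range (F.opp.weight k i), ((j : ℂ) - F.opp.form k β)) *
          (F.gapProd k (F.form k (β - column k i)) *
            F.opp.gapProd k (F.opp.form k (β - column k i))) := by
  rcases Nat.eq_zero_or_pos (F.weight k i) with hi | hi
  · exact ⟨0, differentiable_const _, fun _ => rfl, fun β => by simp [hi]⟩
  -- `0` is not a gap, so the factor `j = 0` is not needed to cancel the gaps of `F`.
  obtain ⟨Q, hQ, hQ'⟩ := hk.exists_mul_gapProd_eq F (F.weight_mem_monoid i)
    (J := Finset.Ico 1 (F.weight k i)) (fun j hj => (Finset.mem_Ico.1 hj).2) (fun j hj hj' =>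
      Finset.mem_Ico.2 ⟨Nat.one_le_iff_ne_zero.2 fun h => hj (h ▸ zero_mem _), hj'⟩)
  obtain ⟨R, hR, hR'⟩ := hk.exists_mul_gapProd_eq F.opp (F.opp.weight_mem_monoid i)
    (J := Finset.range (F.opp.weight k i)) (fun j hj => Finset.mem_range.1 hj)
    (fun j _ hj' => Finset.mem_range.2 hj')
  refine ⟨fun β => F.weight k i * Q (F.form k β) * R (F.opp.form k β),
    ((hQ.comp F.differentiable_form).const_mul _).mul (hR.comp F.opp.differentiable_form),
    fun h => absurd h hi.ne', fun β => ?_⟩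
  rw [hk.form_sub_column, hk.form_sub_column]
  linear_combination (F.weight k i : ℂ) * R (F.opp.form k β) *
      F.opp.gapProd k (F.opp.form k β) * hQ' (F.form k β) +
    (F.weight k i : ℂ) * (∏ j ∈ Finset.Ico 1 (F.weight k i), ((j : ℂ) - F.form k β)) *
      F.gapProd k (F.form k β - F.weight k i) * hR' (F.opp.form k β)

/-- The entire coefficients of the contiguity relation for the facet `F`, which expresses the
extended Euler–Mellin integral at `β` by its values at `β` minus the columns of `A`. -/
noncomputable def IsCurve.contiguityCoeff (hk : IsCurve k) (F : Facet) (i : Fin (n + 1)) :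
    ℂ × ℂ → ℂ :=
  (hk.exists_contiguityCoeff F i).choose

theorem IsCurve.differentiable_contiguityCoeff (hk : IsCurve k) (F : Facet) (i : Fin (n + 1)) :
    Differentiable ℂ (hk.contiguityCoeff F i) :=
  (hk.exists_contiguityCoeff F i).choose_spec.1

theorem IsCurve.contiguityCoeff_eq_zero (hk : IsCurve k) {F : Facet} {i : Fin (n + 1)}
    (h : F.weight k i = 0) : hk.contiguityCoeff F i = 0 :=
  (hk.exists_contiguityCoeff F i).choose_spec.2.1 h

theorem IsCurve.contiguityCoeff_mul (hk : IsCurve k) (F : Facet) (i : Fin (n + 1)) (β : ℂ × ℂ) :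
    hk.contiguityCoeff F i β * (F.gapProd k (F.form k β) * F.opp.gapProd k (F.opp.form k β)) =
      F.weight k i * (∏ j ∈ Finset.Ico 1 (F.weight k i), ((j : ℂ) - F.form k β)) *
        (∏ j ∈ Finset.range (F.opp.weight k i), ((j : ℂ) - F.opp.form k β)) *
        (F.gapProd k (F.form k (β - column k i)) *
          F.opp.gapProd k (F.opp.form k (β - column k i))) :=
  (hk.exists_contiguityCoeff F i).choose_spec.2.2 β

theorem Gamma_natCast_sub {s : ℂ} (hs : ∀ j : ℕ, s ≠ j) (a : ℕ) :
    Complex.Gamma (a - s) = (∏ j ∈ Finset.range a, ((j : ℂ) - s)) * Complex.Gamma (-s) := by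
  have hrec := inv_Gamma_neg_eq s a
  have hneg : Complex.Gamma (-s) ≠ 0 := Complex.Gamma_ne_zero fun m hm => hs m (neg_injective hm)
  have hsub : Complex.Gamma (a - s) ≠ 0 := Complex.Gamma_ne_zero fun m hm =>
    hs (a + m) (by push_cast; linear_combination -hm)
  field_simp at hrec
  rw [hrec, mul_comm]

theorem ne_natCast_of_re_neg {s : ℂ} (hs : s.re < 0) (j : ℕ) : s ≠ j := fun h =>
  absurd (h ▸ hs) (by simp)

theorem prod_range_eq_neg_mul_prod_Ico (s : ℂ) {a : ℕ} (ha : 0 < a) :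
    ∏ j ∈ Finset.range a, ((j : ℂ) - s) = -s * ∏ j ∈ Finset.Ico 1 a, ((j : ℂ) - s) := by
  rw [Finset.range_eq_Ico, Finset.prod_eq_prod_Ico_succ_bot ha, Nat.cast_zero, zero_sub]

theorem inv_Gamma_neg_fst (β : ℂ × ℂ) (i : Fin (n + 1)) :
    (Complex.Gamma (-β.1))⁻¹ = -β.1 * (Complex.Gamma (-(β - column k i).1))⁻¹ := by
  have hrec := inv_Gamma_neg_eq β.1 1
  rw [Finset.prod_range_one, Nat.cast_zero, Nat.cast_one, zero_sub] at hrec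
  rw [hrec, Prod.fst_sub, column, neg_sub]

theorem IsCurve.fst_mul_gammaFactor (hk : IsCurve k) (F : Facet) (i : Fin (n + 1)) {β : ℂ × ℂ}
    (hβ : β ∈ convergenceDomain k) :
    β.1 * F.weight k i * gammaFactor k (β - column k i) =
      F.form k β * hk.contiguityCoeff F i β * gammaFactor k β := by
  rcases Nat.eq_zero_or_pos (F.weight k i) with hi | hi
  · simp [hi, hk.contiguityCoeff_eq_zero hi]
  have hform : ∀ F' : Facet, -(F'.form k (β - column k i)) = F'.weight k i - F'.form k β :=
    fun F' => by rw [hk.form_sub_column, neg_sub]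
  rw [gammaFactor_eq F, gammaFactor_eq F β, hform, hform, inv_Gamma_neg_fst (k := k) β i,
    Gamma_natCast_sub (ne_natCast_of_re_neg (hβ F)),
    Gamma_natCast_sub (ne_natCast_of_re_neg (hβ F.opp)), prod_range_eq_neg_mul_prod_Ico _ hi]
  linear_combination F.form k β * β.1 * (Complex.Gamma (-(β - column k i).1))⁻¹ *
    Complex.Gamma (-F.form k β) * Complex.Gamma (-F.opp.form k β) * hk.contiguityCoeff_mul F i β

theorem IsCurve.eq_sum_contiguityCoeff_mul (hk : IsCurve k) {x : Fin (n + 1) → ℂ}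
    {M Ψ : ℂ × ℂ → ℂ} {F : Facet}
    (hM : ∀ β ∈ convergenceDomain k, F.form k β * M β =
      β.1 * ∑ i, (F.weight k i : ℂ) * x i * M (β - column k i))
    (hΨ : ∀ β ∈ convergenceDomain k, M β = Ψ β * gammaFactor k β) {β : ℂ × ℂ}
    (hβ : β ∈ convergenceDomain k) :
    Ψ β = ∑ i, hk.contiguityCoeff F i β * x i * Ψ (β - column k i) := by
  have hform : F.form k β ≠ 0 := fun h => (hβ F).ne (by rw [h, Complex.zero_re])
  apply mul_left_cancel₀ (mul_ne_zero hform (hk.gammaFactor_ne_zero hβ))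
  calc F.form k β * gammaFactor k β * Ψ β = F.form k β * M β := by rw [hΨ β hβ]; ring
    _ = ∑ i, β.1 * (F.weight k i * x i * M (β - column k i)) := by rw [hM β hβ, Finset.mul_sum]
    _ = F.form k β * gammaFactor k β *
        ∑ i, hk.contiguityCoeff F i β * x i * Ψ (β - column k i) := by
      rw [Finset.mul_sum]
      refine Finset.sum_congr rfl fun i _ => ?_
      rw [hΨ _ (hk.sub_column_mem hβ i)]
      linear_combination x i * Ψ (β - column k i) * hk.fst_mul_gammaFactor F i hβ

end Contiguity

section Continuation

theorem eq_of_eventuallyEq_of_differentiable {E : Type*} [NormedAddCommGroup E] [NormedSpace ℂ E]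
    {f g : E → ℂ} (hf : Differentiable ℂ f) (hg : Differentiable ℂ g) {p : E}
    (h : f =ᶠ[𝓝 p] g) : f = g := by
  funext q
  let c : ℂ → E := fun t => p + t • (q - p)
  have hc : Differentiable ℂ c := by fun_prop
  have hc₀ : Tendsto c (𝓝 0) (𝓝 p) := by
    simpa only [c, zero_smul, add_zero] using hc.continuous.tendsto 0
  have hline := AnalyticOnNhd.eqOn_of_preconnected_of_eventuallyEq
    ((hf.comp hc).differentiableOn.analyticOnNhd isOpen_univ)
    ((hg.comp hc).differentiableOn.analyticOnNhd isOpen_univ) isPreconnected_univ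
    (Set.mem_univ (0 : ℂ)) (hc₀.eventually h) (Set.mem_univ 1)
  simpa only [c, Function.comp_apply, one_smul, add_sub_cancel] using hline

theorem exists_differentiable_eqOn_of_exhaustion {𝕜 E G : Type*} [NontriviallyNormedField 𝕜]
    [NormedAddCommGroup E] [NormedSpace 𝕜 E] [NormedAddCommGroup G] [NormedSpace 𝕜 G]
    {D : ℕ → Set E} (hopen : ∀ m, IsOpen (D m)) (hmono : Monotone D) (hcover : ∀ p, ∃ m, p ∈ D m)
    {T : (E → G) → E → G}
    (hTeq : ∀ m Φ Φ', Set.EqOn Φ Φ' (D m) → Set.EqOn (T Φ) (T Φ') (D (m + 1)))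
    (hTdiff : ∀ m Φ, DifferentiableOn 𝕜 Φ (D m) → DifferentiableOn 𝕜 (T Φ) (D (m + 1)))
    {ψ : E → G} (hψ : DifferentiableOn 𝕜 ψ (D 0)) (hTψ : Set.EqOn (T ψ) ψ (D 0)) :
    ∃ Ψ : E → G, Differentiable 𝕜 Ψ ∧ Set.EqOn Ψ ψ (D 0) := by
  let Φ : ℕ → E → G := fun m => T^[m] ψ
  have hsucc : ∀ m, Φ (m + 1) = T (Φ m) := fun m => Function.iterate_succ_apply' T m ψ
  have hstep : ∀ m, Set.EqOn (Φ (m + 1)) (Φ m) (D m) := by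
    intro m
    induction m with
    | zero => exact hTψ
    | succ m ih => simpa only [← hsucc] using hTeq m _ _ ih
  have hle : ∀ m p, m ≤ p → Set.EqOn (Φ p) (Φ m) (D m) := by
    intro m p hmp
    induction p, hmp using Nat.le_induction with
    | base => exact fun _ _ => rfl
    | succ p hp ih => exact fun β hβ => (hstep p (hmono hp hβ)).trans (ih hβ)
  have hdiff : ∀ m, DifferentiableOn 𝕜 (Φ m) (D m) := by
    intro m
    induction m with
    | zero => exact hψ
    | succ m ih => exact hsucc m ▸ hTdiff m _ ih
  choose m hm using hcover
  have hglue : ∀ p, Set.EqOn (fun q => Φ (m q) q) (Φ p) (D p) := fun p q hq =>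
    (hle _ _ (le_max_left (m q) p) (hm q)).symm.trans (hle _ _ (le_max_right (m q) p) hq)
  have hnhds : ∀ q, D (m q) ∈ 𝓝 q := fun q => (hopen _).mem_nhds (hm q)
  exact ⟨fun q => Φ (m q) q, fun q =>
    ((hdiff (m q)).differentiableAt (hnhds q)).congr_of_eventuallyEq
      ((hglue (m q)).eventuallyEq_of_mem (hnhds q)), hglue 0⟩

variable {n : ℕ} {k : Fin (n + 1) → ℕ}

theorem exists_forall_form_re_lt_natCast (k : Fin (n + 1) → ℕ) (β : ℂ × ℂ) :
    ∃ m : ℕ, ∀ F : Facet, (F.form k β).re < m := by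
  obtain ⟨m₀, h₀⟩ := exists_nat_gt (Facet.origin.form k β).re
  obtain ⟨m₁, h₁⟩ := exists_nat_gt (Facet.infinity.form k β).re
  refine ⟨max m₀ m₁, fun F => ?_⟩
  cases F
  · exact h₀.trans_le (Nat.cast_le.2 (le_max_left _ _))
  · exact h₁.trans_le (Nat.cast_le.2 (le_max_right _ _))

theorem exists_differentiable_eqOn_of_shift {ι : Type*} [Fintype ι] {c : ι → ℂ × ℂ → ℂ}
    {γ : ι → ℂ × ℂ} (hc : ∀ j, Differentiable ℂ (c j))
    (hγ : ∀ j, c j = 0 ∨ ∀ F : Facet, 1 ≤ (F.form k (γ j)).re) {ψ : ℂ × ℂ → ℂ}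
    (hψ : DifferentiableOn ℂ ψ (convergenceDomain k))
    (hrec : ∀ β ∈ convergenceDomain k, ψ β = ∑ j, c j β * ψ (β - γ j)) :
    ∃ Ψ : ℂ × ℂ → ℂ, Differentiable ℂ Ψ ∧ Set.EqOn Ψ ψ (convergenceDomain k) := by
  let D : ℕ → Set (ℂ × ℂ) := fun m => {β | ∀ F : Facet, (F.form k β).re < m}
  have hD₀ : D 0 = convergenceDomain k := by simp only [D, Nat.cast_zero, convergenceDomain]
  have hshift : ∀ j m, c j ≠ 0 → ∀ β ∈ D (m + 1), β - γ j ∈ D m := by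
    intro j m hj β hβ F
    have hγF := (hγ j).resolve_left hj F
    have hβF := hβ F
    rw [F.form_sub, Complex.sub_re]
    push_cast at hβF
    linarith
  rw [← hD₀] at hψ hrec ⊢
  refine exists_differentiable_eqOn_of_exhaustion (T := fun Φ β => ∑ j, c j β * Φ (β - γ j))
    (fun m => isOpen_setOf_forall_form_re_lt m)
    (fun m m' hm β hβ F => (hβ F).trans_le (Nat.cast_le.2 hm))
    (exists_forall_form_re_lt_natCast k) (fun m Φ Φ' h β hβ => ?_) (fun m Φ h => ?_) hψ
    (fun β hβ => (hrec β hβ).symm)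
  · refine Finset.sum_congr rfl fun j _ => ?_
    by_cases hj : c j = 0
    · simp only [hj, Pi.zero_apply, zero_mul]
    · rw [h (hshift j m hj β hβ)]
  · refine DifferentiableOn.fun_sum fun j _ => ?_
    by_cases hj : c j = 0
    · simp only [hj, Pi.zero_apply, zero_mul, differentiableOn_const]
    · exact (hc j).differentiableOn.mul
        (h.comp (differentiableOn_id.sub_const (γ j)) (hshift j m hj))

theorem IsCurve.form_column (hk : IsCurve k) (F : Facet) (i : Fin (n + 1)) :
    F.form k (column k i) = F.weight k i := by
  have hzero : F.form k 0 = 0 := by cases F <;> simp [Facet.form]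
  have hsub := hk.form_sub_column F (column k i) i
  rw [sub_self, hzero] at hsub
  exact sub_eq_zero.1 hsub.symm

theorem Facet.form_add (F : Facet) (β γ : ℂ × ℂ) :
    F.form k (β + γ) = F.form k β + F.form k γ := by
  cases F
  · rfl
  · simp only [Facet.form, Prod.fst_add, Prod.snd_add]
    ring

theorem IsCurve.one_le_re_form_column_add_column (hk : IsCurve k) {i j : Fin (n + 1)}
    (hi : Facet.origin.weight k i ≠ 0) (hj : Facet.infinity.weight k j ≠ 0) (F : Facet) :
    1 ≤ (F.form k (column k i + column k j)).re := by
  rw [F.form_add, hk.form_column, hk.form_column]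
  norm_cast
  cases F <;> omega

/-- The relation of `F` shifts by columns on which the form of `F` is positive, but that of `F.opp`
may vanish; composing the relations of both facets leaves only shifts that enlarge the domain. -/
theorem IsCurve.exists_differentiable_eqOn_of_contiguity (hk : IsCurve k) {x : Fin (n + 1) → ℂ}
    {ψ : ℂ × ℂ → ℂ} (hψ : DifferentiableOn ℂ ψ (convergenceDomain k))
    (hrec : ∀ F : Facet, ∀ β ∈ convergenceDomain k,
      ψ β = ∑ i, hk.contiguityCoeff F i β * x i * ψ (β - column k i)) :
    ∃ Ψ : ℂ × ℂ → ℂ, Differentiable ℂ Ψ ∧ Set.EqOn Ψ ψ (convergenceDomain k) := by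
  let c : Fin (n + 1) × Fin (n + 1) → ℂ × ℂ → ℂ := fun q β =>
    hk.contiguityCoeff .origin q.1 β * x q.1 *
      (hk.contiguityCoeff .infinity q.2 (β - column k q.1) * x q.2)
  refine exists_differentiable_eqOn_of_shift (c := c) (γ := fun q => column k q.1 + column k q.2)
    (fun q => ?_) (fun q => ?_) hψ (fun β hβ => ?_)
  · exact ((hk.differentiable_contiguityCoeff .origin q.1).mul_const _).mul
      (((hk.differentiable_contiguityCoeff .infinity q.2).comp
        (differentiable_id.sub_const (column k q.1))).mul_const (x q.2))
  · by_cases hi : Facet.origin.weight k q.1 = 0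
    · exact Or.inl (funext fun β => by simp [c, hk.contiguityCoeff_eq_zero hi])
    by_cases hj : Facet.infinity.weight k q.2 = 0
    · exact Or.inl (funext fun β => by simp [c, hk.contiguityCoeff_eq_zero hj])
    exact Or.inr (hk.one_le_re_form_column_add_column hi hj)
  · rw [hrec .origin β hβ, Fintype.sum_prod_type]
    refine Finset.sum_congr rfl fun i _ => ?_
    rw [hrec .infinity _ (hk.sub_column_mem hβ i), Finset.mul_sum]
    refine Finset.sum_congr rfl fun j _ => ?_
    rw [sub_add_eq_sub_sub, ← mul_assoc]

end Continuation

section ExtendedEulerMellin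

variable {n : ℕ} {k : Fin (n + 1) → ℕ} {x : Fin (n + 1) → ℂ} {Θ : Set Real.Angle} {lz lf : ℂ → ℂ}

theorem IsExtendedEulerMellin.eulerMellin_eq_mul_gammaFactor {Ψ : ℂ × ℂ → ℂ}
    (h : IsExtendedEulerMellin k Θ lz lf Ψ) {θ : Real.Angle} (hθ : θ ∈ Θ) {β : ℂ × ℂ}
    (hβ : β ∈ convergenceDomain k) : eulerMellin lz lf θ β = Ψ β * gammaFactor k β := by
  rw [h.eq θ hθ β hβ, gammaFactor]
  ring

theorem IsBranch.exists_rayBound_of_mem (hb : IsBranch k x Θ lz lf) (hk : IsCurve k)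
    (hx : x ∈ nonzeroEnds n) (hΘ : IsComponent k x Θ) {θ : Real.Angle} (hθ : θ ∈ Θ) :
    ∃ C, RayBound k lz lf θ C :=
  (hb.exists_rayBound hk hx hΘ isCompact_singleton (Set.singleton_subset_iff.2 hθ)).imp
    fun _ hC => hC θ rfl

theorem IsBranch.exists_isExtendedEulerMellin (hb : IsBranch k x Θ lz lf) (hk : IsCurve k)
    (hx : x ∈ nonzeroEnds n) (hΘ : IsComponent k x Θ) :
    ∃ Ψ, IsExtendedEulerMellin k Θ lz lf Ψ := by
  obtain ⟨θ₀, hθ₀⟩ := hΘ.nonempty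
  obtain ⟨C₀, hC₀⟩ := hb.exists_rayBound_of_mem hk hx hΘ hθ₀
  let ψ : ℂ × ℂ → ℂ := fun β => eulerMellin lz lf θ₀ β * (gammaFactor k β)⁻¹
  have hψ : ∀ β ∈ convergenceDomain k, eulerMellin lz lf θ₀ β = ψ β * gammaFactor k β :=
    fun β hβ => (inv_mul_cancel_right₀ (hk.gammaFactor_ne_zero hβ) _).symm
  have hdiff : DifferentiableOn ℂ ψ (convergenceDomain k) := fun β hβ =>
    ((hb.differentiableAt_eulerMellin hk hθ₀ hC₀ hβ).mul
      ((hk.differentiableAt_gammaFactor hβ).inv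
        (hk.gammaFactor_ne_zero hβ))).differentiableWithinAt
  obtain ⟨Ψ, hΨ, hΨψ⟩ := hk.exists_differentiable_eqOn_of_contiguity hdiff fun F β hβ =>
    hk.eq_sum_contiguityCoeff_mul
      (fun β hβ => hb.form_mul_eulerMellin hk (hΘ.isOpen hk hx) hθ₀ hC₀ F hβ) hψ hβ
  refine ⟨Ψ, hΨ, fun θ hθ β hβ => ?_, fun θ hθ β hβ => ?_⟩
  · obtain ⟨C, hC⟩ := hb.exists_rayBound_of_mem hk hx hΘ hθ
    exact hb.integrableOn_integrand hk hθ hC hβ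
  · rw [hb.eulerMellin_eq hk hx hΘ hβ hθ hθ₀, hψ β hβ, ← hΨψ hβ, gammaFactor]
    ring

theorem IsExtendedEulerMellin.unique (hk : IsCurve k) (hΘ : IsComponent k x Θ)
    {Ψ Ψ' : ℂ × ℂ → ℂ} (h : IsExtendedEulerMellin k Θ lz lf Ψ)
    (h' : IsExtendedEulerMellin k Θ lz lf Ψ') : Ψ = Ψ' := by
  obtain ⟨θ, hθ⟩ := hΘ.nonempty
  obtain ⟨β₀, hβ₀⟩ := hk.convergenceDomain_nonempty
  refine eq_of_eventuallyEq_of_differentiable h.entire h'.entire (p := β₀) ?_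
  filter_upwards [isOpen_convergenceDomain.mem_nhds hβ₀] with β hβ
  refine mul_right_cancel₀ (hk.gammaFactor_ne_zero hβ) ?_
  rw [← h.eulerMellin_eq_mul_gammaFactor hθ hβ, h'.eulerMellin_eq_mul_gammaFactor hθ hβ]

end ExtendedEulerMellin

/-! ### Restriction to polar lines -/

section ReducedEulerMellin

variable {n : ℕ} {k : Fin (n + 1) → ℕ} {x : Fin (n + 1) → ℂ} {Θ : Set Real.Angle}
  {lz lf : ℂ → ℂ} {Ψ : ℂ × ℂ → ℂ}

theorem IsExtendedEulerMellin.eq_sum_contiguityCoeff_mul (h : IsExtendedEulerMellin k Θ lz lf Ψ)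
    (hb : IsBranch k x Θ lz lf) (hk : IsCurve k) (hx : x ∈ nonzeroEnds n)
    (hΘ : IsComponent k x Θ) (F : Facet) (β : ℂ × ℂ) :
    Ψ β = ∑ i, hk.contiguityCoeff F i β * x i * Ψ (β - column k i) := by
  obtain ⟨θ, hθ⟩ := hΘ.nonempty
  obtain ⟨C, hC⟩ := hb.exists_rayBound_of_mem hk hx hΘ hθ
  obtain ⟨β₀, hβ₀⟩ := hk.convergenceDomain_nonempty
  have hsum : Differentiable ℂ
      fun β => ∑ i, hk.contiguityCoeff F i β * x i * Ψ (β - column k i) :=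
    Differentiable.fun_sum fun i _ => ((hk.differentiable_contiguityCoeff F i).mul_const _).mul
      (h.entire.comp (differentiable_id.sub_const _))
  refine congrFun (eq_of_eventuallyEq_of_differentiable h.entire hsum (p := β₀) ?_) β
  filter_upwards [isOpen_convergenceDomain.mem_nhds hβ₀] with β hβ
  exact hk.eq_sum_contiguityCoeff_mul
    (fun β hβ => hb.form_mul_eulerMellin hk (hΘ.isOpen hk hx) hθ hC F hβ)
    (fun β hβ => h.eulerMellin_eq_mul_gammaFactor hθ hβ) hβ

/-- The entire continuation in `β` of the Euler–Mellin integral divided by the two Gamma factors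
`Γ(-F(β))` of the facets `F`, in terms of the extended Euler–Mellin integral `Ψ`. -/
noncomputable def reducedEulerMellin (k : Fin (n + 1) → ℕ) (Ψ : ℂ × ℂ → ℂ) (F : Facet)
    (β : ℂ × ℂ) : ℂ :=
  (Complex.Gamma (-β.1))⁻¹ *
    (Ψ β * (F.gapProd k (F.form k β) * F.opp.gapProd k (F.opp.form k β)))

theorem IsExtendedEulerMellin.eulerMellin_eq_reducedEulerMellin_mul
    (h : IsExtendedEulerMellin k Θ lz lf Ψ) (F : Facet) {θ : Real.Angle} (hθ : θ ∈ Θ) {β : ℂ × ℂ}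
    (hβ : β ∈ convergenceDomain k) :
    eulerMellin lz lf θ β = reducedEulerMellin k Ψ F β *
      (Complex.Gamma (-(F.form k β)) * Complex.Gamma (-(F.opp.form k β))) := by
  rw [h.eulerMellin_eq_mul_gammaFactor hθ hβ, gammaFactor_eq F, reducedEulerMellin]
  ring

theorem IsExtendedEulerMellin.differentiable_reducedEulerMellin
    (h : IsExtendedEulerMellin k Θ lz lf Ψ) (hk : IsCurve k) (F : Facet) :
    Differentiable ℂ (reducedEulerMellin k Ψ F) := by
  have hgap : ∀ F' : Facet, Differentiable ℂ fun β => F'.gapProd k (F'.form k β) := fun F' =>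
    (hk.differentiable_gapProd F').comp F'.differentiable_form
  exact (Complex.differentiable_one_div_Gamma.comp differentiable_fst.neg).mul
    (h.entire.mul ((hgap F).mul (hgap F.opp)))

theorem IsExtendedEulerMellin.reducedEulerMellin_eq (h : IsExtendedEulerMellin k Θ lz lf Ψ)
    (hb : IsBranch k x Θ lz lf) (hk : IsCurve k) (hx : x ∈ nonzeroEnds n)
    (hΘ : IsComponent k x Θ) (F : Facet) (β : ℂ × ℂ) :
    reducedEulerMellin k Ψ F β = -β.1 * ∑ i, F.weight k i * x i *
      ((∏ j ∈ Finset.Ico 1 (F.weight k i), ((j : ℂ) - F.form k β)) *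
      (∏ j ∈ Finset.range (F.opp.weight k i), ((j : ℂ) - F.opp.form k β)) *
      reducedEulerMellin k Ψ F (β - column k i)) := by
  rw [reducedEulerMellin, h.eq_sum_contiguityCoeff_mul hb hk hx hΘ F β, Finset.sum_mul,
    Finset.mul_sum, Finset.mul_sum]
  refine Finset.sum_congr rfl fun i _ => ?_
  rw [reducedEulerMellin, inv_Gamma_neg_fst (k := k) β i]
  linear_combination -β.1 * (Complex.Gamma (-(β - column k i).1))⁻¹ * x i *
    Ψ (β - column k i) * hk.contiguityCoeff_mul F i β

theorem IsExtendedEulerMellin.form_mul_reducedEulerMellin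
    (h : IsExtendedEulerMellin k Θ lz lf Ψ) (hb : IsBranch k x Θ lz lf) (hk : IsCurve k)
    (hx : x ∈ nonzeroEnds n) (hΘ : IsComponent k x Θ) (F : Facet) (β : ℂ × ℂ) :
    F.form k β * reducedEulerMellin k Ψ F β = β.1 * ∑ i, F.weight k i * x i *
      ((∏ j ∈ Finset.range (F.weight k i), ((j : ℂ) - F.form k β)) *
      (∏ j ∈ Finset.range (F.opp.weight k i), ((j : ℂ) - F.opp.form k β)) *
      reducedEulerMellin k Ψ F (β - column k i)) := by
  rw [h.reducedEulerMellin_eq hb hk hx hΘ F β, Finset.mul_sum, Finset.mul_sum, Finset.mul_sum]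
  refine Finset.sum_congr rfl fun i _ => ?_
  rcases Nat.eq_zero_or_pos (F.weight k i) with hi | hi
  · simp only [hi, Nat.cast_zero, zero_mul, mul_zero]
  · rw [prod_range_eq_neg_mul_prod_Ico _ hi]
    ring

theorem prod_Ico_one_natCast {w : ℕ} (hw : 0 < w) :
    ∏ j ∈ Finset.Ico 1 w, (j : ℂ) = Complex.Gamma w := by
  obtain ⟨m, rfl⟩ := Nat.exists_eq_add_one.2 hw
  rw [Nat.cast_succ, Complex.Gamma_nat_eq_factorial, ← Finset.prod_Ico_id_eq_factorial,
    Nat.cast_prod]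

theorem IsExtendedEulerMellin.reducedEulerMellin_sub_column_of_form_eq_zero
    (h : IsExtendedEulerMellin k Θ lz lf Ψ) (hk : IsCurve k) {F : Facet} {θ : Real.Angle}
    (hθ : θ ∈ Θ) {β : ℂ × ℂ} (hβ : F.form k β = 0) (hβ' : (F.opp.form k β).re < 0)
    {i : Fin (n + 1)} (hi : F.weight k i ≠ 0) :
    (∏ j ∈ Finset.Ico 1 (F.weight k i), ((j : ℂ) - F.form k β)) *
      (∏ j ∈ Finset.range (F.opp.weight k i), ((j : ℂ) - F.opp.form k β)) *
      reducedEulerMellin k Ψ F (β - column k i) =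
      (Complex.Gamma (-(F.opp.form k β)))⁻¹ * eulerMellin lz lf θ (β - column k i) := by
  have hopp : ∀ j : ℕ, F.opp.form k β ≠ j := ne_natCast_of_re_neg hβ'
  have hΓ : Complex.Gamma (-(F.opp.form k β)) ≠ 0 :=
    Complex.Gamma_ne_zero fun m hm => hopp m (neg_injective hm)
  simp only [h.eulerMellin_eq_reducedEulerMellin_mul F hθ
    (hk.sub_column_mem_of_form_eq_zero hβ hβ' hi), hk.form_sub_column, neg_sub, hβ, sub_zero,
    prod_Ico_one_natCast (Nat.pos_of_ne_zero hi), Gamma_natCast_sub hopp]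
  field_simp

theorem IsExtendedEulerMellin.reducedEulerMellin_of_form_eq_zero
    (h : IsExtendedEulerMellin k Θ lz lf Ψ) (hb : IsBranch k x Θ lz lf) (hk : IsCurve k)
    (hx : x ∈ nonzeroEnds n) (hΘ : IsComponent k x Θ) {F : Facet} {v : ℂ}
    (hv : IsVertexLog k Θ lz lf v F) {β : ℂ × ℂ} (hβ : F.form k β = 0)
    (hβ' : (F.opp.form k β).re < 0) :
    reducedEulerMellin k Ψ F β =
      (Complex.Gamma (-(F.opp.form k β)))⁻¹ * Complex.exp (β.1 * v) := by
  obtain ⟨θ, hθ⟩ := hΘ.nonempty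
  obtain ⟨C, hC⟩ := hb.exists_rayBound_of_mem hk hx hΘ hθ
  have hsum := hb.sum_eulerMellin_of_form_eq_zero hk (hΘ.isOpen hk hx) hθ hC hv hβ hβ'
  calc reducedEulerMellin k Ψ F β
      = -β.1 * ∑ i, (Complex.Gamma (-(F.opp.form k β)))⁻¹ *
          (F.weight k i * x i * eulerMellin lz lf θ (β - column k i)) := by
        rw [h.reducedEulerMellin_eq hb hk hx hΘ F β]
        refine congrArg _ (Finset.sum_congr rfl fun i _ => ?_)
        rcases eq_or_ne (F.weight k i) 0 with hi | hi
        · simp only [hi, Nat.cast_zero, zero_mul, mul_zero]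
        · rw [h.reducedEulerMellin_sub_column_of_form_eq_zero hk hθ hβ hβ' hi]
          ring
    _ = (Complex.Gamma (-(F.opp.form k β)))⁻¹ * Complex.exp (β.1 * v) := by
        rw [← Finset.mul_sum]
        linear_combination -(Complex.Gamma (-(F.opp.form k β)))⁻¹ * hsum

end ReducedEulerMellin

section PolarLine

variable {n : ℕ} {k : Fin (n + 1) → ℕ} {x : Fin (n + 1) → ℂ} {Θ : Set Real.Angle}
  {lz lf : ℂ → ℂ} {Ψ : ℂ × ℂ → ℂ}

/-- The parametrization of the polar line `polarLine k F N` by `t = β₁`. -/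
def linePoint (k : Fin (n + 1) → ℕ) : Facet → ℕ → ℂ → ℂ × ℂ
  | .origin, N, t => (t, N)
  | .infinity, N, t => (t, degree k * t - N)

theorem form_linePoint (F : Facet) (N : ℕ) (t : ℂ) : F.form k (linePoint k F N t) = N := by
  cases F
  · rfl
  · exact sub_sub_cancel _ _

theorem linePoint_fst (F : Facet) (N : ℕ) (t : ℂ) : (linePoint k F N t).1 = t := by
  cases F <;> rfl

theorem form_opp_linePoint (F : Facet) (N : ℕ) (t : ℂ) :
    F.opp.form k (linePoint k F N t) = degree k * t - N := by
  have h := F.form_add_form_opp (k := k) (linePoint k F N t)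
  rw [form_linePoint, linePoint_fst] at h
  linear_combination h

theorem eq_linePoint {F : Facet} {N : ℕ} {β : ℂ × ℂ} (h : F.form k β = N) :
    β = linePoint k F N β.1 := by
  cases F
  · exact Prod.ext rfl h
  · exact Prod.ext rfl (by rw [linePoint, ← h, Facet.form, sub_sub_cancel])

theorem IsCurve.linePoint_sub_column (hk : IsCurve k) {F : Facet} {N : ℕ} {i : Fin (n + 1)}
    (hi : F.weight k i ≤ N) (t : ℂ) :
    linePoint k F N t - column k i = linePoint k F (N - F.weight k i) (t - 1) := by
  have hform : F.form k (linePoint k F N t - column k i) = (N - F.weight k i : ℕ) := by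
    rw [hk.form_sub_column, form_linePoint, Nat.cast_sub hi]
  rw [eq_linePoint hform, Prod.fst_sub, linePoint_fst, column]

theorem differentiable_linePoint (F : Facet) (N : ℕ) : Differentiable ℂ (linePoint k F N) := by
  cases F
  · exact differentiable_id.prodMk (differentiable_const _)
  · exact differentiable_id.prodMk ((differentiable_id.const_mul _).sub_const _)

theorem IsExtendedEulerMellin.reducedEulerMellin_linePoint_zero
    (h : IsExtendedEulerMellin k Θ lz lf Ψ) (hb : IsBranch k x Θ lz lf) (hk : IsCurve k)
    (hx : x ∈ nonzeroEnds n) (hΘ : IsComponent k x Θ) {F : Facet} {v : ℂ}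
    (hv : IsVertexLog k Θ lz lf v F) (t : ℂ) :
    reducedEulerMellin k Ψ F (linePoint k F 0 t) =
      (Complex.Gamma (-(degree k * t)))⁻¹ * Complex.exp (t * v) := by
  have hleft : Differentiable ℂ fun t => reducedEulerMellin k Ψ F (linePoint k F 0 t) :=
    (h.differentiable_reducedEulerMellin hk F).comp (differentiable_linePoint F 0)
  have hright : Differentiable ℂ
      fun t => (Complex.Gamma (-(degree k * t)))⁻¹ * Complex.exp (t * v) :=
    (differentiable_inv_Gamma_comp (differentiable_id.const_mul _).neg).mul
      (differentiable_id.mul_const v).cexp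
  refine congrFun (eq_of_eventuallyEq_of_differentiable hleft hright (p := -1) ?_) t
  filter_upwards [(isOpen_lt Complex.continuous_re continuous_const).mem_nhds
    (show (-1 : ℂ).re < 0 by simp)] with t ht
  have hform : F.form k (linePoint k F 0 t) = 0 := by rw [form_linePoint, Nat.cast_zero]
  have hopp : F.opp.form k (linePoint k F 0 t) = degree k * t := by
    rw [form_opp_linePoint, Nat.cast_zero, sub_zero]
  have hre : (F.opp.form k (linePoint k F 0 t)).re < 0 := by
    rw [hopp, re_natCast_mul]
    exact mul_neg_of_pos_of_neg (Nat.cast_pos.2 hk.degree_pos) ht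
  rw [h.reducedEulerMellin_of_form_eq_zero hb hk hx hΘ hv hform hre, hopp, linePoint_fst]

theorem prod_range_sub_natCast_mul_factorial {w N : ℕ} (h : w ≤ N) :
    (∏ j ∈ Finset.range w, ((j : ℂ) - N)) * (N - w).factorial = (-1) ^ w * N.factorial := by
  have hprod : ∏ j ∈ Finset.range w, ((j : ℂ) - N) = (-1) ^ w * N.descFactorial w := by
    rw [Nat.descFactorial_eq_prod_range, Nat.cast_prod, ← Finset.card_range w,
      ← Finset.prod_const, Finset.card_range, ← Finset.prod_mul_distrib]
    refine Finset.prod_congr rfl fun j hj => ?_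
    rw [Nat.cast_sub ((Finset.mem_range.1 hj).le.trans h)]
    ring
  rw [hprod, ← Nat.factorial_mul_descFactorial h, Nat.cast_mul]
  ring

theorem reducedEulerMellin_sub_column_of_linePoint (hk : IsCurve k) {F : Facet} {v : ℂ} {N : ℕ}
    {i : Fin (n + 1)} (t : ℂ)
    (h : F.weight k i ≤ N → reducedEulerMellin k Ψ F (linePoint k F (N - F.weight k i) (t - 1)) =
      (-1) ^ (N - F.weight k i) * (N - F.weight k i).factorial *
        (Complex.Gamma ((N - F.weight k i : ℕ) - degree k * (t - 1)))⁻¹ *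
        taylorCoeff (F.weight k) x (t - 1) v 0 0 (N - F.weight k i : ℕ)) :
    (∏ j ∈ Finset.range (F.weight k i), ((j : ℂ) - N)) *
      (∏ j ∈ Finset.range (F.opp.weight k i), ((j : ℂ) - (degree k * t - N))) *
      reducedEulerMellin k Ψ F (linePoint k F N t - column k i) =
      (-1) ^ N * N.factorial * (Complex.Gamma (N - degree k * t))⁻¹ *
        taylorCoeff (F.weight k) x (t - 1) v 0 0 (N - F.weight k i) := by
  rcases lt_or_ge N (F.weight k i) with hlt | hle
  · rw [Finset.prod_eq_zero (Finset.mem_range.2 hlt) (sub_self _),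
      taylorCoeff_of_neg _ _ _ _ _ _ (sub_neg.2 (Nat.cast_lt.2 hlt)), zero_mul, zero_mul, mul_zero]
  have hw : (F.weight k i : ℂ) + F.opp.weight k i = degree k :=
    mod_cast hk.weight_add_weight_opp F i
  have hΓ := inv_Gamma_neg_eq (degree k * t - N) (F.opp.weight k i)
  have harg : (F.opp.weight k i : ℂ) - (degree k * t - N) =
      (N - F.weight k i : ℕ) - degree k * (t - 1) := by
    rw [Nat.cast_sub hle]
    linear_combination hw
  have hsign : (-1 : ℂ) ^ F.weight k i * (-1) ^ (N - F.weight k i) = (-1) ^ N := by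
    rw [← pow_add, Nat.add_sub_cancel' hle]
  rw [hk.linePoint_sub_column hle, h hle, ← neg_sub (degree k * t) (N : ℂ), hΓ, harg,
    ← hsign, ← Nat.cast_sub hle]
  linear_combination (∏ j ∈ Finset.range (F.opp.weight k i), ((j : ℂ) - (degree k * t - N))) *
    (-1) ^ (N - F.weight k i) *
    (Complex.Gamma ((N - F.weight k i : ℕ) - degree k * (t - 1)))⁻¹ *
    taylorCoeff (F.weight k) x (t - 1) v 0 0 (N - F.weight k i : ℕ) *
    prod_range_sub_natCast_mul_factorial hle

theorem IsExtendedEulerMellin.reducedEulerMellin_linePoint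
    (h : IsExtendedEulerMellin k Θ lz lf Ψ) (hb : IsBranch k x Θ lz lf) (hk : IsCurve k)
    (hx : x ∈ nonzeroEnds n) (hΘ : IsComponent k x Θ) {F : Facet} {v : ℂ}
    (hv : IsVertexLog k Θ lz lf v F) (N : ℕ) (t : ℂ) :
    reducedEulerMellin k Ψ F (linePoint k F N t) =
      (-1) ^ N * N.factorial * (Complex.Gamma (N - degree k * t))⁻¹ *
        taylorCoeff (F.weight k) x t v 0 0 N := by
  induction N using Nat.strong_induction_on generalizing t with
  | _ N ih =>
    rcases Nat.eq_zero_or_pos N with rfl | hN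
    · rw [h.reducedEulerMellin_linePoint_zero hb hk hx hΘ hv, Nat.cast_zero, Nat.cast_zero,
        taylorCoeff_zero]
      simp [powDeriv]
    apply mul_left_cancel₀ (Nat.cast_ne_zero.2 hN.ne' : (N : ℂ) ≠ 0)
    have hmellin := h.form_mul_reducedEulerMellin hb hk hx hΘ F (linePoint k F N t)
    have hseries := intCast_mul_taylorCoeff (F.weight k) x t v 0 0 N
    rw [form_linePoint, form_opp_linePoint, linePoint_fst] at hmellin
    rw [Int.cast_natCast] at hseries
    rw [hmellin, mul_left_comm, hseries, Finset.mul_sum, Finset.mul_sum]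
    refine Finset.sum_congr rfl fun i _ => ?_
    rcases Nat.eq_zero_or_pos (F.weight k i) with hi | hi
    · simp only [hi, Nat.cast_zero, zero_mul, mul_zero]
    rw [reducedEulerMellin_sub_column_of_linePoint hk t
      fun _ => ih _ (Nat.sub_lt hN hi) (t - 1), taylorCoeff_zero_succ]
    ring

theorem IsVertexLog.exp_eq {v : ℂ} {F : Facet} (hv : IsVertexLog k Θ lz lf v F)
    (hb : IsBranch k x Θ lz lf) (hk : IsCurve k) (hx : x ∈ nonzeroEnds n)
    (hΘ : IsComponent k x Θ) : Complex.exp v = x F.vertex := by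
  obtain ⟨θ, hθ⟩ := hΘ.nonempty
  obtain ⟨v', hexp, hv'⟩ := hb.exists_isVertexLog hk hx hΘ F
  have := (F.tendsto_rayPoint hθ).neBot
  rw [tendsto_nhds_unique ((isVertexLog_iff hk F).1 hv) ((isVertexLog_iff hk F).1 hv'), hexp]

theorem continuous_polarSeries (w : Fin (n + 1) → ℕ) (b : Fin (n + 1)) (N : ℕ) (v : ℂ)
    (x : Fin (n + 1) → ℂ) : Continuous (polarSeries w b N v x) := by
  unfold polarSeries
  fun_prop

theorem IsCurve.dense_generic (hk : IsCurve k) (N : ℕ) :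
    Dense {t : ℂ | (∀ j : ℕ, t ≠ j) ∧ ∀ j : ℕ, degree k * t ≠ N + j} := by
  have hd : (degree k : ℂ) ≠ 0 := Nat.cast_ne_zero.2 hk.degree_pos.ne'
  have hc : ((Set.range fun j : ℕ => (j : ℂ)) ∪
      Set.range fun j : ℕ => ((N : ℂ) + j) / degree k).Countable :=
    (Set.countable_range _).union (Set.countable_range _)
  refine (hc.dense_compl ℝ).mono fun t ht => ?_
  simp only [Set.mem_compl_iff, Set.mem_union, Set.mem_range, not_or, not_exists] at ht
  exact ⟨fun j hj => ht.1 j hj.symm, fun j hj =>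
    ht.2 j ((div_eq_iff hd).2 (by rw [← hj, mul_comm]))⟩

theorem neg_one_pow_mul_Gamma_natCast_sub {t : ℂ} (ht : ∀ j : ℕ, t ≠ j) (ℓ : ℕ) :
    (-1) ^ ℓ * Complex.Gamma (ℓ - t) =
      (∏ i ∈ Finset.range ℓ, (t - i)) * Complex.Gamma (-t) := by
  have hprod : ∏ i ∈ Finset.range ℓ, (t - i) = (-1) ^ ℓ * ∏ i ∈ Finset.range ℓ, (i - t) := by
    simpa only [neg_sub, Finset.card_range] using
      Finset.prod_neg (s := Finset.range ℓ) (fun i : ℕ => (i - t : ℂ))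
  rw [Gamma_natCast_sub ht, hprod, mul_assoc]

theorem IsExtendedEulerMellin.apply_linePoint_of_generic
    (h : IsExtendedEulerMellin k Θ lz lf Ψ) (hb : IsBranch k x Θ lz lf) (hk : IsCurve k)
    (hx : x ∈ nonzeroEnds n) (hΘ : IsComponent k x Θ) {F : Facet} {v : ℂ}
    (hv : IsVertexLog k Θ lz lf v F) {N : ℕ} (hN : N ∈ F.monoid k) {t : ℂ}
    (ht : ∀ j : ℕ, t ≠ j) (ht' : ∀ j : ℕ, degree k * t ≠ N + j) :
    Ψ (linePoint k F N t) =
      (-1) ^ (N + minLength (F.weight k) N) * (N.factorial : ℂ)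
        * Complex.Gamma (minLength (F.weight k) N - t)
        / (Complex.Gamma (N - degree k * t) * F.gapProd k N * F.opp.gapProd k (degree k * t - N))
        * polarSeries (F.weight k) F.vertex N v x t := by
  have hgap : F.gapProd k N ≠ 0 := hk.gapProd_natCast_ne_zero F hN
  have hgap' : F.opp.gapProd k (degree k * t - N) ≠ 0 := by
    rw [Ne, hk.gapProd_eq_zero_iff]
    rintro ⟨κ, -, hκ⟩
    exact ht' κ (eq_add_of_sub_eq' hκ)
  have hΓ : Complex.Gamma (-t) ≠ 0 :=
    Complex.Gamma_ne_zero fun m hm => ht m (neg_injective hm)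
  have hline := h.reducedEulerMellin_linePoint hb hk hx hΘ hv N t
  rw [reducedEulerMellin, form_linePoint, form_opp_linePoint, linePoint_fst,
    ← prod_mul_polarSeries (hv.exp_eq hb hk hx hΘ)] at hline
  apply mul_left_cancel₀ (inv_ne_zero hΓ)
  apply mul_right_cancel₀ (mul_ne_zero hgap hgap')
  rw [mul_assoc, hline, pow_add, div_eq_mul_inv, mul_inv, mul_inv]
  field_simp
  linear_combination -(N.factorial * polarSeries (F.weight k) F.vertex N v x t *
    (Complex.Gamma (N - degree k * t))⁻¹) *
    neg_one_pow_mul_Gamma_natCast_sub ht (minLength (F.weight k) N)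

theorem IsExtendedEulerMellin.eq_on_polarLine (h : IsExtendedEulerMellin k Θ lz lf Ψ)
    (hb : IsBranch k x Θ lz lf) (hk : IsCurve k) (hx : x ∈ nonzeroEnds n)
    (hΘ : IsComponent k x Θ) {F : Facet} {v : ℂ} (hv : IsVertexLog k Θ lz lf v F) {N : ℕ}
    (hN : N ∈ F.monoid k) {g : ℂ → ℂ} (hg : Differentiable ℂ g)
    (hgeneric : ∀ t : ℂ, (∀ j : ℕ, t ≠ j) → (∀ j : ℕ, degree k * t ≠ N + j) →
        g t = (-1) ^ (N + minLength (F.weight k) N) * (N.factorial : ℂ)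
            * Complex.Gamma (minLength (F.weight k) N - t)
          / (Complex.Gamma (N - degree k * t) * F.gapProd k N
            * F.opp.gapProd k (degree k * t - N)))
    {β : ℂ × ℂ} (hβ : β ∈ polarLine k F N) :
    Ψ β = g β.1 * polarSeries (F.weight k) F.vertex N v x β.1 := by
  have hline : (fun t => Ψ (linePoint k F N t)) =
      fun t => g t * polarSeries (F.weight k) F.vertex N v x t :=
    Continuous.ext_on (hk.dense_generic N)
      (h.entire.comp (differentiable_linePoint F N)).continuous
      (hg.continuous.mul (continuous_polarSeries _ _ _ _ _)) fun t ⟨ht, ht'⟩ => by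
        rw [h.apply_linePoint_of_generic hb hk hx hΘ hv hN ht ht', hgeneric t ht ht']
  have hpoint := congrFun hline β.1
  rwa [← eq_linePoint hβ] at hpoint

end PolarLine

section PolarLocus

theorem exists_coe_eq_range_of_finrank_direction_eq_one {K V : Type*} [DivisionRing K]
    [AddCommGroup V] [Module K V] {L : AffineSubspace K V} (hL : Module.finrank K L.direction = 1) :
    ∃ p d : V, d ≠ 0 ∧ (L : Set V) = Set.range fun t : K => p + t • d := by
  obtain ⟨⟨d, hdL⟩, hd, hspan⟩ := finrank_eq_one_iff'.1 hL
  obtain ⟨p, hp⟩ : (L : Set V).Nonempty := L.eq_bot_or_nonempty.resolve_left fun hbot => by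
    rw [hbot, AffineSubspace.direction_bot, finrank_bot] at hL
    exact zero_ne_one hL
  refine ⟨p, d, fun h => hd (Subtype.ext h), Set.ext fun q => ?_⟩
  rw [SetLike.mem_coe, ← AffineSubspace.vsub_right_mem_direction_iff_mem hp]
  constructor
  · intro hq
    obtain ⟨t, ht⟩ := hspan ⟨q -ᵥ p, hq⟩
    exact ⟨t, (sub_eq_iff_eq_add'.1 (congrArg Subtype.val ht).symm).symm⟩
  · rintro ⟨t, rfl⟩
    rw [vsub_eq_sub, add_sub_cancel_left]
    exact L.direction.smul_mem t hdL

variable {n : ℕ} {k : Fin (n + 1) → ℕ}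

theorem Facet.form_smul (F : Facet) (t : ℂ) (β : ℂ × ℂ) : F.form k (t • β) = t * F.form k β := by
  cases F
  · rfl
  · simp only [Facet.form, Prod.smul_fst, Prod.smul_snd, smul_eq_mul]
    ring

theorem IsCurve.eq_zero_of_form_eq_zero (hk : IsCurve k) (F : Facet) {d : ℂ × ℂ}
    (h : F.form k d = 0) (h' : F.opp.form k d = 0) : d = 0 := by
  have hd : (degree k : ℂ) ≠ 0 := Nat.cast_ne_zero.2 hk.degree_pos.ne'
  have hfst : d.1 = 0 := by
    have hadd := F.form_add_form_opp (k := k) d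
    rw [h, h', add_zero] at hadd
    exact (mul_eq_zero.1 hadd.symm).resolve_left hd
  cases F
  · exact Prod.ext hfst h
  · exact Prod.ext hfst h'

theorem Facet.countable_setOf_form_eq_natCast (F : Facet) (p d : ℂ × ℂ) :
    {t : ℂ | F.form k d ≠ 0 ∧ ∃ N : ℕ, F.form k (p + t • d) = N}.Countable := by
  refine (Set.countable_range fun N : ℕ => (N - F.form k p) / F.form k d).mono ?_
  rintro t ⟨hd, N, hN⟩
  refine ⟨N, ?_⟩
  dsimp only
  rw [← hN, F.form_add, F.form_smul, add_sub_cancel_left, mul_div_cancel_right₀ _ hd]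

theorem exists_form_eq_of_forall_mem_polarLocus {p d : ℂ × ℂ}
    (h : ∀ t : ℂ, p + t • d ∈ polarLocus k) :
    ∃ F : Facet, ∃ N ∈ F.monoid k, F.form k d = 0 ∧ F.form k p = N := by
  obtain ⟨t, ht⟩ := (((Facet.origin.countable_setOf_form_eq_natCast (k := k) p d).union
    (Facet.infinity.countable_setOf_form_eq_natCast (k := k) p d)).dense_compl ℝ).nonempty
  obtain ⟨F, N, hN, hF : F.form k (p + t • d) = N⟩ := h t
  have hd : F.form k d = 0 := by
    by_contra hd
    cases F
    · exact ht (Or.inl ⟨hd, N, hF⟩)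
    · exact ht (Or.inr ⟨hd, N, hF⟩)
  rw [F.form_add, F.form_smul, hd, mul_zero, add_zero] at hF
  exact ⟨F, N, hN, hd, hF⟩

theorem IsCurve.range_eq_polarLine (hk : IsCurve k) {F : Facet} {N : ℕ} {p d : ℂ × ℂ}
    (hd : d ≠ 0) (hFd : F.form k d = 0) (hFp : F.form k p = N) :
    (Set.range fun t : ℂ => p + t • d) = polarLine k F N := by
  have hopp : F.opp.form k d ≠ 0 := fun h => hd (hk.eq_zero_of_form_eq_zero F hFd h)
  refine Set.Subset.antisymm ?_ fun q (hq : F.form k q = N) =>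
    ⟨F.opp.form k (q - p) / F.opp.form k d, Eq.symm <| sub_eq_zero.1 <|
      hk.eq_zero_of_form_eq_zero F ?_ ?_⟩
  · rintro _ ⟨t, rfl⟩
    change F.form k (p + t • d) = N
    rw [F.form_add, F.form_smul, hFd, mul_zero, add_zero, hFp]
  · rw [F.form_sub, F.form_add, F.form_smul, hFd, hq, hFp, mul_zero, add_zero, sub_self]
  · rw [F.opp.form_sub, F.opp.form_add, F.opp.form_smul, F.opp.form_sub, div_mul_cancel₀ _ hopp]
    ring

theorem IsCurve.exists_eq_polarLine (hk : IsCurve k) {L : AffineSubspace ℂ (ℂ × ℂ)}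
    (hL : Module.finrank ℂ L.direction = 1) (hpolar : (L : Set (ℂ × ℂ)) ⊆ polarLocus k) :
    ∃ F : Facet, ∃ N ∈ F.monoid k, (L : Set (ℂ × ℂ)) = polarLine k F N := by
  obtain ⟨p, d, hd, hrange⟩ := exists_coe_eq_range_of_finrank_direction_eq_one hL
  obtain ⟨F, N, hN, hFd, hFp⟩ := exists_form_eq_of_forall_mem_polarLocus fun t =>
    hpolar (hrange ▸ Set.mem_range_self t)
  exact ⟨F, N, hN, hrange.trans (hk.range_eq_polarLine hd hFd hFp)⟩

end PolarLocus

section PolarSolution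

variable {n : ℕ} {k : Fin (n + 1) → ℕ}

theorem IsCurve.sum_weight_mul_eq (hk : IsCurve k) (F : Facet) {u u' : Fin (n + 1) → ℕ}
    (hsum : ∑ i, u i = ∑ i, u' i) (hweight : ∑ i, k i * u i = ∑ i, k i * u' i) :
    ∑ i, F.weight k i * u i = ∑ i, F.weight k i * u' i := by
  cases F with
  | origin => exact hweight
  | infinity =>
    have hadd : ∀ u : Fin (n + 1) → ℕ,
        ∑ i, Facet.infinity.weight k i * u i + ∑ i, k i * u i = degree k * ∑ i, u i := fun u => by
      rw [← Finset.sum_add_distrib, Finset.mul_sum]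
      exact Finset.sum_congr rfl fun i _ => by
        rw [← add_mul, ← hk.weight_add_weight_opp .infinity i, Facet.opp, Facet.weight]
    have hu := hadd u
    rw [hsum, hweight, ← hadd u'] at hu
    exact Nat.add_right_cancel hu

theorem IsCurve.isSolution_polarSeries (hk : IsCurve k) (F : Facet) (N : ℕ)
    {U : Set (Fin (n + 1) → ℂ)} {v : (Fin (n + 1) → ℂ) → ℂ} (hv : IsLogBranch F.vertex U v)
    {β : ℂ × ℂ} (hβ : β ∈ polarLine k F N) :
    IsSolution k β U (fun x => polarSeries (F.weight k) F.vertex N (v x) x β.1) where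
  analytic x hx := (analyticAt_polarSeries N (hv.analyticAt hx) (hv.ne_zero hx)).comp₂
    analyticAt_id analyticAt_const
  toric u u' hsum hweight x hx := hv.monomialDeriv_polarSeries_eq (hk.weight_eq_zero_iff F) N β.1
    hsum (hk.sum_weight_mul_eq F hsum hweight) hx
  euler_one x hx := hv.sum_mul_partialDeriv_polarSeries (hk.weight_eq_zero_iff F) N β.1 hx
  euler_two x hx := by
    have hone := hv.sum_mul_partialDeriv_polarSeries (hk.weight_eq_zero_iff F) N β.1 hx
    have hweight :=
      hv.sum_weight_mul_partialDeriv_polarSeries (hk.weight_eq_zero_iff F) N β.1 hx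
    rw [← show F.form k β = N from hβ] at hweight
    cases F with
    | origin => exact hweight
    | infinity =>
      have hterm : ∀ j, (k j : ℂ) = degree k - Facet.infinity.weight k j := fun j => by
        rw [Facet.weight, Nat.cast_sub (hk.le_degree j), sub_sub_cancel]
      simp only [hterm, sub_mul, Finset.sum_sub_distrib, hweight]
      simp only [mul_assoc, ← Finset.mul_sum, hone, Facet.form]
      ring

end PolarSolution

end ToricCurve

theorem mainTheorem5 {n : ℕ} (k : Fin (n + 1) → ℕ) (hk : IsCurve k)
    (L : AffineSubspace ℂ (ℂ × ℂ)) (hL : Module.finrank ℂ L.direction = 1)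
    (hpolar : (L : Set (ℂ × ℂ)) ⊆ polarLocus k) :
    ∃ (F : Facet) (N : ℕ) (h : ℂ → ℂ),
      N ∈ F.monoid k ∧ (L : Set (ℂ × ℂ)) = polarLine k F N ∧
      -- the removed factor `h` is entire on `L`, with an explicit generic value
      Differentiable ℂ h ∧
      (∀ t : ℂ, (∀ j : ℕ, t ≠ j) → (∀ j : ℕ, degree k * t ≠ N + j) →
        h t = (-1) ^ (N + minLength (F.weight k) N) * (N.factorial : ℂ)
            * Complex.Gamma (minLength (F.weight k) N - t)
          / (Complex.Gamma (N - degree k * t) * F.gapProd k N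
            * F.opp.gapProd k (degree k * t - N))) ∧
      (∀ x ∈ nonzeroEnds n,
        -- for each component and each branch, the extended Euler–Mellin integral exists, is
        -- unique, and equals `h` times the series on `L`
        (∀ Θ lz lf, IsComponent k x Θ → IsBranch k x Θ lz lf →
          (∃! Ψ, IsExtendedEulerMellin k Θ lz lf Ψ) ∧
          (∃ v, Complex.exp v = x F.vertex ∧ IsVertexLog k Θ lz lf v F) ∧
          ∀ Ψ v, IsExtendedEulerMellin k Θ lz lf Ψ → IsVertexLog k Θ lz lf v F →
            ∀ β ∈ L, Ψ β = h β.1 * polarSeries (F.weight k) F.vertex N v x β.1) ∧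
        -- for each logarithm of the vertex coefficient, all components have compatible branches
        (∀ v, Complex.exp v = x F.vertex → ∀ Θ, IsComponent k x Θ →
          ∃ lz lf, IsBranch k x Θ lz lf ∧ IsVertexLog k Θ lz lf v F) ∧
        -- all extended Euler–Mellin integrals with compatible branches coincide on `L`
        (∀ v Θ lz lf Ψ Θ' lz' lf' Ψ',
          IsComponent k x Θ → IsBranch k x Θ lz lf → IsVertexLog k Θ lz lf v F →
          IsExtendedEulerMellin k Θ lz lf Ψ →
          IsComponent k x Θ' → IsBranch k x Θ' lz' lf' → IsVertexLog k Θ' lz' lf' v F →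
          IsExtendedEulerMellin k Θ' lz' lf' Ψ' →
          ∀ β ∈ L, Ψ β = Ψ' β)) ∧
      -- for each local branch of the logarithm of the vertex coefficient, the series is jointly
      -- analytic, solves the hypergeometric system, and is not identically zero in `x`
      (∀ (U : Set (Fin (n + 1) → ℂ)) (v : (Fin (n + 1) → ℂ) → ℂ),
        IsOpen U → U.Nonempty → U ⊆ nonzeroEnds n → ContinuousOn v U →
        (∀ x ∈ U, Complex.exp (v x) = x F.vertex) →
        AnalyticOnNhd ℂ
          (fun q : (Fin (n + 1) → ℂ) × ℂ =>
            polarSeries (F.weight k) F.vertex N (v q.1) q.1 q.2) (U ×ˢ Set.univ) ∧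
        ∀ β ∈ L,
          IsSolution k β U (fun x => polarSeries (F.weight k) F.vertex N (v x) x β.1) ∧
          ∃ x ∈ U, polarSeries (F.weight k) F.vertex N (v x) x β.1 ≠ 0) := by
  obtain ⟨F, N, hN, hLN⟩ := hk.exists_eq_polarLine hL hpolar
  obtain ⟨h, hdiff, hval⟩ := hk.exists_entire_factor F hN
  have hmem : ∀ β ∈ L, β ∈ polarLine k F N := fun β hβ => hLN ▸ (SetLike.mem_coe.2 hβ)
  refine ⟨F, N, h, hN, hLN, hdiff, hval, fun x hx => ⟨fun Θ lz lf hΘ hb => ⟨?_, ?_, ?_⟩, ?_, ?_⟩,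
    fun U v hU hne _ hv hexp => ?_⟩
  · obtain ⟨Ψ, hΨ⟩ := hb.exists_isExtendedEulerMellin hk hx hΘ
    exact ⟨Ψ, hΨ, fun Ψ' hΨ' => hΨ'.unique hk hΘ hΨ⟩
  · exact hb.exists_isVertexLog hk hx hΘ F
  · exact fun Ψ v hΨ hv β hβ => hΨ.eq_on_polarLine hb hk hx hΘ hv hN hdiff hval (hmem β hβ)
  · exact fun v hv Θ hΘ => exists_isBranch_isVertexLog hk hx hΘ F hv
  · intro v Θ lz lf Ψ Θ' lz' lf' Ψ' hΘ hb hv hΨ hΘ' hb' hv' hΨ' β hβ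
    rw [hΨ.eq_on_polarLine hb hk hx hΘ hv hN hdiff hval (hmem β hβ),
      hΨ'.eq_on_polarLine hb' hk hx hΘ' hv' hN hdiff hval (hmem β hβ)]
  · have hlog : IsLogBranch F.vertex U v := ⟨hU, hv, hexp⟩
    exact ⟨hlog.analyticOnNhd_polarSeries N, fun β hβ =>
      ⟨hk.isSolution_polarSeries F N hlog (hmem β hβ),
        hlog.exists_polarSeries_ne_zero hne (hk.weight_eq_zero_iff F) hN β.1⟩⟩
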